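/- **Setting.** Let $1\le k_1<k_2$, $D_1,D_2\ge2$ and $\lambda_1,\lambda_2\ge 0$ be integers, and let $\delta^{(1)}_{\ell_1}$ ($1\le\ell_1\le D_1$), $\delta^{(2)}_{\ell_2}$ ($1\le\ell_2\le D_2$), $\Delta_{\ell_1\ell_2}$ be non-negative integers with $\delta^{(1)}_{D_1}+\delta^{(2)}_{D_2}\ge1$, $$\Delta_{D_1D_2}=\lambda_1k_1\delta^{(1)}_{D_1}+\lambda_2k_2\delta^{(2)}_{D_2},\qquad \lambda_1k_1<\lambda_2k_2,$$ and, for all $1\le\ell_1\le D_1-1$, $1\le\ell_2\le D_2-1$ (the range of all indices $\ell_1,\ell_2$ below), $$\Delta_{\ell_1\ell_2}>\lambda_1k_1\delta^{(1)}_{\ell_1}+\lambda_2k_2\delta^{(2)}_{\ell_2},\qquad k_1\delta^{(1)}_{\ell_1}+k_2\delta^{(2)}_{\ell_2}\le k_1\delta^{(1)}_{D_1}+k_2\delta^{(2)}_{D_2}.$$ Let $Q,R_{D_1D_2},R_{\ell_1\ell_2}\in\mathbb C[X]$ with $\deg R_{\ell_1\ell_2}\le\deg R_{D_1D_2}$,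 $R_{D_1D_2}(im)\ne0$ for $m\in\mathbb R$, and such that $Q(im)/R_{D_1D_2}(im)$, $m\in\mathbb R$, stays in a sectorial annulus $\{r^1\le|z|\le r^2,\ \arg z\in(\alpha,\beta_0)\}$, $0<r^1<r^2$, $\alpha<\beta_0$. Let $\beta,\nu,\epsilon_0>0$, $\mu>1+\deg R_{\ell_1\ell_2}$ for all $\ell_1,\ell_2$, and $k_1<k'<k_2$ be real numbers. Write $D(0,r)$ for the open disc, $H_\beta=\{|\mathrm{Im}\,z|<\beta\}$ and $\mathcal F^{-1}(g)(z)=(2\pi)^{-1/2}\int_{\mathbb R}g(m)e^{izm}\,dm$. Let $c_{\ell_1\ell_2}(z,\epsilon)=\mathcal F^{-1}(m\mapsto C_{\ell_1\ell_2}(m,\epsilon))(z)$ be holomorphic on $H_\beta\times D(0,\epsilon_0)$, where $m\mapsto C_{\ell_1\ell_2}(m,\epsilon)$ is continuous and $\sup_{\epsilon\in D(0,\epsilon_0),\,m\in\mathbb R}(1+|m|)^\mu e^{\beta|m|}|C_{\ell_1\ell_2}(m,\epsilon)|<\infty$. Put $\Omega(u,T_1,T_2)=\exp(-(u/T_1)^{k_1}-(u/T_2)^{k_2})$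 and $L_\gamma=(0,\infty)e^{i\gamma}$. Call $\psi:\mathbb C\times\mathbb R\times D(0,\epsilon_0)\to\mathbb C$ a *profile of size* $C_\psi>0$ if it is entire in $\tau$, continuous in $m$, holomorphic in $\epsilon$, and $$|\psi(\tau,m,\epsilon)|\le C_\psi(1+|m|)^{-\mu}e^{-\beta|m|}e^{\nu|\tau|^{k'}}|\tau| .$$ For such $\psi$ and $T_1,T_2\neq0$ let $F(T_1,T_2,m,\epsilon)=\int_{L_\gamma}\psi(u,m,\epsilon)\Omega(u,T_1,T_2)\frac{du}u$, where $|\gamma-\arg T_2|<\frac{\pi}{2k_2}$ (the value does not depend on such a $\gamma$), and $f(t_1,t_2,z,\epsilon)=\mathcal F^{-1}(m\mapsto F(\epsilon^{\lambda_1}t_1,\epsilon^{\lambda_2}t_2,m,\epsilon))(z)$. The main equation is $$Q(\partial_z)u=\epsilon^{\Delta_{D_1D_2}}(t_1^{k_1+1}\partial_{t_1})^{\delta^{(1)}_{D_1}}(t_2^{k_2+1}\partial_{t_2})^{\delta^{(2)}_{D_2}}R_{D_1D_2}(\partial_z)u+\sum_{\ell_1,\ell_2}\epsilon^{\Delta_{\ell_1\ell_2}}(t_1^{k_1+1}\partial_{t_1})^{\delta^{(1)}_{\ell_1}}(t_2^{k_2+1}\partial_{t_2})^{\delta^{(2)}_{\ell_2}}c_{\ell_1\ell_2}(z,\epsilon)R_{\ell_1\ell_2}(\partial_z)u+f\qquad(\ast)$$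 with zero initial data at $t_1=0$ and at $t_2=0$. Its associated equation for $w(\tau,m)$ is, with $P_m(\tau)=Q(im)-(k_1\tau^{k_1})^{\delta^{(1)}_{D_1}}(k_2\tau^{k_2})^{\delta^{(2)}_{D_2}}R_{D_1D_2}(im)$, $$P_m(\tau)w(\tau,m)=\sum_{\ell_1,\ell_2}\epsilon^{\Delta_{\ell_1\ell_2}-\lambda_1k_1\delta^{(1)}_{\ell_1}-\lambda_2k_2\delta^{(2)}_{\ell_2}}(k_1\tau^{k_1})^{\delta^{(1)}_{\ell_1}}(k_2\tau^{k_2})^{\delta^{(2)}_{\ell_2}}\frac1{(2\pi)^{1/2}}\int_{\mathbb R}C_{\ell_1\ell_2}(m-m_1,\epsilon)R_{\ell_1\ell_2}(im_1)w(\tau,m_1)dm_1+\psi(\tau,m,\epsilon).\qquad(\ast\ast)$$ Let $\iota_2\ge2$ and $\rho>0$. For $0\le h\le\iota_2-1$ (indices are cyclic modulo $\iota_2$) let $S_h$ be an unbounded open sector with vertex $0$, bisecting direction $d_h\in\mathbb R$ and opening in $(0,2\pi-\pi/k_2]$ such that, for some $\mathfrak m>0$, $|\tau-q|\ge\mathfrak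 m(1+|\tau|)$ for all $\tau\in S_h\cup D(0,\rho)$, $m\in\mathbb R$ and all roots $q$ of $P_m$. Let $\mathrm{Exp}^{d_h}$ be the space of continuous functions $w$ on $(S_h\cup\overline D(0,\rho))\times\mathbb R$, holomorphic in $\tau\in S_h\cup D(0,\rho)$, with finite norm $\|w\|=\sup(1+|m|)^\mu e^{\beta|m|}e^{-\nu|\tau|^{k'}}|\tau|^{-1}|w(\tau,m)|$ (in particular $w(0,m)=0$). **Theorem.** For every $\varpi>0$ there are $\epsilon_1\in(0,\epsilon_0]$ and $\xi_\psi>0$ such that for every profile $\psi$ of size $C_\psi\le\xi_\psi$ the following holds. For all $h$ and $\epsilon\in D(0,\epsilon_1)$, $(\ast\ast)$ has a solution $\omega_{d_h}(\cdot,\cdot,\epsilon)\in\mathrm{Exp}^{d_h}$ of norm at most $\varpi$, and only one. Suppose further that: * $\mathcal T_1$ is a bounded and $\mathcal T_2$ an unbounded open sector with vertex $0$, and $(\mathcal E^\infty_h)_{0\le h\le\iota_2-1}$ is a good covering in $\mathbb C^\star$: open sectors with vertex $0$ contained in $D(0,\epsilon_1)$, consecutive ones intersect, any three different ones have empty intersection,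 and their union covers a punctured disc centred at $0$; * $\{\mathcal T_1,\mathcal T_2,(\mathcal E_h^\infty),(S_h)\}$ is admissible: there is $\delta>0$ and, for all $h$, $\epsilon\in\mathcal E^\infty_h$, $t_1\in\mathcal T_1$, $t_2\in\mathcal T_2$, a chosen $\xi_h=\xi_h(t_1,t_2,\epsilon)\in\mathbb R$ with $e^{i\xi_h}\in S_h$ and $k_j\xi_h-k_j\arg(\epsilon^{\lambda_j}t_j)\in(-\frac\pi2+\delta,\frac\pi2-\delta)$, $j=1,2$, for some determination of each argument; * $\mu_2>\lambda_2$ is an integer with $\lambda_1k_1>(\mu_2-\lambda_2)\left(\frac1{k'}-\frac1{k_2}\right)^{-1}$, $\chi_2^\infty=\{r<|x_2|<R,\ \arg x_2\in(a,b)\}$ with $0<r<R$, $a<b$, and $\theta_h\in\mathbb R$ are such that $x_2\epsilon^{-\mu_2}e^{i\theta_h}\in\mathcal T_2$ for all $h$, $x_2\in\chi^\infty_2$, $\epsilon\in\mathcal E^\infty_h$. Put $\mathcal T_{2,\epsilon,\mu_2}=\{x_2\epsilon^{-\mu_2}e^{i\theta_h}:x_2\in\chi_2^\infty\}$. Then,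 for every $h$, $0<\beta'<\beta$ and $\epsilon\in\mathcal E_h^\infty$, the integrals in $$u_{d_h}(t_1,t_2,z,\epsilon)=\frac1{(2\pi)^{1/2}}\int_{-\infty}^\infty\int_{L_{\xi_h}}\omega_{d_h}(u,m,\epsilon)\exp\left(-\left(\frac u{\epsilon^{\lambda_1}t_1}\right)^{k_1}-\left(\frac u{\epsilon^{\lambda_2}t_2}\right)^{k_2}\right)e^{izm}\,\frac{du}u\,dm$$ converge for $(t_1,t_2,z)\in\mathcal T_1\times\mathcal T_2\times H_{\beta'}$, and $(t_1,t_2,z)\mapsto u_{d_h}(t_1,t_2,z,\epsilon)$ is a bounded holomorphic function on $\mathcal T_1\times\mathcal T_{2,\epsilon,\mu_2}\times H_{\beta'}$ which solves $(\ast)$ there; moreover $u_{d_h}\to0$ as $t_1\to0$ in $\mathcal T_1$ (for fixed $t_2\in\mathcal T_2$, $z\in H_{\beta'}$), and as $t_2\to0$ in $\mathcal T_2$ (for fixed $t_1\in\mathcal T_1$, $z\in H_{\beta'}$). Furthermore, for every $h$ and $\beta'$ there are $\tilde C,\tilde D>0$ such that for all $\epsilon\in\mathcal E_h^\infty\cap\mathcal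 E_{h+1}^\infty$ $$\sup_{t_1\in\mathcal T_1,\,x_2\in\chi_2^\infty,\,z\in H_{\beta'}}\left|u_{d_{h+1}}(t_1,x_2\epsilon^{-\mu_2}e^{i\theta_h},z,\epsilon)-u_{d_h}(t_1,x_2\epsilon^{-\mu_2}e^{i\theta_h},z,\epsilon)\right|\le\tilde C\exp\left(-\frac{\tilde D}{|\epsilon|^{\lambda_1k_1}}\right).$$ -/

import Mathlib

open Complex MeasureTheory Set Filter Topology Polynomial

noncomputable section

namespace InnerSol

/-- The bounded open sector with vertex `0`, bisecting direction `d`, opening `θ`, radius `R`. -/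
def bddSector (d θ R : ℝ) : Set ℂ :=
  {u | ∃ r φ : ℝ, 0 < r ∧ r < R ∧ |φ - d| < θ / 2 ∧ u = r * exp (φ * I)}

/-- The unbounded open sector with vertex `0`, bisecting direction `d`, opening `θ`. -/
def infSector (d θ : ℝ) : Set ℂ :=
  {u | ∃ r φ : ℝ, 0 < r ∧ |φ - d| < θ / 2 ∧ u = r * exp (φ * I)}

def IsBddSector (T : Set ℂ) : Prop :=
  ∃ d θ R : ℝ, 0 < θ ∧ θ ≤ 2 * Real.pi ∧ 0 < R ∧ T = bddSector d θ R

def IsInfSector (T : Set ℂ) : Prop :=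
  ∃ d θ : ℝ, 0 < θ ∧ θ ≤ 2 * Real.pi ∧ T = infSector d θ

/-- The horizontal strip `|Im z| < β`. -/
def strip (β : ℝ) : Set ℂ := {z | |z.im| < β}

/-- The sectorial set `r < |x| < R`, `arg x ∈ (a, b)` (for some determination of the argument). -/
def annularSector (r R a b : ℝ) : Set ℂ :=
  {x | ∃ s φ : ℝ, r < s ∧ s < R ∧ a < φ ∧ φ < b ∧ x = s * exp (φ * I)}

/-- Inverse Fourier transform `(2π)^{-1/2} ∫ f(m) e^{izm} dm`. -/
def invFourier (f : ℝ → ℂ) (z : ℂ) : ℂ :=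
  ((Real.sqrt (2 * Real.pi) : ℝ) : ℂ)⁻¹ * ∫ m : ℝ, f m * exp (I * z * m)

/-- `Ω(u, T₁, T₂) = exp (-(u/T₁)^{k₁} - (u/T₂)^{k₂})`. -/
def kernel (k₁ k₂ : ℕ) (u T₁ T₂ : ℂ) : ℂ :=
  exp (-(u / T₁) ^ k₁ - (u / T₂) ^ k₂)

/-- `g(u) Ω(u, T₁, T₂) du/u` on the half line `u = r e^{iγ}`, where `du/u = dr/r`. -/
def rayIntegrand (k₁ k₂ : ℕ) (g : ℂ → ℂ) (γ : ℝ) (T₁ T₂ : ℂ) (r : ℝ) : ℂ :=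
  g (r * exp (γ * I)) * kernel k₁ k₂ (r * exp (γ * I)) T₁ T₂ / r

/-- The Laplace-like integral `∫_{L_γ} g(u) Ω(u, T₁, T₂) du/u`, `L_γ = (0,∞) e^{iγ}`. -/
def laplaceRay (k₁ k₂ : ℕ) (g : ℂ → ℂ) (γ : ℝ) (T₁ T₂ : ℂ) : ℂ :=
  ∫ r in Ioi (0 : ℝ), rayIntegrand k₁ k₂ g γ T₁ T₂ r

/-- `t₁^{k+1} ∂_{t₁}`. -/
def opT1 (k : ℕ) (u : ℂ → ℂ → ℂ → ℂ) : ℂ → ℂ → ℂ → ℂ :=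
  fun t₁ t₂ z => t₁ ^ (k + 1) * deriv (fun s => u s t₂ z) t₁

/-- `t₂^{k+1} ∂_{t₂}`. -/
def opT2 (k : ℕ) (u : ℂ → ℂ → ℂ → ℂ) : ℂ → ℂ → ℂ → ℂ :=
  fun t₁ t₂ z => t₂ ^ (k + 1) * deriv (fun s => u t₁ s z) t₂

/-- `A(∂_z)` for a polynomial `A`. -/
def opZ (A : ℂ[X]) (u : ℂ → ℂ → ℂ → ℂ) : ℂ → ℂ → ℂ → ℂ :=
  fun t₁ t₂ z => A.sum fun n a => a * iteratedDeriv n (fun w => u t₁ t₂ w) z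

/-- The elements of the equation other than the forcing term. `R D₁ D₂` is the leading
polynomial, `C l₁ l₂ m ε` the Fourier transform of the coefficient `c_{l₁ l₂}(z, ε)`. -/
structure MainData where
  (k₁ k₂ D₁ D₂ lam₁ lam₂ : ℕ)
  (δ₁ δ₂ : ℕ → ℕ)
  (Dlt : ℕ → ℕ → ℕ)
  (Q : ℂ[X])
  (R : ℕ → ℕ → ℂ[X])
  (C : ℕ → ℕ → ℝ → ℂ → ℂ)
  (β μ ν k' ε₀ : ℝ)

namespace MainData

variable (P : MainData)

/-- The coefficient `c_{l₁ l₂}(z, ε)`. -/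
def c (l₁ l₂ : ℕ) (z ε : ℂ) : ℂ := invFourier (fun m => P.C l₁ l₂ m ε) z

/-- The standing assumptions on the elements of the equation. -/
structure Valid : Prop where
  one_le_k₁ : 1 ≤ P.k₁
  k₁_lt_k₂ : P.k₁ < P.k₂
  two_le_D₁ : 2 ≤ P.D₁
  two_le_D₂ : 2 ≤ P.D₂
  Dlt_top : P.Dlt P.D₁ P.D₂
    = P.lam₁ * P.k₁ * P.δ₁ P.D₁ + P.lam₂ * P.k₂ * P.δ₂ P.D₂
  lam_lt : P.lam₁ * P.k₁ < P.lam₂ * P.k₂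
  /-- the leading term does involve a time derivative -/
  top_order_pos : 0 < P.δ₁ P.D₁ + P.δ₂ P.D₂
  Dlt_gt : ∀ l₁ ∈ Finset.Ico 1 P.D₁, ∀ l₂ ∈ Finset.Ico 1 P.D₂,
    P.lam₁ * P.k₁ * P.δ₁ l₁ + P.lam₂ * P.k₂ * P.δ₂ l₂ < P.Dlt l₁ l₂
  order_le : ∀ l₁ ∈ Finset.Ico 1 P.D₁, ∀ l₂ ∈ Finset.Ico 1 P.D₂,
    P.k₁ * P.δ₁ l₁ + P.k₂ * P.δ₂ l₂ ≤ P.k₁ * P.δ₁ P.D₁ + P.k₂ * P.δ₂ P.D₂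
  R_top_ne : ∀ m : ℝ, (P.R P.D₁ P.D₂).eval (I * m) ≠ 0
  /-- `Q(im)/R_{D₁D₂}(im)` stays in a sectorial annulus -/
  quotient_mem : ∃ r₁ r₂ a b : ℝ, 0 < r₁ ∧ r₁ < r₂ ∧ a < b ∧ ∀ m : ℝ, ∃ s φ : ℝ,
    r₁ ≤ s ∧ s ≤ r₂ ∧ a < φ ∧ φ < b ∧
      P.Q.eval (I * m) / (P.R P.D₁ P.D₂).eval (I * m) = s * exp (φ * I)
  deg_le : ∀ l₁ ∈ Finset.Ico 1 P.D₁, ∀ l₂ ∈ Finset.Ico 1 P.D₂,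
    (P.R l₁ l₂).natDegree ≤ (P.R P.D₁ P.D₂).natDegree
  ε₀_pos : 0 < P.ε₀
  β_pos : 0 < P.β
  ν_pos : 0 < P.ν
  μ_gt : ∀ l₁ ∈ Finset.Ico 1 P.D₁, ∀ l₂ ∈ Finset.Ico 1 P.D₂,
    1 + ((P.R l₁ l₂).natDegree : ℝ) < P.μ
  k₁_lt_k' : (P.k₁ : ℝ) < P.k'
  k'_lt_k₂ : P.k' < P.k₂
  /-- `m ↦ C_{l₁l₂}(m, ε)` lies in `E_{(β,μ)}` with norm bounded uniformly in `ε` -/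
  C_cont : ∀ l₁ ∈ Finset.Ico 1 P.D₁, ∀ l₂ ∈ Finset.Ico 1 P.D₂,
    ∀ ε ∈ Metric.ball (0 : ℂ) P.ε₀, Continuous fun m => P.C l₁ l₂ m ε
  C_bound : ∀ l₁ ∈ Finset.Ico 1 P.D₁, ∀ l₂ ∈ Finset.Ico 1 P.D₂, ∃ B : ℝ, 0 < B ∧
    ∀ ε ∈ Metric.ball (0 : ℂ) P.ε₀, ∀ m : ℝ,
      (1 + |m|) ^ P.μ * Real.exp (P.β * |m|) * ‖P.C l₁ l₂ m ε‖ ≤ B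
  c_holo : ∀ l₁ ∈ Finset.Ico 1 P.D₁, ∀ l₂ ∈ Finset.Ico 1 P.D₂,
    DifferentiableOn ℂ (fun p : ℂ × ℂ => P.c l₁ l₂ p.1 p.2)
      (strip P.β ×ˢ Metric.ball (0 : ℂ) P.ε₀)

/-- The function `ψ(τ, m, ε)` from which the forcing term is built. -/
structure IsForcingProfile (Cψ : ℝ) (ψ : ℂ → ℝ → ℂ → ℂ) : Prop where
  entire : ∀ m : ℝ, ∀ ε ∈ Metric.ball (0 : ℂ) P.ε₀, Differentiable ℂ fun τ => ψ τ m ε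
  cont : ∀ τ : ℂ, ∀ ε ∈ Metric.ball (0 : ℂ) P.ε₀, Continuous fun m => ψ τ m ε
  holo : ∀ (τ : ℂ) (m : ℝ), DifferentiableOn ℂ (fun ε => ψ τ m ε) (Metric.ball 0 P.ε₀)
  bound : ∀ (τ : ℂ) (m : ℝ), ∀ ε ∈ Metric.ball (0 : ℂ) P.ε₀,
    ‖ψ τ m ε‖ ≤ Cψ / (1 + |m|) ^ P.μ * Real.exp (-P.β * |m|)
      * Real.exp (P.ν * ‖τ‖ ^ P.k') * ‖τ‖

/-- `F(T₁, T₂, m, ε) = ∫_{L_γ} ψ(u, m, ε) Ω(u, T₁, T₂) du/u` for `T₁, T₂ ≠ 0`. The half line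
turns with `T₂`: every `γ` with `|γ - arg T₂| < π/(2 k₂)` gives the same value, and this is the
choice `γ = arg T₂`. -/
def F (ψ : ℂ → ℝ → ℂ → ℂ) (T₁ T₂ : ℂ) (m : ℝ) (ε : ℂ) : ℂ :=
  laplaceRay P.k₁ P.k₂ (fun τ => ψ τ m ε) (arg T₂) T₁ T₂

/-- The forcing term. -/
def f (ψ : ℂ → ℝ → ℂ → ℂ) (t₁ t₂ z ε : ℂ) : ℂ :=
  invFourier (fun m => P.F ψ (ε ^ P.lam₁ * t₁) (ε ^ P.lam₂ * t₂) m ε) z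

/-- The main partial differential equation, for fixed `ε`, at the point `(t₁, t₂, z)`. -/
def SolvesAt (ψ : ℂ → ℝ → ℂ → ℂ) (ε : ℂ) (u : ℂ → ℂ → ℂ → ℂ) (t₁ t₂ z : ℂ) : Prop :=
  opZ P.Q u t₁ t₂ z =
    ε ^ P.Dlt P.D₁ P.D₂ *
      ((opT1 P.k₁)^[P.δ₁ P.D₁] ((opT2 P.k₂)^[P.δ₂ P.D₂] (opZ (P.R P.D₁ P.D₂) u))) t₁ t₂ z
    + ∑ l₁ ∈ Finset.Ico 1 P.D₁, ∑ l₂ ∈ Finset.Ico 1 P.D₂,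
        ε ^ P.Dlt l₁ l₂ *
          ((opT1 P.k₁)^[P.δ₁ l₁] ((opT2 P.k₂)^[P.δ₂ l₂]
            (fun s₁ s₂ w => P.c l₁ l₂ w ε * opZ (P.R l₁ l₂) u s₁ s₂ w))) t₁ t₂ z
    + P.f ψ t₁ t₂ z ε

/-- `P_m(τ)`. -/
def Pm (m : ℝ) (τ : ℂ) : ℂ :=
  P.Q.eval (I * m) - (P.k₁ * τ ^ P.k₁) ^ P.δ₁ P.D₁ * (P.k₂ * τ ^ P.k₂) ^ P.δ₂ P.D₂
    * (P.R P.D₁ P.D₂).eval (I * m)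

/-- The unbounded sector with bisecting direction `d` and opening `θ`, and the disc of radius `ρ`,
stay away from all the roots of all the polynomials `P_m`. -/
def AvoidsRoots (ρ d θ : ℝ) : Prop :=
  ∃ 𝔪 : ℝ, 0 < 𝔪 ∧ ∀ (m : ℝ) (q : ℂ), P.Pm m q = 0 →
    ∀ τ ∈ infSector d θ ∪ Metric.ball 0 ρ, 𝔪 * (1 + ‖τ‖) ≤ ‖τ - q‖

/-- `h` belongs to the closed ball of radius `B` of the Banach space `Exp^d_{(ν,β,μ,k')}` of
functions on `(S_d ∪ D̄(0,ρ)) × ℝ`, `S_d` of opening `θ`. -/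
structure InExpBall (ρ d θ B : ℝ) (h : ℂ → ℝ → ℂ) : Prop where
  cont : ContinuousOn (fun p : ℂ × ℝ => h p.1 p.2)
    ((infSector d θ ∪ Metric.closedBall 0 ρ) ×ˢ univ)
  holo : ∀ m : ℝ, DifferentiableOn ℂ (fun τ => h τ m) (infSector d θ ∪ Metric.ball 0 ρ)
  bound : ∀ τ ∈ infSector d θ ∪ Metric.closedBall 0 ρ, ∀ m : ℝ,
    (1 + |m|) ^ P.μ * Real.exp (P.β * |m|) * Real.exp (-P.ν * ‖τ‖ ^ P.k') * ‖h τ m‖ ≤ B * ‖τ‖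

/-- The auxiliary convolution equation in the Borel plane, for fixed `ε`, on `G × ℝ`. -/
def SolvesBorel (ψ : ℂ → ℝ → ℂ → ℂ) (ε : ℂ) (G : Set ℂ) (w : ℂ → ℝ → ℂ) : Prop :=
  ∀ τ ∈ G, ∀ m : ℝ,
    P.Pm m τ * w τ m =
      ∑ l₁ ∈ Finset.Ico 1 P.D₁, ∑ l₂ ∈ Finset.Ico 1 P.D₂,
        ε ^ (P.Dlt l₁ l₂ - (P.lam₁ * P.k₁ * P.δ₁ l₁ + P.lam₂ * P.k₂ * P.δ₂ l₂))
          * (P.k₁ * τ ^ P.k₁) ^ P.δ₁ l₁ * (P.k₂ * τ ^ P.k₂) ^ P.δ₂ l₂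
          * (((Real.sqrt (2 * Real.pi) : ℝ) : ℂ)⁻¹ *
              ∫ m₁ : ℝ, P.C l₁ l₂ (m - m₁) ε * (P.R l₁ l₂).eval (I * m₁) * w τ m₁)
      + ψ τ m ε

/-- `w` is the solution of the auxiliary equation on `S_d ∪ D̄(0,ρ)` in the ball of radius `B`. -/
structure IsBorelSolution (ψ : ℂ → ℝ → ℂ → ℂ) (ε : ℂ) (ρ d θ B : ℝ) (w : ℂ → ℝ → ℂ) : Prop where
  mem : P.InExpBall ρ d θ B w
  solves : P.SolvesBorel ψ ε (infSector d θ ∪ Metric.closedBall 0 ρ) w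
  unique : ∀ w' : ℂ → ℝ → ℂ, P.InExpBall ρ d θ B w' →
    P.SolvesBorel ψ ε (infSector d θ ∪ Metric.closedBall 0 ρ) w' →
    ∀ τ ∈ infSector d θ ∪ Metric.closedBall 0 ρ, ∀ m : ℝ, w' τ m = w τ m

/-- `ξ` is an admissible direction of integration in the sector `S` at `(t₁, t₂, ε)`:
`e^{iξ} ∈ S` and `k_j ξ - k_j arg(ε^{λ_j} t_j) ∈ (-π/2 + δ, π/2 - δ)`, `j = 1, 2`, for some
determinations `a_j` of the arguments. -/
def IsDirection (S : Set ℂ) (δ : ℝ) (t₁ t₂ ε : ℂ) (ξ : ℝ) : Prop :=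
  exp (ξ * I) ∈ S ∧
  (∃ a₁ : ℝ, ε ^ P.lam₁ * t₁ = ‖ε ^ P.lam₁ * t₁‖ * exp (a₁ * I) ∧
    P.k₁ * ξ - P.k₁ * a₁ ∈ Ioo (-(Real.pi / 2) + δ) (Real.pi / 2 - δ)) ∧
  (∃ a₂ : ℝ, ε ^ P.lam₂ * t₂ = ‖ε ^ P.lam₂ * t₂‖ * exp (a₂ * I) ∧
    P.k₂ * ξ - P.k₂ * a₂ ∈ Ioo (-(Real.pi / 2) + δ) (Real.pi / 2 - δ))

/-- `U_ξ(T₁, T₂, m, ε) = ∫_{L_ξ} w(u, m, ε) Ω(u, T₁, T₂) du/u`. -/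
def U (w : ℂ → ℝ → ℂ → ℂ) (ξ : ℝ) (T₁ T₂ : ℂ) (m : ℝ) (ε : ℂ) : ℂ :=
  laplaceRay P.k₁ P.k₂ (fun τ => w τ m ε) ξ T₁ T₂

/-- `u(t₁, t₂, z, ε) = F⁻¹(m ↦ U_ξ(ε^{λ₁} t₁, ε^{λ₂} t₂, m, ε))(z)`, with `ξ = ξ(t₁, t₂, ε)`. -/
def u (w : ℂ → ℝ → ℂ → ℂ) (ξ : ℂ → ℂ → ℂ → ℝ) (t₁ t₂ z ε : ℂ) : ℂ :=
  invFourier (fun m => P.U w (ξ t₁ t₂ ε) (ε ^ P.lam₁ * t₁) (ε ^ P.lam₂ * t₂) m ε) z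

end MainData

/-- Good covering of `ℂ*` by sectors contained in the disc of radius `ε₁`; `h + 1` is cyclic. -/
structure IsGoodCovering (ι : ℕ) [NeZero ι] (ε₁ : ℝ) (E : Fin ι → Set ℂ) : Prop where
  sector : ∀ h, IsBddSector (E h)
  subset : ∀ h, E h ⊆ Metric.ball 0 ε₁
  inter : ∀ h, (E h ∩ E (h + 1)).Nonempty
  three : ∀ h₁ h₂ h₃, h₁ ≠ h₂ → h₂ ≠ h₃ → h₁ ≠ h₃ → E h₁ ∩ E h₂ ∩ E h₃ = ∅
  cover : ∃ r : ℝ, 0 < r ∧ Metric.ball (0 : ℂ) r \ {0} ⊆ ⋃ h, E h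

/-- `t₂ = x₂ ε^{-μ₂} e^{iθ}`. -/
def innerTime (μ₂ : ℕ) (θ : ℝ) (ε x₂ : ℂ) : ℂ := x₂ / ε ^ μ₂ * exp (θ * I)

/-- `𝒯_{2,ε,μ₂}`, the image of `χ₂` under `x₂ ↦ x₂ ε^{-μ₂} e^{iθ}`. -/
def innerDomain (μ₂ : ℕ) (θ : ℝ) (χ₂ : Set ℂ) (ε : ℂ) : Set ℂ := innerTime μ₂ θ ε '' χ₂

end InnerSol

end

/-! The auxiliary equation is a linear fixed point problem. For fixed `m`, `P_m` is a binomial in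
`τ` whose roots stay at distance at least `𝔪 (1 + |τ|)`, and its leading coefficient is a multiple
of `R_{D₁D₂}(im)`. Hence `|P_m(τ)|` is bounded below by a multiple of `(1 + |τ|)^N (1 + |m|)^{deg
R_{D₁D₂}}`, where `N` is the order of the leading term (`exists_le_norm_Pm`). Dividing by `P_m` pays
for the powers of `τ` and for the power of `|m|` lost in the convolution with `R_{ℓ₁ℓ₂}`. The strict
inequality on `Δ_{ℓ₁ℓ₂}` leaves a factor `ε`, so for small `ε` the operator halves norms
(`exists_norm_borelOp_le`). A Neumann series gives the solution and iteration gives uniqueness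
(`exists_isBorelSolution`). The series is a pointwise formula in which the sector does not occur, so
a single function serves all directions at once.

To pass to the main equation, one freezes the direction `ξ`. The Laplace–Fourier transform is then
an integral of `g(m, r) exp(-A r^{k₁} - B r^{k₂} + izm)` whose exponent is linear in `(A, B, z)`; it
converges when `Re B > 0`, because `k₁` and `k'` are below `k₂`. Differentiation under the integral
(`hasFDerivAt_expIntegral`) turns `t_j^{k_j+1} ∂_{t_j}` into multiplication by a multiple of
`τ^{k_j}` and `∂_z` into multiplication by `im`. A coefficient `c_{ℓ₁ℓ₂}` becomes a convolution
(`invFourier_mul_eq`). Freezing is legitimate since the integral does not change between two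
directions of the sector that are both admissible for `T₂` (`laplaceRay_eq_of_isRay`); the bound on
the opening makes the angle between them stay in the sector. The main equation is then the transform
of the auxiliary one (`solvesAt_fieldTransform`).

For the estimates, Young's inequality absorbs `exp(ν r^{k'})` into half of the decay `exp(-c
(r/|T₂|)^{k₂})` at the price `exp(K |T₂|^κ)`, `κ = (1/k' - 1/k₂)⁻¹` (`exists_mul_rpow_le_rpow_add`).
What remains is at most linear in `|T₁|`, and also in `|T₂|`; this gives boundedness and the zero
initial data. For two consecutive directions both half lines are cut at radius `ρ/2`. The inner
segments differ by an arc, by Cauchy's theorem in the disc, and the arc and the tails are of order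
`exp(-c (ρ/|T₁|)^{k₁})`, up to the price above (`exists_norm_laplaceRay_sub_le`). With `|T₁|` of
order at most `|ε|^{λ₁}` and `|T₂|` of order `|ε|^{-(μ₂-λ₂)}`, the condition `(μ₂ - λ₂) κ < λ₁ k₁`
says that the decay wins (`exists_mul_exp_le_exp_neg`). -/

namespace InnerSol

/-! ### Elementary inequalities -/

/-- Young's inequality with exponents `q/p` and `q/(q-p)`, applied to `ν r^p = (b^{p/q} (r/T)^p) ·
(ν b^{-p/q} T^p)`. The constant `K` does not depend on `T`, so the dependence of later bounds on
`|T₂|` is explicit. -/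
theorem exists_mul_rpow_le_rpow_add {p q ν b : ℝ} (hp : 0 < p) (hpq : p < q) (hν : 0 ≤ ν)
    (hb : 0 < b) :
    ∃ K : ℝ, 0 ≤ K ∧ ∀ T : ℝ, 0 < T → ∀ r : ℝ, 0 ≤ r →
      ν * r ^ p ≤ b * (r / T) ^ q + K * T ^ (1 / p - 1 / q)⁻¹ := by
  have hq : 0 < q := hp.trans hpq
  have hqp : 0 < q - p := sub_pos.2 hpq
  have hc : 0 < b ^ (p / q) := Real.rpow_pos_of_pos hb _
  refine ⟨(ν / b ^ (p / q)) ^ (q / (q - p)), Real.rpow_nonneg (by positivity) _, fun T hT r hr => ?_⟩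
  have hconj : (q / p).HolderConjugate (q / (q - p)) := by
    refine Real.holderConjugate_iff.2 ⟨(one_lt_div hp).2 hpq, ?_⟩
    field_simp
    ring
  have hx : 0 ≤ r / T := by positivity
  have hy := Real.young_inequality_of_nonneg (a := b ^ (p / q) * (r / T) ^ p)
    (b := ν / b ^ (p / q) * T ^ p) (by positivity) (by positivity) hconj
  have e1 : b ^ (p / q) * (r / T) ^ p * (ν / b ^ (p / q) * T ^ p) = ν * r ^ p := by
    rw [Real.div_rpow hr hT.le]
    have := (Real.rpow_pos_of_pos hT p).ne'
    field_simp
  have e2 : (b ^ (p / q) * (r / T) ^ p) ^ (q / p) = b * (r / T) ^ q := by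
    rw [Real.mul_rpow (by positivity) (by positivity), ← Real.rpow_mul hb.le, ← Real.rpow_mul hx]
    have h1 : p / q * (q / p) = 1 := by field_simp
    have h2 : p * (q / p) = q := by field_simp
    rw [h1, h2, Real.rpow_one]
  have e3 : (ν / b ^ (p / q) * T ^ p) ^ (q / (q - p))
      = (ν / b ^ (p / q)) ^ (q / (q - p)) * T ^ (1 / p - 1 / q)⁻¹ := by
    rw [Real.mul_rpow (by positivity) (by positivity), ← Real.rpow_mul hT.le]
    congr 2
    have : (1 / p - 1 / q) = (q - p) / (p * q) := by field_simp
    rw [this, inv_div]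
    ring
  rw [e1, e2, e3] at hy
  refine hy.trans (add_le_add ?_ ?_)
  · exact div_le_self (by positivity) ((one_lt_div hp).2 hpq).le
  · refine div_le_self (by positivity) ?_
    rw [le_div_iff₀ hqp]
    linarith

/-- Over `ℂ` the polynomial is its leading coefficient times the product of the `τ - q`, and each
factor has norm at least `a`. -/
theorem mul_pow_le_norm_eval {p : ℂ[X]} {τ : ℂ} {a : ℝ} (ha : 0 ≤ a)
    (h : ∀ q ∈ p.roots, a ≤ ‖τ - q‖) :
    ‖p.leadingCoeff‖ * a ^ p.natDegree ≤ ‖p.eval τ‖ := by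
  have hs : p.Splits := IsAlgClosed.splits p
  rw [hs.eval_eq_prod_roots, norm_mul, hs.natDegree_eq_card_roots]
  refine mul_le_mul_of_nonneg_left ?_ (norm_nonneg _)
  generalize p.roots = s at h
  induction s using Multiset.induction_on with
  | empty => simp
  | cons q s ih =>
    simp only [Multiset.card_cons, Multiset.map_cons, Multiset.prod_cons, norm_mul, pow_succ']
    exact mul_le_mul (h q (by simp)) (ih fun x hx => h x (by simp [hx])) (by positivity)
      (norm_nonneg _)

/-- Every root `q` has nonzero real part. So `|im - q|` is at least `|Re q|` when `|m|` is moderate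
and at least `|m| - |q|` when `|m|` is large; together these dominate a multiple of `1 + |m|`, and
the factorisation concludes. -/
theorem exists_mul_pow_le_norm_eval {p : ℂ[X]} (hp : ∀ m : ℝ, p.eval (I * m) ≠ 0) :
    ∃ c : ℝ, 0 < c ∧ ∀ m : ℝ, c * (1 + |m|) ^ p.natDegree ≤ ‖p.eval (I * m)‖ := by
  have hp0 : p ≠ 0 := by rintro rfl; simpa using hp 0
  have key : ∀ q ∈ p.roots.toFinset, ∃ c : ℝ, 0 < c ∧ ∀ m : ℝ, c * (1 + |m|) ≤ ‖I * m - q‖ := by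
    intro q hq
    have hre : q.re ≠ 0 := by
      intro h0
      apply hp q.im
      have : I * (q.im : ℂ) = q := by
        apply Complex.ext <;> simp [h0]
      rw [this]
      simpa using (Polynomial.mem_roots'.1 (by simpa using hq)).2
    have hre' : 0 < |q.re| := abs_pos.2 hre
    refine ⟨min (1 / 4) (|q.re| / (2 * ‖q‖ + 2)), lt_min (by norm_num) (by positivity), fun m => ?_⟩
    rcases le_total (2 * ‖q‖ + 1) |m| with h | h
    · have h1 : |m| - ‖q‖ ≤ ‖I * m - q‖ := by
        have := norm_sub_norm_le (I * (m : ℂ)) q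
        simpa using this
      have h2 : min (1 / 4) (|q.re| / (2 * ‖q‖ + 2)) * (1 + |m|) ≤ 1 / 4 * (1 + |m|) :=
        mul_le_mul_of_nonneg_right (min_le_left _ _) (by positivity)
      have := norm_nonneg q
      linarith
    · have h1 : |q.re| ≤ ‖I * m - q‖ := by
        have := Complex.abs_re_le_norm (I * m - q)
        simpa using this
      have h2 : min (1 / 4) (|q.re| / (2 * ‖q‖ + 2)) * (1 + |m|)
          ≤ (|q.re| / (2 * ‖q‖ + 2)) * (2 * ‖q‖ + 2) :=
        mul_le_mul (min_le_right _ _) (by linarith) (by positivity) (by positivity)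
      rw [div_mul_cancel₀ _ (by positivity)] at h2
      linarith
  choose! c hc hcm using key
  obtain ⟨a, ha, hale⟩ : ∃ a : ℝ, 0 < a ∧ ∀ q ∈ p.roots.toFinset, a ≤ c q := by
    rcases p.roots.toFinset.eq_empty_or_nonempty with h | h
    · exact ⟨1, one_pos, by simp [h]⟩
    · obtain ⟨q, hq, hmin⟩ := p.roots.toFinset.exists_min_image c h
      exact ⟨c q, hc q hq, hmin⟩
  refine ⟨‖p.leadingCoeff‖ * a ^ p.natDegree, ?_, fun m => ?_⟩
  · have : 0 < ‖p.leadingCoeff‖ := norm_pos_iff.2 (leadingCoeff_ne_zero.2 hp0)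
    positivity
  · rw [mul_assoc, ← mul_pow]
    refine mul_pow_le_norm_eval (by positivity) fun q hq => ?_
    have hq' : q ∈ p.roots.toFinset := by simpa using hq
    exact (mul_le_mul_of_nonneg_right (hale q hq') (by positivity)).trans (hcm q hq' m)

theorem exists_norm_eval_le_mul_pow (p : ℂ[X]) :
    ∃ c : ℝ, 0 < c ∧ ∀ m : ℝ, ‖p.eval (I * m)‖ ≤ c * (1 + |m|) ^ p.natDegree := by
  refine ⟨(∑ i ∈ Finset.range (p.natDegree + 1), ‖p.coeff i‖) + 1, by positivity, fun m => ?_⟩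
  rw [eval_eq_sum_range]
  have hm : 1 ≤ 1 + |m| := by linarith [abs_nonneg m]
  calc ‖∑ i ∈ Finset.range (p.natDegree + 1), p.coeff i * (I * m) ^ i‖
      ≤ ∑ i ∈ Finset.range (p.natDegree + 1), ‖p.coeff i‖ * (1 + |m|) ^ p.natDegree := by
        refine norm_sum_le_of_le _ fun i hi => ?_
        rw [norm_mul, norm_pow, norm_mul, norm_I, one_mul, norm_real, Real.norm_eq_abs]
        refine mul_le_mul_of_nonneg_left ?_ (norm_nonneg _)
        calc |m| ^ i ≤ (1 + |m|) ^ i := pow_le_pow_left₀ (abs_nonneg _) (by linarith) _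
          _ ≤ _ := pow_le_pow_right₀ hm (by simpa [Nat.lt_succ_iff] using hi)
    _ = (∑ i ∈ Finset.range (p.natDegree + 1), ‖p.coeff i‖) * (1 + |m|) ^ p.natDegree := by
        rw [Finset.sum_mul]
    _ ≤ _ := by gcongr; linarith

theorem one_add_abs_le (m m₁ : ℝ) : 1 + |m| ≤ (1 + |m - m₁|) + (1 + |m₁|) := by
  have : |m| ≤ |m - m₁| + |m₁| := by simpa using abs_add_le (m - m₁) m₁
  linarith

/-- The larger of `1 + |m - m₁|` and `1 + |m₁|` is at least `(1 + |m|)/2`. It produces the decay in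
`m`, and the other factor survives as a function integrable in `m₁`. -/
theorem one_add_abs_rpow_mul_le {μ s m m₁ : ℝ} (hs : 0 ≤ s) (hsμ : s ≤ μ) :
    (1 + |m - m₁|) ^ (-μ) * (1 + |m₁|) ^ (-s)
      ≤ 2 ^ μ * ((1 + |m - m₁|) ^ (-μ) + (1 + |m₁|) ^ (-s)) * (1 + |m|) ^ (-s) := by
  have ha : 1 ≤ 1 + |m - m₁| := by linarith [abs_nonneg (m - m₁)]
  have hb : 1 ≤ 1 + |m₁| := by linarith [abs_nonneg m₁]
  have hm : 1 ≤ 1 + |m| := by linarith [abs_nonneg m]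
  have hsum := one_add_abs_le m m₁
  generalize 1 + |m - m₁| = a at *
  generalize 1 + |m₁| = b at *
  generalize 1 + |m| = c at *
  have hA : 0 < a ^ (-μ) := by positivity
  have hB : 0 < b ^ (-s) := by positivity
  have hC : 0 < c ^ (-s) := by positivity
  have h2 : (2 : ℝ) ^ s ≤ 2 ^ μ := Real.rpow_le_rpow_of_exponent_le (by norm_num) hsμ
  have key : ∀ x : ℝ, 1 ≤ x → c ≤ 2 * x → x ^ (-s) ≤ 2 ^ μ * c ^ (-s) := by
    intro x hx hcx
    have : (2 * x) ^ (-s) ≤ c ^ (-s) :=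
      Real.rpow_le_rpow_of_nonpos (by linarith) hcx (by linarith)
    rw [Real.mul_rpow (by norm_num) (by linarith)] at this
    have h3 : x ^ (-s) ≤ 2 ^ s * c ^ (-s) := by
      calc x ^ (-s) = 2 ^ s * (2 ^ (-s) * x ^ (-s)) := by
            rw [← mul_assoc, ← Real.rpow_add (by norm_num)]; simp
        _ ≤ _ := by gcongr
    exact h3.trans (by gcongr)
  rcases le_total a b with h | h
  · have := key b hb (by linarith)
    calc a ^ (-μ) * b ^ (-s) ≤ a ^ (-μ) * (2 ^ μ * c ^ (-s)) := by gcongr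
      _ = 2 ^ μ * a ^ (-μ) * c ^ (-s) := by ring
      _ ≤ _ := by gcongr; linarith
  · have h1 := key a ha (by linarith)
    have h4 : a ^ (-μ) ≤ a ^ (-s) := Real.rpow_le_rpow_of_exponent_le ha (by linarith)
    calc a ^ (-μ) * b ^ (-s) ≤ (2 ^ μ * c ^ (-s)) * b ^ (-s) := by gcongr; linarith
      _ = 2 ^ μ * b ^ (-s) * c ^ (-s) := by ring
      _ ≤ _ := by gcongr; linarith

theorem integrable_one_add_abs_rpow {s : ℝ} (hs : 1 < s) :
    Integrable fun m : ℝ => (1 + |m|) ^ (-s) := by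
  have := integrable_one_add_norm (E := ℝ) (μ := volume) (r := s) (by simpa using hs)
  simpa using this

/-- The weight `(1+|m|)^{-μ} e^{-β|m|}` is stable under convolution against
`(1+|m|)^n (1+|m|)^{-μ} e^{-β|m|}`, up to the loss of a factor `(1+|m|)^n`. -/
theorem exists_weight_convolution_le {μ β : ℝ} (hβ : 0 ≤ β) (n : ℕ) (hμ : 1 + (n : ℝ) < μ) :
    ∃ c : ℝ, 0 < c ∧ ∀ m : ℝ, ∃ q : ℝ → ℝ, Integrable q ∧
      (∀ m₁ : ℝ, (1 + |m - m₁|) ^ (-μ) * Real.exp (-β * |m - m₁|) *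
        ((1 + |m₁|) ^ n * ((1 + |m₁|) ^ (-μ) * Real.exp (-β * |m₁|))) ≤ q m₁) ∧
      ∫ m₁, q m₁ ≤ c * ((1 + |m|) ^ n * ((1 + |m|) ^ (-μ) * Real.exp (-β * |m|))) := by
  have hn : (0 : ℝ) ≤ n := Nat.cast_nonneg n
  have i1 := integrable_one_add_abs_rpow (s := μ) (by linarith)
  have i2 := integrable_one_add_abs_rpow (s := μ - n) (by linarith)
  have p1 : 0 ≤ ∫ m : ℝ, (1 + |m|) ^ (-μ) := integral_nonneg fun m => by positivity
  have p2 : 0 ≤ ∫ m : ℝ, (1 + |m|) ^ (-(μ - n)) := integral_nonneg fun m => by positivity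
  have hpow : ∀ x : ℝ, (1 + |x|) ^ n * (1 + |x|) ^ (-μ) = (1 + |x|) ^ (-(μ - n)) := by
    intro x
    rw [← Real.rpow_natCast, ← Real.rpow_add (by positivity)]
    congr 1; ring
  -- The exponent `μ - n` exceeds `1`, so both terms of the majorant are integrable, with integrals
  -- independent of `m`. The final `+ 1` only makes the constant positive.
  refine ⟨2 ^ μ * ((∫ m : ℝ, (1 + |m|) ^ (-μ)) + ∫ m : ℝ, (1 + |m|) ^ (-(μ - n))) + 1,
    by positivity, fun m => ⟨fun m₁ => 2 ^ μ * ((1 + |m - m₁|) ^ (-μ) + (1 + |m₁|) ^ (-(μ - n)))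
      * ((1 + |m|) ^ (-(μ - n)) * Real.exp (-β * |m|)), ?_, fun m₁ => ?_, ?_⟩⟩
  · exact (((i1.comp_sub_left m).add i2).const_mul _).mul_const _
  · have e : (1 + |m - m₁|) ^ (-μ) * Real.exp (-β * |m - m₁|) *
        ((1 + |m₁|) ^ n * ((1 + |m₁|) ^ (-μ) * Real.exp (-β * |m₁|)))
        = ((1 + |m - m₁|) ^ (-μ) * (1 + |m₁|) ^ (-(μ - n))) *
          Real.exp (-β * |m - m₁| + -β * |m₁|) := by
      rw [Real.exp_add, ← hpow m₁]; ring
    beta_reduce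
    rw [e, ← mul_assoc (2 ^ μ * _)]
    refine mul_le_mul (one_add_abs_rpow_mul_le (by linarith) (by linarith)) ?_ (by positivity)
      (by positivity)
    refine Real.exp_le_exp.2 ?_
    have : |m| ≤ |m - m₁| + |m₁| := by simpa using abs_add_le (m - m₁) m₁
    nlinarith
  · rw [integral_mul_const, integral_const_mul, integral_add (i1.comp_sub_left m) i2,
      integral_sub_left_eq_self (fun x : ℝ => (1 + |x|) ^ (-μ)), ← mul_assoc ((1 + |m|) ^ n), hpow]
    gcongr
    linarith

/-! ### Holomorphic functions depending on a parameter -/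

/-- A parametric integral of holomorphic functions is holomorphic, under a domination hypothesis. -/
theorem differentiableOn_integral_of_norm_le {α : Type*} [MeasurableSpace α] {μ : Measure α}
    {U : Set ℂ} (hU : IsOpen U) {F : ℂ → α → ℂ} {M : ℂ → ℝ} {q : α → ℝ}
    (hmeas : ∀ τ ∈ U, AEStronglyMeasurable (F τ) μ)
    (hholo : ∀ a, DifferentiableOn ℂ (fun τ => F τ a) U)
    (hM : ContinuousOn M U) (hq : Integrable q μ)
    (hbound : ∀ τ ∈ U, ∀ a, ‖F τ a‖ ≤ M τ * q a) :
    DifferentiableOn ℂ (fun τ => ∫ a, F τ a ∂μ) U := by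
  intro τ₀ hτ₀
  obtain ⟨R₀, hR₀, hball₀⟩ := Metric.isOpen_iff.1 hU τ₀ hτ₀
  obtain ⟨R₁, hR₁, hM₁⟩ := Metric.continuousOn_iff.1 hM τ₀ hτ₀ 1 one_pos
  -- A third, so that circles of radius `R` centred in `ball τ₀ R` remain where the domination holds
  -- with the single constant `B`.
  set R := min R₀ R₁ / 3 with hRdef
  have hR : 0 < R := by positivity
  have hR0 : 3 * R ≤ R₀ := by rw [hRdef]; linarith [min_le_left R₀ R₁]
  have hR1 : 3 * R ≤ R₁ := by rw [hRdef]; linarith [min_le_right R₀ R₁]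
  set B := |M τ₀| + 1
  have hsub : ∀ x, dist x τ₀ ≤ 2 * R → x ∈ U ∧ ∀ a, ‖F x a‖ ≤ B * |q a| := by
    intro x hx
    have hxU : x ∈ U := hball₀ (by rw [Metric.mem_ball]; linarith)
    refine ⟨hxU, fun a => (hbound x hxU a).trans ?_⟩
    have h1 := hM₁ x hxU (by linarith)
    rw [Real.dist_eq] at h1
    have h2 : |M x| ≤ B := by
      have := abs_sub_abs_le_abs_sub (M x) (M τ₀)
      simp only [B]; linarith
    calc M x * q a ≤ |M x * q a| := le_abs_self _
      _ = |M x| * |q a| := abs_mul _ _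
      _ ≤ _ := by gcongr
  -- Cauchy's estimate dominates the derivative by the function itself, so no hypothesis on
  -- derivatives is required.
  have hderiv : ∀ a, ∀ x ∈ Metric.ball τ₀ R, ‖deriv (fun τ => F τ a) x‖ ≤ B * |q a| / R := by
    intro a x hx
    rw [Metric.mem_ball] at hx
    have hcl : Metric.closedBall x R ⊆ U := fun y hy => by
      rw [Metric.mem_closedBall] at hy
      exact (hsub y (by linarith [dist_triangle y x τ₀])).1
    refine Complex.norm_deriv_le_of_forall_mem_sphere_norm_le hR ?_ fun y hy => ?_
    · exact ((hholo a).mono hcl).diffContOnCl_ball (Subset.refl _)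
    · rw [mem_sphere_iff_norm, ← dist_eq_norm] at hy
      exact (hsub y (by linarith [dist_triangle y x τ₀])).2 a
  have hev : ∀ᶠ x in 𝓝 τ₀, x ∈ U := hU.mem_nhds hτ₀
  have hda : ∀ a, ∀ x ∈ Metric.ball τ₀ R,
      HasDerivAt (fun τ => F τ a) (deriv (fun τ => F τ a) x) x := by
    intro a x hx
    have hxU : x ∈ U := (hsub x (by rw [Metric.mem_ball] at hx; linarith)).1
    exact ((hholo a x hxU).differentiableAt (hU.mem_nhds hxU)).hasDerivAt
  have hint : Integrable (F τ₀) μ :=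
    (hq.abs.const_mul B).mono' (hmeas τ₀ hτ₀) (ae_of_all _ (hsub τ₀ (by simp; positivity)).2)
  -- Measurability of the derivative: it is the pointwise limit of difference quotients along a
  -- sequence tending to `τ₀`.
  have hF'meas : AEStronglyMeasurable (fun a => deriv (fun τ => F τ a) τ₀) μ := by
    have hτ : Tendsto (fun n : ℕ => τ₀ + (((R / (n + 1 : ℝ) : ℝ)) : ℂ)) atTop (𝓝[≠] τ₀) := by
      refine tendsto_nhdsWithin_iff.2 ⟨?_, Eventually.of_forall fun n => ?_⟩
      · have h1 : Tendsto (fun n : ℕ => (R / (n + 1 : ℝ) : ℝ)) atTop (𝓝 0) :=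
          tendsto_const_nhds.div_atTop
            (tendsto_atTop_add_const_right _ _ tendsto_natCast_atTop_atTop)
        have h2 := (continuous_ofReal.tendsto 0).comp h1
        simpa using h2.const_add τ₀
      · have : (R / (n + 1 : ℝ)) ≠ 0 := by positivity
        simp only [mem_compl_iff, mem_singleton_iff, add_eq_left, ofReal_eq_zero]
        exact this
    refine aestronglyMeasurable_of_tendsto_ae (u := atTop)
      (f := fun (n : ℕ) a => slope (fun τ => F τ a) τ₀ (τ₀ + (((R / (n + 1 : ℝ) : ℝ)) : ℂ)))
      (fun n => ?_) (ae_of_all _ fun a => ?_)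
    · have hx : τ₀ + (((R / (n + 1 : ℝ) : ℝ)) : ℂ) ∈ U := by
        refine (hsub _ ?_).1
        rw [dist_eq_norm, add_sub_cancel_left, norm_real, Real.norm_of_nonneg (by positivity)]
        have : R / (n + 1 : ℝ) ≤ R := div_le_self hR.le (by linarith [Nat.cast_nonneg (α := ℝ) n])
        linarith
      simp only [slope_def_field, div_eq_mul_inv]
      exact ((hmeas _ hx).sub (hmeas _ hτ₀)).mul_const _
    · exact (hda a τ₀ (Metric.mem_ball_self hR)).tendsto_slope.comp hτ
  have := hasDerivAt_integral_of_dominated_loc_of_deriv_le (μ := μ) (F := F)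
    (F' := fun x a => deriv (fun τ => F τ a) x) (bound := fun a => B * |q a| / R)
    (Metric.ball_mem_nhds τ₀ hR) (hev.mono hmeas) hint hF'meas
    (ae_of_all _ hderiv) ((hq.abs.const_mul B).div_const R) (ae_of_all _ hda)
  exact this.2.differentiableAt.differentiableWithinAt

/-- Separate holomorphy and continuity, with a local bound, give joint continuity. -/
theorem continuous_uncurry_of_differentiable {F : ℂ → ℝ → ℂ} {M : ℂ → ℝ}
    (hholo : ∀ m, Differentiable ℂ fun τ => F τ m) (hcont : ∀ τ, Continuous (F τ))
    (hM : Continuous M) (hbound : ∀ τ m, ‖F τ m‖ ≤ M τ) :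
    Continuous fun p : ℂ × ℝ => F p.1 p.2 := by
  rw [continuous_iff_continuousAt]
  rintro ⟨τ₀, m₀⟩
  obtain ⟨B, hB⟩ := (isCompact_closedBall τ₀ 2).exists_bound_of_continuousOn hM.continuousOn
  have hB' : ∀ x ∈ Metric.closedBall τ₀ 2, ∀ m, ‖F x m‖ ≤ B := fun x hx m =>
    (hbound x m).trans ((le_abs_self _).trans (hB x hx))
  have hB0 : 0 ≤ B := (norm_nonneg _).trans (hB τ₀ (by simp))
  -- By Cauchy's estimate the functions `F · m` are Lipschitz near `τ₀` with a constant independent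
  -- of `m`; this upgrades separate continuity to joint continuity.
  have hlip : ∀ m, ∀ x ∈ Metric.ball τ₀ 1, ‖F x m - F τ₀ m‖ ≤ B * ‖x - τ₀‖ := by
    intro m x hx
    refine Convex.norm_image_sub_le_of_norm_deriv_le (f := fun τ => F τ m)
      (s := Metric.ball τ₀ 1) (fun y _ => (hholo m).differentiableAt) (fun y hy => ?_)
      (convex_ball _ _) (Metric.mem_ball_self one_pos) hx
    have := Complex.norm_deriv_le_of_forall_mem_sphere_norm_le (c := y) (R := 1) (C := B)
      one_pos (hholo m).diffContOnCl (f := fun τ => F τ m) fun w hw => ?_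
    · simpa using this
    · refine hB' w ?_ m
      rw [Metric.mem_ball] at hy
      rw [mem_sphere_iff_norm, ← dist_eq_norm] at hw
      rw [Metric.mem_closedBall]
      linarith [dist_triangle w y τ₀]
  have h1 : Tendsto (fun p : ℂ × ℝ => F p.1 p.2 - F τ₀ p.2) (𝓝 (τ₀, m₀)) (𝓝 0) := by
    have hfst : Tendsto (fun p : ℂ × ℝ => p.1) (𝓝 (τ₀, m₀)) (𝓝 τ₀) := continuous_fst.tendsto _
    refine squeeze_zero_norm' (a := fun p => B * ‖p.1 - τ₀‖) ?_ ?_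
    · filter_upwards [hfst (Metric.ball_mem_nhds τ₀ one_pos)] with p hp
      exact hlip p.2 p.1 hp
    · have : Tendsto (fun p : ℂ × ℝ => B * ‖p.1 - τ₀‖) (𝓝 (τ₀, m₀)) (𝓝 (B * ‖τ₀ - τ₀‖)) :=
        ((hfst.sub_const τ₀).norm).const_mul B
      simpa using this
  have h2 : Tendsto (fun p : ℂ × ℝ => F τ₀ p.2) (𝓝 (τ₀, m₀)) (𝓝 (F τ₀ m₀)) :=
    ((hcont τ₀).comp continuous_snd).tendsto (τ₀, m₀)
  have := h1.add h2
  simpa [ContinuousAt] using this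

end InnerSol

/-! ### Weighted convolutions and the contraction estimate in the Borel plane -/

noncomputable section

namespace InnerSol

/-- `(2π)^{-1/2} ∫ C(m - m₁) G(τ, m₁) dm₁`. -/
def convol (C : ℝ → ℂ) (G : ℂ → ℝ → ℂ) (τ : ℂ) (m : ℝ) : ℂ :=
  ((Real.sqrt (2 * Real.pi) : ℝ) : ℂ)⁻¹ * ∫ m₁ : ℝ, C (m - m₁) * G τ m₁

theorem norm_inv_sqrt_two_pi_le_one : ‖((Real.sqrt (2 * Real.pi) : ℝ) : ℂ)⁻¹‖ ≤ 1 := by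
  rw [norm_inv, norm_real, Real.norm_of_nonneg (Real.sqrt_nonneg _)]
  refine inv_le_one_of_one_le₀ (Real.one_le_sqrt.2 ?_)
  linarith [Real.pi_gt_three]

section Convol

variable {X : Set ℂ} {C : ℝ → ℂ} {G : ℂ → ℝ → ℂ} {M : ℂ → ℝ} {q : ℝ → ℝ} {B : ℝ}

theorem continuous_convol_integrand (hC : Continuous C)
    (hG : ContinuousOn (fun p : ℂ × ℝ => G p.1 p.2) (X ×ˢ univ)) {τ : ℂ} (hτ : τ ∈ X) (m : ℝ) :
    Continuous fun m₁ => C (m - m₁) * G τ m₁ := by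
  have : Continuous fun m₁ => G τ m₁ :=
    hG.comp_continuous (f := fun m₁ : ℝ => (τ, m₁)) (by fun_prop) fun m₁ => ⟨hτ, mem_univ _⟩
  fun_prop

theorem integrable_convol_integrand (hC : Continuous C) (hCB : ∀ m, ‖C m‖ ≤ B)
    (hG : ContinuousOn (fun p : ℂ × ℝ => G p.1 p.2) (X ×ˢ univ)) (hq : Integrable q)
    (hbound : ∀ τ ∈ X, ∀ m, ‖G τ m‖ ≤ M τ * q m) {τ : ℂ} (hτ : τ ∈ X) (m : ℝ) :
    Integrable fun m₁ => C (m - m₁) * G τ m₁ := by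
  refine ((hq.const_mul (M τ)).const_mul B).mono'
    (continuous_convol_integrand hC hG hτ m).aestronglyMeasurable (ae_of_all _ fun m₁ => ?_)
  rw [norm_mul]
  exact mul_le_mul (hCB _) (hbound τ hτ m₁) (norm_nonneg _) ((norm_nonneg _).trans (hCB 0))

theorem continuousOn_convol (hC : Continuous C) (hCB : ∀ m, ‖C m‖ ≤ B)
    (hG : ContinuousOn (fun p : ℂ × ℝ => G p.1 p.2) (X ×ˢ univ)) (hM : Continuous M)
    (hq : Integrable q) (hbound : ∀ τ ∈ X, ∀ m, ‖G τ m‖ ≤ M τ * q m) :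
    ContinuousOn (fun p : ℂ × ℝ => convol C G p.1 p.2) (X ×ˢ univ) := by
  refine ContinuousOn.mul continuousOn_const ?_
  rintro ⟨τ₀, m₀⟩ ⟨hτ₀, -⟩
  have hB : 0 ≤ B := (norm_nonneg _).trans (hCB 0)
  refine continuousWithinAt_of_dominated (bound := fun m₁ => B * ((|M τ₀| + 1) * |q m₁|)) ?_ ?_ ?_ ?_
  · filter_upwards [self_mem_nhdsWithin] with p hp
    exact (continuous_convol_integrand hC hG hp.1 p.2).aestronglyMeasurable
  · have h1 : ∀ᶠ p : ℂ × ℝ in 𝓝 (τ₀, m₀), |M p.1| < |M τ₀| + 1 :=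
      ((hM.comp continuous_fst).abs.tendsto (τ₀, m₀)).eventually_lt_const (by simp)
    filter_upwards [self_mem_nhdsWithin, nhdsWithin_le_nhds h1] with p hp hp1
    refine ae_of_all _ fun m₁ => ?_
    rw [norm_mul]
    refine mul_le_mul (hCB _) ((hbound p.1 hp.1 m₁).trans ?_) (norm_nonneg _) hB
    calc M p.1 * q m₁ ≤ |M p.1| * |q m₁| := by rw [← abs_mul]; exact le_abs_self _
      _ ≤ _ := by gcongr
  · exact (hq.abs.const_mul _).const_mul _
  · refine ae_of_all _ fun m₁ => ContinuousWithinAt.mul ?_ ?_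
    · exact (hC.comp (by fun_prop : Continuous fun p : ℂ × ℝ => p.2 - m₁)).continuousWithinAt
    · have := (hG.comp (f := fun p : ℂ × ℝ => (p.1, m₁)) (s := X ×ˢ univ)
        (by fun_prop : Continuous fun p : ℂ × ℝ => (p.1, m₁)).continuousOn
        fun p hp => ⟨hp.1, mem_univ _⟩)
      exact this (τ₀, m₀) ⟨hτ₀, mem_univ _⟩

theorem differentiableOn_convol (hX : IsOpen X) (hC : Continuous C) (hCB : ∀ m, ‖C m‖ ≤ B)
    (hG : ContinuousOn (fun p : ℂ × ℝ => G p.1 p.2) (X ×ˢ univ))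
    (hholo : ∀ m, DifferentiableOn ℂ (fun τ => G τ m) X) (hM : Continuous M)
    (hq : Integrable q) (hbound : ∀ τ ∈ X, ∀ m, ‖G τ m‖ ≤ M τ * q m) (m : ℝ) :
    DifferentiableOn ℂ (fun τ => convol C G τ m) X := by
  refine DifferentiableOn.const_mul ?_ _
  refine differentiableOn_integral_of_norm_le (M := fun τ => B * M τ) (q := q) hX
    (fun τ hτ => (continuous_convol_integrand hC hG hτ m).aestronglyMeasurable)
    (fun m₁ => (hholo m₁).const_mul _) (hM.const_smul B).continuousOn hq fun τ hτ m₁ => ?_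
  rw [norm_mul, mul_assoc]
  exact mul_le_mul (hCB _) (hbound τ hτ m₁) (norm_nonneg _) ((norm_nonneg _).trans (hCB 0))

end Convol

/-- The weight `(1+|m|)^{-μ} e^{-β|m|}`. -/
def weight (μ β m : ℝ) : ℝ := (1 + |m|) ^ (-μ) * Real.exp (-β * |m|)

theorem weight_pos (μ β m : ℝ) : 0 < weight μ β m := by unfold weight; positivity

theorem weight_eq_inv (μ β m : ℝ) :
    weight μ β m = ((1 + |m|) ^ μ * Real.exp (β * |m|))⁻¹ := by
  rw [weight, mul_inv, Real.rpow_neg (by positivity), neg_mul, Real.exp_neg]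

theorem weight_le_one {μ β : ℝ} (hμ : 0 ≤ μ) (hβ : 0 ≤ β) (m : ℝ) : weight μ β m ≤ 1 := by
  refine mul_le_one₀ ?_ (by positivity) (Real.exp_le_one_iff.2 ?_)
  · exact Real.rpow_le_one_of_one_le_of_nonpos (by linarith [abs_nonneg m]) (by linarith)
  · nlinarith [abs_nonneg m]

theorem weight_le_exp {μ β : ℝ} (hμ : 0 ≤ μ) (m : ℝ) : weight μ β m ≤ Real.exp (-β * |m|) :=
  mul_le_of_le_one_left (by positivity)
    (Real.rpow_le_one_of_one_le_of_nonpos (by linarith [abs_nonneg m]) (by linarith))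

theorem continuous_weight (μ β : ℝ) : Continuous (weight μ β) := by
  unfold weight
  refine Continuous.mul ?_ (by fun_prop)
  exact (continuous_const.add continuous_abs).rpow_const fun m => Or.inl (by
    change 1 + |m| ≠ 0
    positivity)

theorem integrable_pow_mul_weight {μ β : ℝ} (hβ : 0 ≤ β) (n : ℕ) (hμ : 1 + (n : ℝ) < μ) :
    Integrable fun m => (1 + |m|) ^ n * weight μ β m := by
  refine (integrable_one_add_abs_rpow (s := μ - n) (by linarith)).mono'
    (Continuous.aestronglyMeasurable ?_) (ae_of_all _ fun m => ?_)
  · exact (by fun_prop : Continuous fun m : ℝ => (1 + |m|) ^ n).mul (continuous_weight μ β)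
  · have h0 := weight_pos μ β m
    rw [Real.norm_of_nonneg (by positivity)]
    have : (1 + |m|) ^ (-(μ - n)) = (1 + |m|) ^ n * (1 + |m|) ^ (-μ) := by
      rw [← Real.rpow_natCast, ← Real.rpow_add (by positivity)]
      congr 1; ring
    rw [this, weight]
    refine mul_le_mul_of_nonneg_left (mul_le_of_le_one_right (by positivity) ?_) (by positivity)
    exact Real.exp_le_one_iff.2 (by nlinarith [abs_nonneg m])

/-- The estimate is made at one fixed `τ`, since convolution acts on `m` only. The loss `(1 +
|m|)^{deg p}` is recovered later by dividing by `P_m`. -/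
theorem exists_norm_convol_le {μ β : ℝ} (hβ : 0 ≤ β) (p : ℂ[X]) (hμ : 1 + (p.natDegree : ℝ) < μ)
    {B : ℝ} (hB : 0 < B) :
    ∃ c : ℝ, 0 < c ∧ ∀ (C : ℝ → ℂ) (w : ℂ → ℝ → ℂ) (τ : ℂ) (b : ℝ),
      (∀ m, ‖C m‖ ≤ B * weight μ β m) → (∀ m, ‖w τ m‖ ≤ b * weight μ β m) →
      ∀ m, ‖convol C (fun τ m₁ => p.eval (I * m₁) * w τ m₁) τ m‖
        ≤ c * b * ((1 + |m|) ^ p.natDegree * weight μ β m) := by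
  obtain ⟨c₁, hc₁, h₁⟩ := exists_norm_eval_le_mul_pow p
  obtain ⟨c₂, hc₂, h₂⟩ := exists_weight_convolution_le hβ p.natDegree hμ
  refine ⟨B * c₁ * c₂, by positivity, fun C w τ b hC hw m => ?_⟩
  have hb : 0 ≤ b := by
    have := (norm_nonneg _).trans (hw 0)
    exact nonneg_of_mul_nonneg_left this (weight_pos μ β 0)
  obtain ⟨q, hq, hq1, hq2⟩ := h₂ m
  rw [convol, norm_mul]
  have hle : ‖∫ m₁ : ℝ, C (m - m₁) * (p.eval (I * m₁) * w τ m₁)‖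
      ≤ ∫ m₁, B * c₁ * b * q m₁ := by
    refine norm_integral_le_of_norm_le (hq.const_mul _) (ae_of_all _ fun m₁ => ?_)
    rw [norm_mul, norm_mul]
    calc ‖C (m - m₁)‖ * (‖p.eval (I * m₁)‖ * ‖w τ m₁‖)
        ≤ (B * weight μ β (m - m₁)) * ((c₁ * (1 + |m₁|) ^ p.natDegree) * (b * weight μ β m₁)) := by
          have := weight_pos μ β (m - m₁)
          gcongr
          · exact hC _
          · exact h₁ _
          · exact hw _
      _ = B * c₁ * b * (weight μ β (m - m₁) * ((1 + |m₁|) ^ p.natDegree * weight μ β m₁)) := by ring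
      _ ≤ _ := by gcongr; exact hq1 m₁
  rw [integral_const_mul] at hle
  calc _ ≤ 1 * (B * c₁ * b * ∫ m₁, q m₁) :=
        mul_le_mul norm_inv_sqrt_two_pi_le_one hle (norm_nonneg _) zero_le_one
    _ ≤ 1 * (B * c₁ * b * (c₂ * ((1 + |m|) ^ p.natDegree * weight μ β m))) := by
        gcongr; exact hq2
    _ = _ := by ring

namespace MainData

variable (P : MainData)

/-- The coefficient of the convolution term of index `(l₁, l₂)` in the auxiliary equation. -/
def borelCoeff (l₁ l₂ : ℕ) (ε τ : ℂ) : ℂ :=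
  ε ^ (P.Dlt l₁ l₂ - (P.lam₁ * P.k₁ * P.δ₁ l₁ + P.lam₂ * P.k₂ * P.δ₂ l₂))
    * (P.k₁ * τ ^ P.k₁) ^ P.δ₁ l₁ * (P.k₂ * τ ^ P.k₂) ^ P.δ₂ l₂

/-- The convolution term of index `(l₁, l₂)` without its coefficient. -/
def borelConv (l₁ l₂ : ℕ) (ε : ℂ) (w : ℂ → ℝ → ℂ) : ℂ → ℝ → ℂ :=
  convol (fun m => P.C l₁ l₂ m ε) fun τ m₁ => (P.R l₁ l₂).eval (I * m₁) * w τ m₁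

/-- The convolution terms of the auxiliary equation. -/
def borelSum (ε : ℂ) (w : ℂ → ℝ → ℂ) (τ : ℂ) (m : ℝ) : ℂ :=
  ∑ l₁ ∈ Finset.Ico 1 P.D₁, ∑ l₂ ∈ Finset.Ico 1 P.D₂,
    P.borelCoeff l₁ l₂ ε τ * P.borelConv l₁ l₂ ε w τ m

/-- The linear operator of which the auxiliary equation is a fixed point equation. -/
def borelOp (ε : ℂ) (w : ℂ → ℝ → ℂ) (τ : ℂ) (m : ℝ) : ℂ :=
  (P.Pm m τ)⁻¹ * P.borelSum ε w τ m

/-- The terms of the Neumann series of the auxiliary equation. -/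
def neumannTerm (ψ : ℂ → ℝ → ℂ → ℂ) (ε : ℂ) (n : ℕ) : ℂ → ℝ → ℂ :=
  (P.borelOp ε)^[n] fun τ m => (P.Pm m τ)⁻¹ * ψ τ m ε

/-- The Neumann series solving the auxiliary equation. -/
def borelSol (ψ : ℂ → ℝ → ℂ → ℂ) (ε : ℂ) (τ : ℂ) (m : ℝ) : ℂ :=
  ∑' n, P.neumannTerm ψ ε n τ m

variable {P}

theorem solvesBorel_iff {ψ : ℂ → ℝ → ℂ → ℂ} {ε : ℂ} {G : Set ℂ} {w : ℂ → ℝ → ℂ} :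
    P.SolvesBorel ψ ε G w ↔
      ∀ τ ∈ G, ∀ m : ℝ, P.Pm m τ * w τ m = P.borelSum ε w τ m + ψ τ m ε := by
  simp only [SolvesBorel, borelSum, borelCoeff, borelConv, convol, mul_assoc]

theorem one_lt_μ (hP : P.Valid) : 1 < P.μ := by
  have := hP.μ_gt 1 (by simp; linarith [hP.two_le_D₁]) 1 (by simp; linarith [hP.two_le_D₂])
  have h2 : (0 : ℝ) ≤ (P.R 1 1).natDegree := Nat.cast_nonneg _
  linarith

theorem k'_pos (hP : P.Valid) : 0 < P.k' := (Nat.cast_nonneg _).trans_lt hP.k₁_lt_k'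

/-- As a polynomial in `τ`, `P_m` has degree `N` and leading coefficient a constant multiple of
`R_{D₁D₂}(im)`. The distance to the roots provides `(1 + |τ|)^N`, and the absence of zeros of
`R_{D₁D₂}` on the imaginary axis provides the power of `1 + |m|`. -/
theorem exists_le_norm_Pm (hP : P.Valid) {ρ d θ : ℝ} (hρ : 0 < ρ) (hS : P.AvoidsRoots ρ d θ) :
    ∃ c : ℝ, 0 < c ∧ ∀ τ ∈ infSector d θ ∪ Metric.closedBall 0 ρ, ∀ m : ℝ,
      c * (1 + ‖τ‖) ^ (P.k₁ * P.δ₁ P.D₁ + P.k₂ * P.δ₂ P.D₂)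
        * (1 + |m|) ^ (P.R P.D₁ P.D₂).natDegree ≤ ‖P.Pm m τ‖ := by
  obtain ⟨𝔪, h𝔪, hroot⟩ := hS
  obtain ⟨c, hc, hR⟩ := exists_mul_pow_le_norm_eval hP.R_top_ne
  set N := P.k₁ * P.δ₁ P.D₁ + P.k₂ * P.δ₂ P.D₂ with hN
  have hk₁ : 0 < P.k₁ := hP.one_le_k₁
  have hk₂ : 0 < P.k₂ := hk₁.trans hP.k₁_lt_k₂
  have hNpos : 0 < N := by
    have := hP.top_order_pos
    rcases Nat.eq_zero_or_pos (P.δ₁ P.D₁) with h | h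
    · have : 0 < P.δ₂ P.D₂ := by omega
      positivity
    · positivity
  set A : ℝ := (P.k₁ : ℝ) ^ P.δ₁ P.D₁ * (P.k₂ : ℝ) ^ P.δ₂ P.D₂ with hA
  have hApos : 0 < A := by positivity
  refine ⟨A * 𝔪 ^ N * c, by positivity, fun τ hτ m => ?_⟩
  -- The root condition is assumed on the open disc only; it is a closed condition in `τ`, so it
  -- extends to the closed disc.
  have hroot' : ∀ q, P.Pm m q = 0 → 𝔪 * (1 + ‖τ‖) ≤ ‖τ - q‖ := by
    intro q hq
    rcases hτ with hτ | hτ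
    · exact hroot m q hq τ (Or.inl hτ)
    · have hcl : IsClosed {x : ℂ | 𝔪 * (1 + ‖x‖) ≤ ‖x - q‖} :=
        isClosed_le (by fun_prop) (by fun_prop)
      have : closure (Metric.ball (0 : ℂ) ρ) ⊆ {x : ℂ | 𝔪 * (1 + ‖x‖) ≤ ‖x - q‖} :=
        hcl.closure_subset_iff.2 fun x hx => hroot m q hq x (Or.inr hx)
      rw [closure_ball _ hρ.ne'] at this
      exact this hτ
  set a : ℂ := -((A : ℂ) * (P.R P.D₁ P.D₂).eval (I * m)) with ha
  have ha0 : a ≠ 0 := by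
    rw [ha, neg_ne_zero]
    exact mul_ne_zero (ofReal_ne_zero.2 hApos.ne') (hP.R_top_ne m)
  set p : ℂ[X] := Polynomial.C a * X ^ N + Polynomial.C (P.Q.eval (I * m)) with hp
  have heval : ∀ x, p.eval x = P.Pm m x := by
    intro x
    simp only [hp, eval_add, eval_mul, eval_C, eval_pow, eval_X, Pm, ha, hA, hN, pow_add, pow_mul,
      mul_pow, ofReal_mul, ofReal_pow, ofReal_natCast]
    ring
  have hdeg : p.natDegree = N := by
    rw [hp, natDegree_add_C, natDegree_C_mul_X_pow N a ha0]
  have hlead : p.leadingCoeff = a := by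
    rw [leadingCoeff, hdeg, hp]
    simp [coeff_C, hNpos.ne']
  have hp0 : p ≠ 0 := by rw [← leadingCoeff_ne_zero, hlead]; exact ha0
  have := mul_pow_le_norm_eval (p := p) (τ := τ) (a := 𝔪 * (1 + ‖τ‖)) (by positivity) fun q hq =>
    hroot' q (by rw [← heval]; exact (Polynomial.mem_roots'.1 hq).2)
  rw [heval, hlead, hdeg, mul_pow, ha, norm_neg, norm_mul, norm_real,
    Real.norm_of_nonneg hApos.le] at this
  refine le_trans ?_ this
  calc A * 𝔪 ^ N * c * (1 + ‖τ‖) ^ N * (1 + |m|) ^ (P.R P.D₁ P.D₂).natDegree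
      = A * (c * (1 + |m|) ^ (P.R P.D₁ P.D₂).natDegree) * (𝔪 ^ N * (1 + ‖τ‖) ^ N) := by ring
    _ ≤ _ := by gcongr; exact hR m

theorem norm_C_le {l₁ l₂ : ℕ} {B : ℝ} {ε : ℂ} {m : ℝ}
    (h : (1 + |m|) ^ P.μ * Real.exp (P.β * |m|) * ‖P.C l₁ l₂ m ε‖ ≤ B) :
    ‖P.C l₁ l₂ m ε‖ ≤ B * weight P.μ P.β m := by
  rw [weight_eq_inv, ← div_eq_mul_inv, le_div_iff₀ (by positivity)]
  linarith

/-- Three comparisons meet: `order_le` bounds the powers of `τ` by `(1 + |τ|)^N`, `deg_le` bounds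
the loss in `m` by the growth of `R_{D₁D₂}`, and `Dlt_gt` leaves at least one factor `ε`. The bound
`b` may depend on `τ`, so the same statement serves the growth weight of the Borel space and the
uniqueness argument at a fixed `τ`. -/
theorem exists_norm_borelOp_le (hP : P.Valid) {ρ d θ : ℝ} (hρ : 0 < ρ)
    (hS : P.AvoidsRoots ρ d θ) :
    ∃ κ : ℝ, 0 < κ ∧ ∀ ε ∈ Metric.ball (0 : ℂ) P.ε₀, ‖ε‖ ≤ 1 →
      ∀ τ ∈ infSector d θ ∪ Metric.closedBall 0 ρ, ∀ (b : ℝ) (w : ℂ → ℝ → ℂ),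
      (∀ m, ‖w τ m‖ ≤ b * weight P.μ P.β m) →
      ∀ m, ‖P.borelOp ε w τ m‖ ≤ κ * ‖ε‖ * b * weight P.μ P.β m := by
  obtain ⟨c, hc, hPm⟩ := exists_le_norm_Pm hP hρ hS
  have hterm : ∀ l₁ ∈ Finset.Ico 1 P.D₁, ∀ l₂ ∈ Finset.Ico 1 P.D₂, ∃ κ : ℝ, 0 < κ ∧
      ∀ ε ∈ Metric.ball (0 : ℂ) P.ε₀, ‖ε‖ ≤ 1 →
      ∀ τ ∈ infSector d θ ∪ Metric.closedBall 0 ρ, ∀ (b : ℝ) (w : ℂ → ℝ → ℂ),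
      (∀ m, ‖w τ m‖ ≤ b * weight P.μ P.β m) →
      ∀ m, ‖(P.Pm m τ)⁻¹ * (P.borelCoeff l₁ l₂ ε τ * P.borelConv l₁ l₂ ε w τ m)‖
        ≤ κ * (‖ε‖ * b * weight P.μ P.β m) := by
    intro l₁ h₁ l₂ h₂
    obtain ⟨B, hB, hCB⟩ := hP.C_bound l₁ h₁ l₂ h₂
    obtain ⟨c', hc', hconv⟩ := exists_norm_convol_le hP.β_pos.le (P.R l₁ l₂)
      (hP.μ_gt l₁ h₁ l₂ h₂) hB
    set A : ℝ := (P.k₁ : ℝ) ^ P.δ₁ l₁ * (P.k₂ : ℝ) ^ P.δ₂ l₂ with hA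
    refine ⟨c⁻¹ * (A * c') + 1, by positivity, fun ε hε hε1 τ hτ b w hw m => ?_⟩
    have hb : 0 ≤ b := by
      have := (norm_nonneg _).trans (hw 0)
      exact nonneg_of_mul_nonneg_left this (weight_pos _ _ 0)
    have hW := weight_pos P.μ P.β m
    set N := P.k₁ * P.δ₁ P.D₁ + P.k₂ * P.δ₂ P.D₂ with hN
    have hx : 0 < c * (1 + ‖τ‖) ^ N * (1 + |m|) ^ (P.R P.D₁ P.D₂).natDegree := by positivity
    have e1 : ‖(P.Pm m τ)⁻¹‖
        ≤ (c * (1 + ‖τ‖) ^ N * (1 + |m|) ^ (P.R P.D₁ P.D₂).natDegree)⁻¹ := by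
      rw [norm_inv]
      exact inv_anti₀ hx (hPm τ hτ m)
    have e2 : ‖P.borelCoeff l₁ l₂ ε τ‖ ≤ ‖ε‖ * A * (1 + ‖τ‖) ^ N := by
      have hτ1 : 1 ≤ 1 + ‖τ‖ := by linarith [norm_nonneg τ]
      have f1 : ‖ε ^ (P.Dlt l₁ l₂ - (P.lam₁ * P.k₁ * P.δ₁ l₁ + P.lam₂ * P.k₂ * P.δ₂ l₂))‖
          ≤ ‖ε‖ := by
        rw [norm_pow]
        refine pow_le_of_le_one (norm_nonneg _) hε1 ?_
        have := hP.Dlt_gt l₁ h₁ l₂ h₂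
        omega
      have f2 : ‖τ‖ ^ (P.k₁ * P.δ₁ l₁ + P.k₂ * P.δ₂ l₂) ≤ (1 + ‖τ‖) ^ N :=
        (pow_le_pow_left₀ (norm_nonneg _) (by linarith) _).trans
          (pow_le_pow_right₀ hτ1 (hP.order_le l₁ h₁ l₂ h₂))
      rw [borelCoeff, mul_assoc (ε ^ _), norm_mul]
      have f3 : ‖((P.k₁ : ℂ) * τ ^ P.k₁) ^ P.δ₁ l₁ * ((P.k₂ : ℂ) * τ ^ P.k₂) ^ P.δ₂ l₂‖
          = A * ‖τ‖ ^ (P.k₁ * P.δ₁ l₁ + P.k₂ * P.δ₂ l₂) := by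
        simp only [norm_mul, norm_pow, norm_natCast, hA, pow_add, pow_mul, mul_pow]
        ring
      rw [f3, mul_assoc ‖ε‖]
      gcongr
    have e3 : ‖P.borelConv l₁ l₂ ε w τ m‖
        ≤ c' * b * ((1 + |m|) ^ (P.R P.D₁ P.D₂).natDegree * weight P.μ P.β m) := by
      refine (hconv _ w τ b (fun m => norm_C_le (hCB ε hε m)) hw m).trans ?_
      gcongr
      · linarith [abs_nonneg m]
      · exact hP.deg_le l₁ h₁ l₂ h₂
    rw [norm_mul, norm_mul]
    calc _ ≤ (c * (1 + ‖τ‖) ^ N * (1 + |m|) ^ (P.R P.D₁ P.D₂).natDegree)⁻¹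
          * ((‖ε‖ * A * (1 + ‖τ‖) ^ N)
          * (c' * b * ((1 + |m|) ^ (P.R P.D₁ P.D₂).natDegree * weight P.μ P.β m))) := by gcongr
      _ = c⁻¹ * (A * c') * (‖ε‖ * b * weight P.μ P.β m) := by
          have : 0 < 1 + ‖τ‖ := by positivity
          field_simp
      _ ≤ _ := by gcongr; linarith
  choose! κ hκ hκ' using hterm
  refine ⟨(∑ l₁ ∈ Finset.Ico 1 P.D₁, ∑ l₂ ∈ Finset.Ico 1 P.D₂, κ l₁ l₂) + 1, ?_,
    fun ε hε hε1 τ hτ b w hw m => ?_⟩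
  · have : 0 ≤ ∑ l₁ ∈ Finset.Ico 1 P.D₁, ∑ l₂ ∈ Finset.Ico 1 P.D₂, κ l₁ l₂ :=
      Finset.sum_nonneg fun l₁ h₁ => Finset.sum_nonneg fun l₂ h₂ => (hκ l₁ h₁ l₂ h₂).le
    linarith
  · have hb : 0 ≤ b := by
      have := (norm_nonneg _).trans (hw 0)
      exact nonneg_of_mul_nonneg_left this (weight_pos _ _ 0)
    have hW := weight_pos P.μ P.β m
    rw [borelOp, borelSum, Finset.mul_sum]
    simp only [Finset.mul_sum]
    calc _ ≤ ∑ l₁ ∈ Finset.Ico 1 P.D₁, ∑ l₂ ∈ Finset.Ico 1 P.D₂,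
          κ l₁ l₂ * (‖ε‖ * b * weight P.μ P.β m) :=
          norm_sum_le_of_le _ fun l₁ h₁ => norm_sum_le_of_le _ fun l₂ h₂ =>
            hκ' l₁ h₁ l₂ h₂ ε hε hε1 τ hτ b w hw m
      _ = (∑ l₁ ∈ Finset.Ico 1 P.D₁, ∑ l₂ ∈ Finset.Ico 1 P.D₂, κ l₁ l₂)
          * (‖ε‖ * b * weight P.μ P.β m) := by simp only [Finset.sum_mul]
      _ ≤ _ := by
          have : 0 ≤ ‖ε‖ * b * weight P.μ P.β m := by positivity
          nlinarith

end MainData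

end InnerSol

end

/-! ### The Banach space of the Borel plane and the Neumann series -/

noncomputable section

namespace InnerSol

/-- The sector is the image of a horizontal strip under `exp`, which is an open map. -/
theorem isOpen_infSector (d θ : ℝ) : IsOpen (infSector d θ) := by
  have : infSector d θ = exp '' {s | |s.im - d| < θ / 2} := by
    ext u
    constructor
    · rintro ⟨r, φ, hr, hφ, rfl⟩
      refine ⟨Real.log r + φ * I, by simpa using hφ, ?_⟩
      rw [exp_add, ← ofReal_exp, Real.exp_log hr]
    · rintro ⟨s, hs, rfl⟩
      refine ⟨Real.exp s.re, s.im, Real.exp_pos _, hs, ?_⟩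
      rw [ofReal_exp, ← exp_add, re_add_im]
  rw [this]
  refine isOpenMap_exp _ (isOpen_lt ?_ continuous_const)
  fun_prop

namespace MainData

variable {P : MainData}

/-- The growth `‖τ‖ e^{ν ‖τ‖^{k'}}` of the elements of the Borel space. -/
def growth (P : MainData) (τ : ℂ) : ℝ := ‖τ‖ * Real.exp (P.ν * ‖τ‖ ^ P.k')

theorem growth_nonneg (τ : ℂ) : 0 ≤ P.growth τ := by unfold growth; positivity

theorem continuous_growth (hP : P.Valid) : Continuous P.growth := by
  unfold growth
  have : Continuous fun τ : ℂ => ‖τ‖ ^ P.k' :=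
    continuous_norm.rpow_const fun τ => Or.inr (k'_pos hP).le
  fun_prop

theorem norm_le_of_inExpBall {ρ d θ B : ℝ} {w : ℂ → ℝ → ℂ} (h : P.InExpBall ρ d θ B w)
    {τ : ℂ} (hτ : τ ∈ infSector d θ ∪ Metric.closedBall 0 ρ) (m : ℝ) :
    ‖w τ m‖ ≤ B * P.growth τ * weight P.μ P.β m := by
  have h1 := h.bound τ hτ m
  rw [weight_eq_inv, ← div_eq_mul_inv, le_div_iff₀ (by positivity), growth]
  rw [neg_mul, Real.exp_neg] at h1
  have hE := Real.exp_pos (P.ν * ‖τ‖ ^ P.k')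
  field_simp at h1
  rw [mul_comm |m| P.β] at h1
  linarith

theorem bound_of_norm_le {B : ℝ} {w : ℂ → ℝ → ℂ} {τ : ℂ} {m : ℝ}
    (h : ‖w τ m‖ ≤ B * P.growth τ * weight P.μ P.β m) :
    (1 + |m|) ^ P.μ * Real.exp (P.β * |m|) * Real.exp (-P.ν * ‖τ‖ ^ P.k') * ‖w τ m‖
      ≤ B * ‖τ‖ := by
  rw [weight_eq_inv, ← div_eq_mul_inv, le_div_iff₀ (by positivity), growth] at h
  rw [neg_mul, Real.exp_neg]
  have hE := Real.exp_pos (P.ν * ‖τ‖ ^ P.k')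
  field_simp
  rw [mul_comm |m| P.β]
  linarith

theorem continuous_Pm : Continuous fun p : ℂ × ℝ => P.Pm p.2 p.1 := by
  unfold Pm
  have h : ∀ A : ℂ[X], Continuous fun p : ℂ × ℝ => A.eval (I * (p.2 : ℂ)) := fun A =>
    A.continuous.comp (by fun_prop)
  have h1 := h P.Q
  have h2 := h (P.R P.D₁ P.D₂)
  fun_prop

theorem Pm_ne_zero (hP : P.Valid) {ρ d θ : ℝ} (hρ : 0 < ρ) (hS : P.AvoidsRoots ρ d θ)
    {τ : ℂ} (hτ : τ ∈ infSector d θ ∪ Metric.closedBall 0 ρ) (m : ℝ) : P.Pm m τ ≠ 0 := by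
  obtain ⟨c, hc, h⟩ := exists_le_norm_Pm hP hρ hS
  rw [← norm_pos_iff]
  exact lt_of_lt_of_le (by positivity) (h τ hτ m)

theorem differentiable_Pm (m : ℝ) : Differentiable ℂ fun τ => P.Pm m τ := by
  unfold Pm
  fun_prop

theorem differentiable_borelCoeff (l₁ l₂ : ℕ) (ε : ℂ) :
    Differentiable ℂ fun τ => P.borelCoeff l₁ l₂ ε τ := by
  unfold borelCoeff
  fun_prop

section BorelConv

variable {X : Set ℂ} {w : ℂ → ℝ → ℂ} {M : ℂ → ℝ} {l₁ l₂ : ℕ} {ε : ℂ}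

theorem norm_C_le_const (hP : P.Valid) (h₁ : l₁ ∈ Finset.Ico 1 P.D₁)
    (h₂ : l₂ ∈ Finset.Ico 1 P.D₂) (hε : ε ∈ Metric.ball (0 : ℂ) P.ε₀) :
    ∃ B : ℝ, 0 < B ∧ ∀ m, ‖P.C l₁ l₂ m ε‖ ≤ B := by
  obtain ⟨B, hB, h⟩ := hP.C_bound l₁ h₁ l₂ h₂
  refine ⟨B, hB, fun m => (norm_C_le (h ε hε m)).trans ?_⟩
  exact mul_le_of_le_one_right hB.le
    (weight_le_one (by linarith [one_lt_μ hP]) hP.β_pos.le m)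

theorem continuousOn_eval_mul (A : ℂ[X])
    (hw : ContinuousOn (fun p : ℂ × ℝ => w p.1 p.2) (X ×ˢ univ)) :
    ContinuousOn (fun p : ℂ × ℝ => A.eval (I * (p.2 : ℂ)) * w p.1 p.2) (X ×ˢ univ) := by
  refine ContinuousOn.mul (Continuous.continuousOn ?_) hw
  exact A.continuous.comp (by fun_prop)

/-- An integrable majorant for `R_{l₁l₂}(im) w(τ, m)`. -/
theorem exists_integrable_majorant (hP : P.Valid) (h₁ : l₁ ∈ Finset.Ico 1 P.D₁)
    (h₂ : l₂ ∈ Finset.Ico 1 P.D₂)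
    (hb : ∀ τ ∈ X, ∀ m, ‖w τ m‖ ≤ M τ * weight P.μ P.β m) :
    ∃ q : ℝ → ℝ, Integrable q ∧
      ∀ τ ∈ X, ∀ m : ℝ, ‖(P.R l₁ l₂).eval (I * (m : ℂ)) * w τ m‖ ≤ M τ * q m := by
  obtain ⟨c, hc, h⟩ := exists_norm_eval_le_mul_pow (P.R l₁ l₂)
  refine ⟨fun m => c * ((1 + |m|) ^ (P.R l₁ l₂).natDegree * weight P.μ P.β m),
    (integrable_pow_mul_weight hP.β_pos.le _ (hP.μ_gt l₁ h₁ l₂ h₂)).const_mul c, fun τ hτ m => ?_⟩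
  rw [norm_mul]
  calc _ ≤ (c * (1 + |m|) ^ (P.R l₁ l₂).natDegree) * (M τ * weight P.μ P.β m) :=
        mul_le_mul (h m) (hb τ hτ m) (norm_nonneg _) (by positivity)
    _ = _ := by ring

theorem continuousOn_borelConv (hP : P.Valid) (h₁ : l₁ ∈ Finset.Ico 1 P.D₁)
    (h₂ : l₂ ∈ Finset.Ico 1 P.D₂) (hε : ε ∈ Metric.ball (0 : ℂ) P.ε₀)
    (hw : ContinuousOn (fun p : ℂ × ℝ => w p.1 p.2) (X ×ˢ univ)) (hM : Continuous M)
    (hb : ∀ τ ∈ X, ∀ m, ‖w τ m‖ ≤ M τ * weight P.μ P.β m) :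
    ContinuousOn (fun p : ℂ × ℝ => P.borelConv l₁ l₂ ε w p.1 p.2) (X ×ˢ univ) := by
  obtain ⟨q, hq, hqb⟩ := exists_integrable_majorant hP h₁ h₂ hb
  obtain ⟨B, -, hB⟩ := norm_C_le_const hP h₁ h₂ hε
  exact continuousOn_convol (hP.C_cont l₁ h₁ l₂ h₂ ε hε) hB (continuousOn_eval_mul _ hw) hM hq hqb

theorem differentiableOn_borelConv (hP : P.Valid) (h₁ : l₁ ∈ Finset.Ico 1 P.D₁)
    (h₂ : l₂ ∈ Finset.Ico 1 P.D₂) (hε : ε ∈ Metric.ball (0 : ℂ) P.ε₀) (hX : IsOpen X)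
    (hw : ContinuousOn (fun p : ℂ × ℝ => w p.1 p.2) (X ×ˢ univ))
    (hh : ∀ m, DifferentiableOn ℂ (fun τ => w τ m) X) (hM : Continuous M)
    (hb : ∀ τ ∈ X, ∀ m, ‖w τ m‖ ≤ M τ * weight P.μ P.β m) (m : ℝ) :
    DifferentiableOn ℂ (fun τ => P.borelConv l₁ l₂ ε w τ m) X := by
  obtain ⟨q, hq, hqb⟩ := exists_integrable_majorant hP h₁ h₂ hb
  obtain ⟨B, -, hB⟩ := norm_C_le_const hP h₁ h₂ hε
  exact differentiableOn_convol hX (hP.C_cont l₁ h₁ l₂ h₂ ε hε) hB (continuousOn_eval_mul _ hw)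
    (fun m₁ => (hh m₁).const_mul _) hM hq hqb m

theorem integrable_borelConv_integrand (hP : P.Valid) (h₁ : l₁ ∈ Finset.Ico 1 P.D₁)
    (h₂ : l₂ ∈ Finset.Ico 1 P.D₂) (hε : ε ∈ Metric.ball (0 : ℂ) P.ε₀)
    (hw : ContinuousOn (fun p : ℂ × ℝ => w p.1 p.2) (X ×ˢ univ))
    (hb : ∀ τ ∈ X, ∀ m, ‖w τ m‖ ≤ M τ * weight P.μ P.β m) {τ : ℂ} (hτ : τ ∈ X) (m : ℝ) :
    Integrable fun m₁ : ℝ => P.C l₁ l₂ (m - m₁) ε * ((P.R l₁ l₂).eval (I * (m₁ : ℂ)) * w τ m₁) := by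
  obtain ⟨q, hq, hqb⟩ := exists_integrable_majorant hP h₁ h₂ hb
  obtain ⟨B, -, hB⟩ := norm_C_le_const hP h₁ h₂ hε
  exact integrable_convol_integrand (hP.C_cont l₁ h₁ l₂ h₂ ε hε) hB (continuousOn_eval_mul _ hw)
    hq hqb hτ m

end BorelConv

theorem ball_subset_closedBall_sector {ρ d θ : ℝ} :
    infSector d θ ∪ Metric.ball 0 ρ ⊆ infSector d θ ∪ Metric.closedBall 0 ρ :=
  union_subset_union_right _ Metric.ball_subset_closedBall

theorem inExpBall_borelOp (hP : P.Valid) {ρ d θ : ℝ} (hρ : 0 < ρ) (hS : P.AvoidsRoots ρ d θ) {ε : ℂ}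
    (hε : ε ∈ Metric.ball (0 : ℂ) P.ε₀)
    (hcontr : ∀ τ ∈ infSector d θ ∪ Metric.closedBall 0 ρ, ∀ (b : ℝ) (w : ℂ → ℝ → ℂ),
      (∀ m, ‖w τ m‖ ≤ b * weight P.μ P.β m) →
      ∀ m, ‖P.borelOp ε w τ m‖ ≤ 1 / 2 * b * weight P.μ P.β m)
    {B : ℝ} {w : ℂ → ℝ → ℂ} (hw : P.InExpBall ρ d θ B w) :
    P.InExpBall ρ d θ (B / 2) (P.borelOp ε w) := by
  have hM : Continuous fun τ => B * P.growth τ := continuous_const.mul (continuous_growth hP)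
  have hb := fun (τ : ℂ) (hτ : τ ∈ infSector d θ ∪ Metric.closedBall 0 ρ) (m : ℝ) =>
    norm_le_of_inExpBall hw hτ m
  have hsub := ball_subset_closedBall_sector (ρ := ρ) (d := d) (θ := θ)
  refine ⟨?_, fun m => ?_, fun τ hτ m => ?_⟩
  · refine ContinuousOn.mul (continuous_Pm.continuousOn.inv₀ fun p hp =>
      Pm_ne_zero hP hρ hS hp.1 p.2) ?_
    refine continuousOn_finsetSum _ fun l₁ h₁ => continuousOn_finsetSum _ fun l₂ h₂ => ?_
    exact ((differentiable_borelCoeff l₁ l₂ ε).continuous.comp continuous_fst).continuousOn.mul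
      (continuousOn_borelConv hP h₁ h₂ hε hw.cont hM hb)
  · refine DifferentiableOn.mul ((differentiable_Pm m).differentiableOn.inv fun τ hτ =>
      Pm_ne_zero hP hρ hS (hsub hτ) m) ?_
    refine DifferentiableOn.fun_sum fun l₁ h₁ => DifferentiableOn.fun_sum fun l₂ h₂ => ?_
    exact (differentiable_borelCoeff l₁ l₂ ε).differentiableOn.mul
      (differentiableOn_borelConv hP h₁ h₂ hε ((isOpen_infSector d θ).union Metric.isOpen_ball)
        (hw.cont.mono (prod_mono hsub Subset.rfl)) hw.holo hM (fun τ hτ => hb τ (hsub hτ)) m)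
  · refine bound_of_norm_le ((hcontr τ hτ _ w (hb τ hτ) m).trans (le_of_eq ?_))
    ring

theorem continuous_profile {Cψ : ℝ} {ψ : ℂ → ℝ → ℂ → ℂ} (hP : P.Valid)
    (hψ : P.IsForcingProfile Cψ ψ) (hC : 0 ≤ Cψ) {ε : ℂ} (hε : ε ∈ Metric.ball (0 : ℂ) P.ε₀) :
    Continuous fun p : ℂ × ℝ => ψ p.1 p.2 ε := by
  refine continuous_uncurry_of_differentiable (F := fun τ m => ψ τ m ε)
    (M := fun τ => Cψ * P.growth τ) (fun m => hψ.entire m ε hε) (fun τ => hψ.cont τ ε hε)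
    (continuous_const.mul (continuous_growth hP)) fun τ m => (hψ.bound τ m ε hε).trans ?_
  have := weight_le_one (by linarith [one_lt_μ hP]) hP.β_pos.le m (μ := P.μ)
  have hg := growth_nonneg (P := P) τ
  calc _ = Cψ * P.growth τ * weight P.μ P.β m := by
        rw [weight, growth, Real.rpow_neg (by positivity)]; ring
    _ ≤ _ := mul_le_of_le_one_right (by positivity) this

theorem norm_profile_le {Cψ : ℝ} {ψ : ℂ → ℝ → ℂ → ℂ} (hψ : P.IsForcingProfile Cψ ψ) {ε : ℂ}
    (hε : ε ∈ Metric.ball (0 : ℂ) P.ε₀) (τ : ℂ) (m : ℝ) :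
    ‖ψ τ m ε‖ ≤ Cψ * P.growth τ * weight P.μ P.β m := by
  refine (hψ.bound τ m ε hε).trans (le_of_eq ?_)
  rw [weight, growth, Real.rpow_neg (by positivity)]; ring

theorem inExpBall_div_Pm (hP : P.Valid) {ρ d θ : ℝ} (hρ : 0 < ρ) (hS : P.AvoidsRoots ρ d θ)
    {c : ℝ} (hc : 0 < c) (hPm : ∀ τ ∈ infSector d θ ∪ Metric.closedBall 0 ρ, ∀ m : ℝ,
      c ≤ ‖P.Pm m τ‖) {Cψ : ℝ} {ψ : ℂ → ℝ → ℂ → ℂ} (hψ : P.IsForcingProfile Cψ ψ)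
    (hC : 0 ≤ Cψ) {ε : ℂ} (hε : ε ∈ Metric.ball (0 : ℂ) P.ε₀) :
    P.InExpBall ρ d θ (Cψ / c) fun τ m => (P.Pm m τ)⁻¹ * ψ τ m ε := by
  have hsub := ball_subset_closedBall_sector (ρ := ρ) (d := d) (θ := θ)
  refine ⟨?_, fun m => ?_, fun τ hτ m => ?_⟩
  · exact (continuous_Pm.continuousOn.inv₀ fun p hp => Pm_ne_zero hP hρ hS hp.1 p.2).mul
      (continuous_profile hP hψ hC hε).continuousOn
  · exact ((differentiable_Pm m).differentiableOn.inv fun τ hτ =>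
      Pm_ne_zero hP hρ hS (hsub hτ) m).mul (hψ.entire m ε hε).differentiableOn
  · refine bound_of_norm_le (w := fun τ m => (P.Pm m τ)⁻¹ * ψ τ m ε) ?_
    rw [norm_mul, norm_inv]
    calc _ ≤ c⁻¹ * (Cψ * P.growth τ * weight P.μ P.β m) :=
          mul_le_mul (inv_anti₀ hc (hPm τ hτ m)) (norm_profile_le hψ hε τ m) (norm_nonneg _)
            (by positivity)
      _ = _ := by ring

/-- The growth factor is bounded on unit balls, so the series converges uniformly near each point.
Continuity up to the closed disc and holomorphy on the open part pass to the sum, and the geometric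
series sums to twice its first term. -/
theorem inExpBall_tsum (hP : P.Valid) {ρ d θ B : ℝ} (hB : 0 ≤ B) {g : ℕ → ℂ → ℝ → ℂ}
    (hg : ∀ n, P.InExpBall ρ d θ (B / 2 ^ n) (g n)) :
    P.InExpBall ρ d θ (2 * B) fun τ m => ∑' n, g n τ m := by
  have hgeo : HasSum (fun n : ℕ => B / 2 ^ n) (2 * B) := by
    have := (hasSum_geometric_two).mul_left B
    simpa [div_eq_mul_inv, mul_comm, inv_pow] using this
  have hb := fun (n : ℕ) (τ : ℂ) (hτ : τ ∈ infSector d θ ∪ Metric.closedBall 0 ρ) (m : ℝ) =>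
    norm_le_of_inExpBall (hg n) hτ m
  have hsub := ball_subset_closedBall_sector (ρ := ρ) (d := d) (θ := θ)
  have hloc : ∀ τ₀ : ℂ, ∃ A : ℝ, 0 ≤ A ∧ ∀ τ ∈ Metric.ball τ₀ 1, P.growth τ ≤ A := by
    intro τ₀
    obtain ⟨A, hA⟩ := (isCompact_closedBall τ₀ 1).exists_bound_of_continuousOn
      (continuous_growth hP).continuousOn
    refine ⟨A, (norm_nonneg _).trans (hA τ₀ (by simp)), fun τ hτ =>
      (le_abs_self _).trans (hA τ (Metric.ball_subset_closedBall hτ))⟩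
  have hunif : ∀ (A : ℝ), 0 ≤ A → ∀ (n : ℕ) (τ : ℂ), P.growth τ ≤ A →
      τ ∈ infSector d θ ∪ Metric.closedBall 0 ρ → ∀ m, ‖g n τ m‖ ≤ B / 2 ^ n * A := by
    intro A hA n τ hτA hτ m
    refine (hb n τ hτ m).trans ?_
    have h1 := weight_le_one (by linarith [one_lt_μ hP]) hP.β_pos.le m (μ := P.μ)
    have h2 := growth_nonneg (P := P) τ
    calc _ ≤ B / 2 ^ n * P.growth τ := mul_le_of_le_one_right (by positivity) h1
      _ ≤ _ := by gcongr
  refine ⟨?_, fun m => ?_, fun τ hτ m => ?_⟩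
  · rintro ⟨τ₀, m₀⟩ ⟨hτ₀, -⟩
    obtain ⟨A, hA, hAb⟩ := hloc τ₀
    have hmem : Metric.ball τ₀ 1 ×ˢ (univ : Set ℝ) ∈ 𝓝 (τ₀, m₀) :=
      prod_mem_nhds (Metric.ball_mem_nhds _ one_pos) univ_mem
    rw [← continuousWithinAt_inter hmem]
    have hc : ContinuousOn (fun p : ℂ × ℝ => ∑' n, g n p.1 p.2)
        ((infSector d θ ∪ Metric.closedBall 0 ρ) ×ˢ univ ∩ Metric.ball τ₀ 1 ×ˢ univ) := by
      refine continuousOn_tsum (u := fun n => B / 2 ^ n * A)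
        (fun n => (hg n).cont.mono inter_subset_left) (hgeo.summable.mul_right A) ?_
      rintro n ⟨τ, m⟩ hp
      exact hunif A hA n τ (hAb τ hp.2.1) hp.1.1 m
    exact hc (τ₀, m₀) ⟨⟨hτ₀, mem_univ _⟩, Metric.mem_ball_self one_pos, mem_univ _⟩
  · intro τ₀ hτ₀
    obtain ⟨A, hA, hAb⟩ := hloc τ₀
    rw [← differentiableWithinAt_inter (Metric.ball_mem_nhds τ₀ one_pos)]
    have hopen : IsOpen ((infSector d θ ∪ Metric.ball 0 ρ) ∩ Metric.ball τ₀ 1) :=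
      ((isOpen_infSector d θ).union Metric.isOpen_ball).inter Metric.isOpen_ball
    have hc : DifferentiableOn ℂ (fun τ => ∑' n, g n τ m)
        ((infSector d θ ∪ Metric.ball 0 ρ) ∩ Metric.ball τ₀ 1) := by
      refine differentiableOn_tsum_of_summable_norm (u := fun n => B / 2 ^ n * A)
        (hgeo.summable.mul_right A) (fun n => ((hg n).holo m).mono inter_subset_left) hopen ?_
      intro n τ hp
      exact hunif A hA n τ (hAb τ hp.2) (hsub hp.1) m
    exact hc τ₀ ⟨hτ₀, Metric.mem_ball_self one_pos⟩
  · refine bound_of_norm_le (w := fun τ m => ∑' n, g n τ m) ?_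
    have h1 := (hgeo.mul_right (P.growth τ)).mul_right (weight P.μ P.β m)
    exact tsum_of_norm_bounded h1 fun n => hb n τ hτ m

/-- The operator commutes with summation of a geometrically dominated series. -/
theorem borelSum_tsum (hP : P.Valid) {ρ d θ B : ℝ} {ε : ℂ}
    (hε : ε ∈ Metric.ball (0 : ℂ) P.ε₀) {g : ℕ → ℂ → ℝ → ℂ}
    (hg : ∀ n, P.InExpBall ρ d θ (B / 2 ^ n) (g n))
    {τ : ℂ} (hτ : τ ∈ infSector d θ ∪ Metric.closedBall 0 ρ) (m : ℝ) :
    HasSum (fun n => P.borelSum ε (g n) τ m) (P.borelSum ε (fun τ m => ∑' n, g n τ m) τ m) := by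
  have hgeo : Summable (fun n : ℕ => B / 2 ^ n) := by
    have := (summable_geometric_two).mul_left B
    simpa [div_eq_mul_inv, mul_comm, inv_pow] using this
  have hb := fun (n : ℕ) (τ : ℂ) (hτ : τ ∈ infSector d θ ∪ Metric.closedBall 0 ρ) (m : ℝ) =>
    norm_le_of_inExpBall (hg n) hτ m
  refine hasSum_sum fun l₁ h₁ => hasSum_sum fun l₂ h₂ => HasSum.mul_left _ (HasSum.mul_left _ ?_)
  -- Applied to the weight itself, as a function constant in `τ`, to obtain an integrable majorant
  -- of `R_{ℓ₁ℓ₂}(im)` times the weight, common to all terms of the series.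
  obtain ⟨q, hq, hqb⟩ := exists_integrable_majorant (X := {τ}) (w := fun _ m => (weight P.μ P.β m : ℂ))
    (M := fun _ => 1) hP h₁ h₂ fun _ _ m => by
      rw [one_mul, norm_real, Real.norm_of_nonneg (weight_pos _ _ _).le]
  obtain ⟨A, hA, hAC⟩ := norm_C_le_const hP h₁ h₂ hε
  have hsum : ∀ m₁, P.C l₁ l₂ (m - m₁) ε * (eval (I * (m₁ : ℂ)) (P.R l₁ l₂) * ∑' n, g n τ m₁)
      = ∑' n, P.C l₁ l₂ (m - m₁) ε * (eval (I * (m₁ : ℂ)) (P.R l₁ l₂) * g n τ m₁) := by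
    intro m₁
    rw [tsum_mul_left, tsum_mul_left]
  simp only [hsum]
  refine hasSum_integral_of_summable_integral_norm
    (fun n => integrable_borelConv_integrand hP h₁ h₂ hε (hg n).cont
      (M := fun τ => B / 2 ^ n * P.growth τ) (hb n) hτ m) ?_
  refine Summable.of_nonneg_of_le (fun n => integral_nonneg fun _ => norm_nonneg _) (fun n => ?_)
    (hgeo.mul_right (P.growth τ * A * ∫ m₁, q m₁))
  rw [← mul_assoc, ← integral_const_mul]
  refine integral_mono_of_nonneg (ae_of_all _ fun _ => norm_nonneg _) (hq.const_mul _)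
    (ae_of_all _ fun m₁ => ?_)
  have h1 := hqb τ rfl m₁
  rw [norm_mul, norm_real, Real.norm_of_nonneg (weight_pos _ _ _).le, one_mul] at h1
  have h2 : 0 ≤ B / 2 ^ n * P.growth τ := by
    have := (norm_nonneg _).trans (hb n τ hτ 0)
    exact nonneg_of_mul_nonneg_left this (weight_pos _ _ 0)
  beta_reduce
  rw [norm_mul, norm_mul]
  calc _ ≤ A * (‖eval (I * (m₁ : ℂ)) (P.R l₁ l₂)‖
        * (B / 2 ^ n * P.growth τ * weight P.μ P.β m₁)) := by
        gcongr
        · exact hAC _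
        · exact hb n τ hτ m₁
    _ = A * (B / 2 ^ n * P.growth τ) *
        (‖eval (I * (m₁ : ℂ)) (P.R l₁ l₂)‖ * weight P.μ P.β m₁) := by ring
    _ ≤ A * (B / 2 ^ n * P.growth τ) * q m₁ := by gcongr
    _ = _ := by ring

theorem borelSum_sub (hP : P.Valid) {ρ d θ B : ℝ} {ε : ℂ}
    (hε : ε ∈ Metric.ball (0 : ℂ) P.ε₀) {w w' : ℂ → ℝ → ℂ} (hw : P.InExpBall ρ d θ B w)
    (hw' : P.InExpBall ρ d θ B w')
    {τ : ℂ} (hτ : τ ∈ infSector d θ ∪ Metric.closedBall 0 ρ) (m : ℝ) :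
    P.borelSum ε (fun τ m => w τ m - w' τ m) τ m = P.borelSum ε w τ m - P.borelSum ε w' τ m := by
  simp only [borelSum, ← Finset.sum_sub_distrib]
  refine Finset.sum_congr rfl fun l₁ h₁ => Finset.sum_congr rfl fun l₂ h₂ => ?_
  rw [← mul_sub]
  congr 1
  simp only [borelConv, convol]
  rw [← mul_sub, ← integral_sub]
  · congr 1
    refine integral_congr_ae (ae_of_all _ fun m₁ => ?_)
    simp only
    ring
  · exact integrable_borelConv_integrand hP h₁ h₂ hε hw.cont (M := fun τ => B * P.growth τ)
      (fun τ hτ m => norm_le_of_inExpBall hw hτ m) hτ m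
  · exact integrable_borelConv_integrand hP h₁ h₂ hε hw'.cont (M := fun τ => B * P.growth τ)
      (fun τ hτ m => norm_le_of_inExpBall hw' hτ m) hτ m

/-- Existence and uniqueness for the auxiliary equation, on one sector. -/
theorem exists_isBorelSolution (hP : P.Valid) {ρ d θ ϖ : ℝ} (hρ : 0 < ρ)
    (hS : P.AvoidsRoots ρ d θ) (hϖ : 0 < ϖ) :
    ∃ ε₁ ξ : ℝ, 0 < ε₁ ∧ ε₁ ≤ P.ε₀ ∧ 0 < ξ ∧
      ∀ (Cψ : ℝ) (ψ : ℂ → ℝ → ℂ → ℂ), 0 < Cψ → Cψ ≤ ξ → P.IsForcingProfile Cψ ψ →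
      ∀ ε ∈ Metric.ball (0 : ℂ) ε₁, P.IsBorelSolution ψ ε ρ d θ ϖ (P.borelSol ψ ε) := by
  obtain ⟨c, hc, hPm⟩ := exists_le_norm_Pm hP hρ hS
  obtain ⟨κ, hκ, hop⟩ := exists_norm_borelOp_le hP hρ hS
  have hPm' : ∀ τ ∈ infSector d θ ∪ Metric.closedBall 0 ρ, ∀ m : ℝ, c ≤ ‖P.Pm m τ‖ := by
    intro τ hτ m
    refine le_trans ?_ (hPm τ hτ m)
    rw [mul_assoc]
    refine le_mul_of_one_le_right hc.le (one_le_mul_of_one_le_of_one_le ?_ ?_)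
    · exact one_le_pow₀ (by linarith [norm_nonneg τ])
    · exact one_le_pow₀ (by linarith [abs_nonneg m])
  -- The radius gives `κ |ε| ≤ 1/2`. The size of the profile makes the first Neumann term at most
  -- `ϖ/2`, so the whole series is at most `ϖ`.
  refine ⟨min P.ε₀ (min 1 (1 / (2 * κ))), ϖ * c / 2, ?_, min_le_left _ _, by positivity, ?_⟩
  · have := hP.ε₀_pos
    positivity
  intro Cψ ψ hC hCξ hψ ε hε
  rw [mem_ball_zero_iff, lt_min_iff, lt_min_iff] at hε
  obtain ⟨hε0, hε1, hεκ⟩ := hε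
  have hεb : ε ∈ Metric.ball (0 : ℂ) P.ε₀ := by rwa [mem_ball_zero_iff]
  have hκε : κ * ‖ε‖ ≤ 1 / 2 := by
    rw [lt_div_iff₀ (by positivity)] at hεκ
    linarith
  have hcontr : ∀ τ ∈ infSector d θ ∪ Metric.closedBall 0 ρ, ∀ (b : ℝ) (w : ℂ → ℝ → ℂ),
      (∀ m, ‖w τ m‖ ≤ b * weight P.μ P.β m) →
      ∀ m, ‖P.borelOp ε w τ m‖ ≤ 1 / 2 * b * weight P.μ P.β m := by
    intro τ hτ b w hw m
    refine (hop ε hεb hε1.le τ hτ b w hw m).trans ?_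
    have hb : 0 ≤ b := nonneg_of_mul_nonneg_left ((norm_nonneg _).trans (hw 0)) (weight_pos _ _ 0)
    have := weight_pos P.μ P.β m
    gcongr
  have hterm : ∀ n, P.InExpBall ρ d θ (Cψ / c / 2 ^ n) (P.neumannTerm ψ ε n) := by
    intro n
    induction n with
    | zero => simpa [neumannTerm] using inExpBall_div_Pm hP hρ hS hc hPm' hψ hC.le hεb
    | succ n ih =>
      have := inExpBall_borelOp hP hρ hS hεb hcontr ih
      rw [div_div, ← pow_succ] at this
      simpa only [neumannTerm, Function.iterate_succ_apply'] using this
  have hsum := inExpBall_tsum hP (by positivity) hterm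
  have hle : 2 * (Cψ / c) ≤ ϖ := by
    have : Cψ / c ≤ ϖ / 2 := by rw [div_le_iff₀ hc]; linarith
    linarith
  have hw : P.InExpBall ρ d θ ϖ (P.borelSol ψ ε) :=
    ⟨hsum.cont, hsum.holo, fun τ hτ m => (hsum.bound τ hτ m).trans (by gcongr)⟩
  have hsol : P.SolvesBorel ψ ε (infSector d θ ∪ Metric.closedBall 0 ρ) (P.borelSol ψ ε) := by
    rw [solvesBorel_iff]
    intro τ hτ m
    have hne := Pm_ne_zero hP hρ hS hτ m
    have hS1 : HasSum (fun n => P.borelSum ε (P.neumannTerm ψ ε n) τ m)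
        (P.borelSum ε (P.borelSol ψ ε) τ m) := borelSum_tsum hP hεb hterm hτ m
    have hsm : Summable fun n => P.neumannTerm ψ ε n τ m := by
      have hgeo : Summable (fun n : ℕ => Cψ / c / 2 ^ n) := by
        have := (summable_geometric_two).mul_left (Cψ / c)
        simpa [div_eq_mul_inv, mul_comm, inv_pow] using this
      exact Summable.of_norm_bounded ((hgeo.mul_right (P.growth τ)).mul_right (weight P.μ P.β m))
        fun n => norm_le_of_inExpBall (hterm n) hτ m
    have h1 : P.borelSol ψ ε τ m = (P.Pm m τ)⁻¹ * ψ τ m ε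
        + (P.Pm m τ)⁻¹ * P.borelSum ε (P.borelSol ψ ε) τ m := by
      rw [borelSol, hsm.tsum_eq_zero_add, ← (hS1.mul_left (P.Pm m τ)⁻¹).tsum_eq]
      simp only [neumannTerm, Function.iterate_succ_apply', Function.iterate_zero, id_eq, borelOp]
    rw [h1]
    field_simp
    ring
  refine ⟨hw, hsol, ?_⟩
  · intro w' hw' hsol' τ hτ m
    rw [solvesBorel_iff] at hsol hsol'
    -- The difference of two solutions is a fixed point of the linear operator; each application
    -- halves its bound at this `τ`, so it vanishes.
    have hfix : ∀ m, P.borelOp ε (fun τ m => w' τ m - P.borelSol ψ ε τ m) τ m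
        = w' τ m - P.borelSol ψ ε τ m := by
      intro m
      have hne := Pm_ne_zero hP hρ hS hτ m
      have e1 := hsol τ hτ m
      have e2 := hsol' τ hτ m
      rw [borelOp, borelSum_sub hP hεb hw' hw hτ m, inv_mul_eq_iff_eq_mul₀ hne]
      linear_combination e1 - e2
    have hiter : ∀ (n : ℕ) (m : ℝ), ‖w' τ m - P.borelSol ψ ε τ m‖
        ≤ (1 / 2) ^ n * (2 * ϖ * P.growth τ) * weight P.μ P.β m := by
      intro n
      induction n with
      | zero =>
        intro m
        have h1 := norm_le_of_inExpBall hw hτ m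
        have h2 := norm_le_of_inExpBall hw' hτ m
        have h3 := norm_sub_le (w' τ m) (P.borelSol ψ ε τ m)
        linarith
      | succ n ih =>
        intro m
        rw [← hfix m]
        refine (hcontr τ hτ _ (fun τ m => w' τ m - P.borelSol ψ ε τ m) ih m).trans (le_of_eq ?_)
        ring
    have hlim : Tendsto (fun n : ℕ => (1 / 2 : ℝ) ^ n * (2 * ϖ * P.growth τ) * weight P.μ P.β m)
        atTop (𝓝 0) := by
      have := ((tendsto_pow_atTop_nhds_zero_of_lt_one (r := (1 / 2 : ℝ)) (by norm_num)
        (by norm_num)).mul_const (2 * ϖ * P.growth τ)).mul_const (weight P.μ P.β m)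
      simpa using this
    have := ge_of_tendsto' hlim fun n => hiter n m
    exact sub_eq_zero.1 (norm_le_zero_iff.1 this)

end MainData

end InnerSol

end

noncomputable section

namespace InnerSol

/-! ### Rotation of half lines -/

theorem norm_ray {r φ : ℝ} (hr : 0 ≤ r) : ‖(r : ℂ) * exp (φ * I)‖ = r := by
  rw [norm_mul, norm_exp_ofReal_mul_I, mul_one, norm_real, Real.norm_of_nonneg hr]

theorem continuous_ray_left (φ : ℝ) : Continuous fun r : ℝ => (r : ℂ) * exp (φ * I) := by
  fun_prop

section Rotation

variable {h : ℂ → ℂ} {ξ ξ' : ℝ}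

/-- With `r = e^x` the measure `dr/r` becomes `dx`: half lines are horizontal lines in the
logarithmic coordinate. -/
theorem integral_comp_exp_ray {a b φ : ℝ} (ha : 0 < a) (hab : a ≤ b)
    (hh : ∀ r ∈ Icc a b, DifferentiableAt ℂ h (r * exp (φ * I))) :
    ∫ x in Real.log a..Real.log b, h (exp (x + φ * I)) = ∫ r in a..b, h (r * exp (φ * I)) / r := by
  have hb : 0 < b := ha.trans_le hab
  have himg : Real.exp '' uIcc (Real.log a) (Real.log b) ⊆ Icc a b := by
    rintro _ ⟨x, hx, rfl⟩
    rw [uIcc_of_le (Real.log_le_log ha hab)] at hx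
    exact ⟨(Real.log_le_iff_le_exp ha).1 hx.1, (Real.le_log_iff_exp_le hb).1 hx.2⟩
  have := intervalIntegral.integral_deriv_smul_comp'' (a := Real.log a) (b := Real.log b)
    (f := Real.exp) (f' := Real.exp) (g := fun r : ℝ => h (r * exp (φ * I)) / r)
    Real.continuous_exp.continuousOn
    (fun x _ => (Real.hasDerivAt_exp x).hasDerivWithinAt) Real.continuous_exp.continuousOn ?_
  · rw [Real.exp_log ha, Real.exp_log hb] at this
    rw [← this]
    refine intervalIntegral.integral_congr fun x _ => ?_
    have hx : (Real.exp x : ℂ) ≠ 0 := ofReal_ne_zero.2 (Real.exp_pos x).ne'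
    simp only [Function.comp, real_smul]
    rw [mul_div_cancel₀ _ hx, ofReal_exp, ← exp_add]
  · refine ContinuousOn.mono ?_ himg
    refine ContinuousOn.div (fun r hr => ?_) continuous_ofReal.continuousOn
      fun r hr => ofReal_ne_zero.2 (ha.trans_le hr.1).ne'
    exact ((hh r hr).continuousAt.comp (f := fun r : ℝ => (r : ℂ) * exp (φ * I))
      (continuous_ray_left φ).continuousAt).continuousWithinAt

/-- An annular sector is the exponential image of a rectangle, so this is Cauchy's theorem on a
rectangle for `h ∘ exp`; the vertical sides become the two arcs. Rectangles also allow angles whose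
difference exceeds `2π`. -/
theorem integral_ray_sub_integral_ray {a b : ℝ} (ha : 0 < a) (hab : a ≤ b)
    (hh : ∀ r ∈ Icc a b, ∀ φ ∈ uIcc ξ ξ', DifferentiableAt ℂ h (r * exp (φ * I))) :
    (∫ r in a..b, h (r * exp (ξ' * I)) / r) - ∫ r in a..b, h (r * exp (ξ * I)) / r
      = I * (∫ φ in ξ..ξ', h (b * exp (φ * I))) - I * ∫ φ in ξ..ξ', h (a * exp (φ * I)) := by
  have hb : 0 < b := ha.trans_le hab
  have key := integral_boundary_rect_eq_zero_of_differentiableOn (fun s => h (exp s))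
    (Real.log a + ξ * I) (Real.log b + ξ' * I) ?_
  · simp only [add_re, ofReal_re, mul_re, I_re, mul_zero, ofReal_im, I_im, mul_one, sub_self,
      add_zero, add_im, mul_im, zero_add] at key
    rw [integral_comp_exp_ray ha hab fun r hr => hh r hr ξ left_mem_uIcc,
      integral_comp_exp_ray ha hab fun r hr => hh r hr ξ' right_mem_uIcc] at key
    have e : ∀ c : ℝ, 0 < c → ∀ φ : ℝ, exp ((Real.log c : ℂ) + φ * I) = c * exp (φ * I) := by
      intro c hc φ
      rw [exp_add, ← ofReal_exp, Real.exp_log hc]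
    simp only [e a ha, e b hb, smul_eq_mul] at key
    linear_combination -key
  · intro s hs
    rw [mem_reProdIm] at hs
    simp only [add_re, ofReal_re, mul_re, I_re, mul_zero, ofReal_im, I_im, mul_one, sub_self,
      add_zero, add_im, mul_im, zero_add] at hs
    rw [uIcc_of_le (Real.log_le_log ha hab)] at hs
    have : DifferentiableAt ℂ h (exp s) := by
      have := hh (Real.exp s.re) ⟨(Real.log_le_iff_le_exp ha).1 hs.1.1,
        (Real.le_log_iff_exp_le hb).1 hs.1.2⟩ s.im hs.2
      rwa [ofReal_exp, ← exp_add, re_add_im] at this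
    exact (this.comp s differentiable_exp.differentiableAt).differentiableWithinAt

theorem continuousOn_ray_div {s : Set ℝ} (hs : ∀ r ∈ s, 0 < r) {φ : ℝ}
    (hh : ∀ r ∈ s, ContinuousAt h (r * exp (φ * I))) :
    ContinuousOn (fun r : ℝ => h (r * exp (φ * I)) / r) s := by
  refine ContinuousOn.div (fun r hr => ?_) continuous_ofReal.continuousOn
    fun r hr => ofReal_ne_zero.2 (hs r hr).ne'
  exact ((hh r hr).comp (f := fun r : ℝ => (r : ℂ) * exp (φ * I))
    (continuous_ray_left φ).continuousAt).continuousWithinAt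

theorem integrableOn_ray_Icc {b K φ : ℝ}
    (hh : ∀ r ∈ Ioc 0 b, ContinuousAt h (r * exp (φ * I)))
    (hK : ∀ r ∈ Ioc 0 b, ‖h (r * exp (φ * I))‖ ≤ K * r) :
    IntegrableOn (fun r : ℝ => h (r * exp (φ * I)) / r) (Icc 0 b) := by
  rw [integrableOn_Icc_iff_integrableOn_Ioc]
  refine Integrable.mono' (g := fun _ => K) (integrable_const K)
    ((continuousOn_ray_div (fun r hr => hr.1) hh).aestronglyMeasurable measurableSet_Ioc) ?_
  refine (ae_restrict_mem measurableSet_Ioc).mono fun r hr => ?_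
  rw [norm_div, norm_real, Real.norm_of_nonneg hr.1.le, div_le_iff₀ hr.1]
  exact hK r hr

/-- The inner radius tends to `0`: the small arc contributes `O(a)` because `h` vanishes linearly at
the vertex, which also makes `h(u)/u` integrable there. -/
theorem integral_ray_zero_sub_integral_ray_zero {b K : ℝ} (hb : 0 < b)
    (hh : ∀ r ∈ Ioc 0 b, ∀ φ ∈ uIcc ξ ξ', DifferentiableAt ℂ h (r * exp (φ * I)))
    (hK : ∀ r ∈ Ioc 0 b, ∀ φ ∈ uIcc ξ ξ', ‖h (r * exp (φ * I))‖ ≤ K * r) :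
    (∫ r in 0..b, h (r * exp (ξ' * I)) / r) - ∫ r in 0..b, h (r * exp (ξ * I)) / r
      = I * ∫ φ in ξ..ξ', h (b * exp (φ * I)) := by
  have hint : ∀ φ ∈ uIcc ξ ξ', IntegrableOn (fun r : ℝ => h (r * exp (φ * I)) / r) (uIcc 0 b) := by
    intro φ hφ
    rw [uIcc_of_le hb.le]
    exact integrableOn_ray_Icc (fun r hr => (hh r hr φ hφ).continuousAt) fun r hr => hK r hr φ hφ
  have hlim : ∀ φ ∈ uIcc ξ ξ', Tendsto (fun a => ∫ r in a..b, h (r * exp (φ * I)) / r) (𝓝[>] 0)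
      (𝓝 (∫ r in 0..b, h (r * exp (φ * I)) / r)) := by
    intro φ hφ
    have := intervalIntegral.continuousOn_primitive_interval_left (hint φ hφ) 0 left_mem_uIcc
    rw [uIcc_of_le hb.le] at this
    refine this.mono_left ?_
    rw [← nhdsWithin_Ioc_eq_nhdsGT hb]
    exact nhdsWithin_mono _ Ioc_subset_Icc_self
  have harc : Tendsto (fun a : ℝ => I * ∫ φ in ξ..ξ', h (a * exp (φ * I))) (𝓝[>] 0) (𝓝 0) := by
    have hx : Tendsto (fun a : ℝ => K * a * |ξ' - ξ|) (𝓝[>] 0) (𝓝 0) := by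
      have : Tendsto (fun a : ℝ => K * a * |ξ' - ξ|) (𝓝 0) (𝓝 (K * 0 * |ξ' - ξ|)) :=
        Continuous.tendsto (by fun_prop) 0
      simpa using this.mono_left nhdsWithin_le_nhds
    refine squeeze_zero_norm' ?_ hx
    filter_upwards [Ioc_mem_nhdsGT hb] with a ha
    rw [norm_mul, norm_I, one_mul]
    exact intervalIntegral.norm_integral_le_of_norm_le_const fun φ hφ =>
      hK a ha φ (uIoc_subset_uIcc hφ)
  have h1 := ((hlim ξ' right_mem_uIcc).sub (hlim ξ left_mem_uIcc)).add harc
  rw [add_zero] at h1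
  refine tendsto_nhds_unique h1 (tendsto_const_nhds.congr' ?_)
  filter_upwards [Ioc_mem_nhdsGT hb] with a ha
  have := integral_ray_sub_integral_ray (h := h) (ξ := ξ) (ξ' := ξ') ha.1 ha.2 fun r hr φ hφ =>
    hh r ⟨ha.1.trans_le hr.1, hr.2⟩ φ hφ
  linear_combination -this

theorem integrableOn_ray_Ioi {K φ : ℝ} (hh : ∀ r : ℝ, 0 < r → ContinuousAt h (r * exp (φ * I)))
    (hK : ∀ r : ℝ, 0 < r → ‖h (r * exp (φ * I))‖ ≤ K * r * Real.exp (-r)) :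
    IntegrableOn (fun r : ℝ => h (r * exp (φ * I)) / r) (Ioi 0) := by
  refine ((exp_neg_integrableOn_Ioi 0 one_pos).const_mul K).mono'
    ((continuousOn_ray_div (fun r hr => hr) hh).aestronglyMeasurable measurableSet_Ioi) ?_
  refine (ae_restrict_mem measurableSet_Ioi).mono fun r hr => ?_
  rw [norm_div, norm_real, Real.norm_of_nonneg (le_of_lt hr), div_le_iff₀ hr]
  refine (hK r hr).trans (le_of_eq ?_)
  simp only [neg_mul, one_mul]
  ring

/-- The outer radius tends to infinity, and the exponential decay, uniform over the angles in
between, kills the large arc. -/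
theorem integral_ray_eq_integral_ray {K : ℝ}
    (hh : ∀ r : ℝ, 0 < r → ∀ φ ∈ uIcc ξ ξ', DifferentiableAt ℂ h (r * exp (φ * I)))
    (hK : ∀ r : ℝ, 0 < r → ∀ φ ∈ uIcc ξ ξ', ‖h (r * exp (φ * I))‖ ≤ K * r * Real.exp (-r)) :
    ∫ r in Ioi (0 : ℝ), h (r * exp (ξ * I)) / r = ∫ r in Ioi (0 : ℝ), h (r * exp (ξ' * I)) / r := by
  have hK0 : 0 ≤ K := by
    have := (norm_nonneg _).trans (hK 1 one_pos ξ left_mem_uIcc)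
    rw [mul_one] at this
    exact nonneg_of_mul_nonneg_left this (Real.exp_pos _)
  have hlim : ∀ φ ∈ uIcc ξ ξ', Tendsto (fun b => ∫ r in (0 : ℝ)..b, h (r * exp (φ * I)) / r) atTop
      (𝓝 (∫ r in Ioi (0 : ℝ), h (r * exp (φ * I)) / r)) := fun φ hφ =>
    intervalIntegral_tendsto_integral_Ioi 0
      (integrableOn_ray_Ioi (fun r hr => (hh r hr φ hφ).continuousAt) fun r hr => hK r hr φ hφ)
      tendsto_id
  have harc : Tendsto (fun a : ℝ => I * ∫ φ in ξ..ξ', h (a * exp (φ * I))) atTop (𝓝 0) := by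
    have hx : Tendsto (fun a : ℝ => K * (a ^ 1 * Real.exp (-a)) * |ξ' - ξ|) atTop (𝓝 0) := by
      simpa using ((Real.tendsto_pow_mul_exp_neg_atTop_nhds_zero 1).const_mul K).mul_const |ξ' - ξ|
    refine squeeze_zero_norm' ?_ hx
    filter_upwards [eventually_gt_atTop 0] with a ha
    rw [norm_mul, norm_I, one_mul, pow_one, ← mul_assoc]
    exact intervalIntegral.norm_integral_le_of_norm_le_const fun φ hφ =>
      hK a ha φ (uIoc_subset_uIcc hφ)
  have h1 := ((hlim ξ' right_mem_uIcc).sub (hlim ξ left_mem_uIcc)).sub harc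
  rw [sub_zero] at h1
  refine (sub_eq_zero.1 (tendsto_nhds_unique h1 (tendsto_const_nhds.congr' ?_))).symm
  filter_upwards [eventually_gt_atTop 0] with b hb
  have := integral_ray_zero_sub_integral_ray_zero (h := h) (ξ := ξ) (ξ' := ξ') (K := K) hb
    (fun r hr φ hφ => hh r hr.1 φ hφ) fun r hr φ hφ => (hK r hr.1 φ hφ).trans
      (mul_le_of_le_one_right (mul_nonneg hK0 hr.1.le)
        (Real.exp_le_one_iff.2 (by linarith [hr.1])))
  linear_combination -this

end Rotation

/-! ### The kernel -/

theorem ray_div_pow_re {T : ℂ} {a : ℝ} (hT : T = ‖T‖ * exp (a * I)) (r φ : ℝ) (k : ℕ) :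
    ((r * exp (φ * I) / T) ^ k).re = (r / ‖T‖) ^ k * Real.cos (k * (φ - a)) := by
  have e : (r * exp (φ * I) / T) ^ k = ((r / ‖T‖) ^ k : ℝ) * exp ((k * (φ - a) : ℝ) * I) := by
    conv_lhs => rw [hT]
    rw [mul_div_mul_comm, ← exp_sub, mul_pow, ← exp_nat_mul]
    push_cast
    congr 2
    ring
  rw [e, re_ofReal_mul, exp_ofReal_mul_I_re]

theorem norm_kernel (k₁ k₂ : ℕ) (u T₁ T₂ : ℂ) :
    ‖kernel k₁ k₂ u T₁ T₂‖ = Real.exp (-((u / T₁) ^ k₁).re - ((u / T₂) ^ k₂).re) := by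
  rw [kernel, norm_exp, sub_re, neg_re]

theorem differentiable_kernel (k₁ k₂ : ℕ) (T₁ T₂ : ℂ) :
    Differentiable ℂ fun u => kernel k₁ k₂ u T₁ T₂ := by
  unfold kernel
  fun_prop

/-- A polynomial exponent with negative leading term of highest degree beats lower order growth. -/
theorem exists_exponent_le {k₁ k₂ : ℕ} {k' ν A c : ℝ} (h1 : 1 ≤ k₁) (h12 : k₁ < k₂) (hk' : 0 < k')
    (hk'2 : k' < k₂) (hc : 0 < c) :
    ∃ K : ℝ, ∀ r : ℝ, 0 ≤ r → ν * r ^ k' + A * r ^ k₁ - c * r ^ k₂ ≤ K - r := by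
  have h12' : (k₁ : ℝ) < k₂ := by exact_mod_cast h12
  have h1' : (1 : ℝ) ≤ k₁ := by exact_mod_cast h1
  obtain ⟨K₁, -, hK₁⟩ := exists_mul_rpow_le_rpow_add (b := c / 3) hk' hk'2 (abs_nonneg ν)
    (by positivity)
  obtain ⟨K₂, -, hK₂⟩ := exists_mul_rpow_le_rpow_add (b := c / 3) (by linarith) h12' (abs_nonneg A)
    (by positivity)
  obtain ⟨K₃, -, hK₃⟩ := exists_mul_rpow_le_rpow_add (b := c / 3) one_pos
    (h1'.trans_lt h12') zero_le_one (by positivity)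
  refine ⟨K₁ + K₂ + K₃, fun r hr => ?_⟩
  have e1 := hK₁ 1 one_pos r hr
  have e2 := hK₂ 1 one_pos r hr
  have e3 := hK₃ 1 one_pos r hr
  simp only [div_one, Real.one_rpow, mul_one, Real.rpow_natCast, Real.rpow_one, one_mul] at e1 e2 e3
  have f1 : ν * r ^ k' ≤ |ν| * r ^ k' := by gcongr; exact le_abs_self ν
  have f2 : A * r ^ k₁ ≤ |A| * r ^ k₁ := by gcongr; exact le_abs_self A
  linarith

/-- The factor of the kernel with `T₁` is bounded by its worst growth `exp((r/|T₁|)^{k₁})`. Since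
`k₁ < k₂`, the decay of the factor with `T₂` absorbs it together with `exp(ν r^{k'})`. So
convergence and rotation of half lines involve the direction relative to `T₂` only. -/
theorem exists_norm_mul_kernel_le {k₁ k₂ : ℕ} {k' ν c : ℝ} (h1 : 1 ≤ k₁) (h12 : k₁ < k₂)
    (hk' : 0 < k') (hk'2 : k' < k₂) {T₁ T₂ : ℂ} (hT₂ : T₂ ≠ 0) {a : ℝ}
    (ha : T₂ = ‖T₂‖ * exp (a * I)) (hc : 0 < c) :
    ∃ B : ℝ, 0 < B ∧ ∀ r φ : ℝ, 0 ≤ r → c ≤ Real.cos (k₂ * (φ - a)) →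
      Real.exp (ν * r ^ k') * ‖kernel k₁ k₂ (r * exp (φ * I)) T₁ T₂‖ ≤ B * Real.exp (-r) := by
  have hT : 0 < ‖T₂‖ := norm_pos_iff.2 hT₂
  obtain ⟨K, hK⟩ := exists_exponent_le (ν := ν) (A := (1 / ‖T₁‖) ^ k₁)
    (c := c * (1 / ‖T₂‖) ^ k₂) h1 h12 hk' hk'2 (by positivity)
  refine ⟨Real.exp K, Real.exp_pos _, fun r φ hr hφ => ?_⟩
  rw [norm_kernel, ← Real.exp_add, ← Real.exp_add]
  refine Real.exp_le_exp.2 ?_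
  have e1 : -((r * exp (φ * I) / T₁) ^ k₁).re ≤ (1 / ‖T₁‖) ^ k₁ * r ^ k₁ := by
    refine (neg_le_abs _).trans ((abs_re_le_norm _).trans (le_of_eq ?_))
    rw [norm_pow, norm_div, norm_ray hr, ← mul_pow]
    congr 1
    ring
  have e2 : c * (1 / ‖T₂‖) ^ k₂ * r ^ k₂ ≤ ((r * exp (φ * I) / T₂) ^ k₂).re := by
    rw [ray_div_pow_re ha]
    calc c * (1 / ‖T₂‖) ^ k₂ * r ^ k₂ = (r / ‖T₂‖) ^ k₂ * c := by
          rw [mul_assoc, ← mul_pow, mul_comm c]; congr 2; ring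
      _ ≤ _ := by gcongr
  have := hK r hr
  linarith

theorem exists_cos_lower_bound {k : ℕ} {a ξ ξ' : ℝ}
    (h : ∀ φ ∈ uIcc ξ ξ', |k * (φ - a)| < Real.pi / 2) :
    ∃ c : ℝ, 0 < c ∧ ∀ φ ∈ uIcc ξ ξ', c ≤ Real.cos (k * (φ - a)) := by
  obtain ⟨φ₀, h₀, hmin⟩ := (isCompact_uIcc (a := ξ) (b := ξ')).exists_isMinOn
    nonempty_uIcc (f := fun φ => Real.cos (k * (φ - a))) (by fun_prop)
  exact ⟨_, Real.cos_pos_of_mem_Ioo (abs_lt.1 (h φ₀ h₀)), fun φ hφ => hmin hφ⟩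

theorem laplaceRay_eq_integral (k₁ k₂ : ℕ) (g : ℂ → ℂ) (γ : ℝ) (T₁ T₂ : ℂ) :
    laplaceRay k₁ k₂ g γ T₁ T₂ = ∫ r in Ioi (0 : ℝ),
      (fun u => g u * kernel k₁ k₂ u T₁ T₂) (r * exp (γ * I)) / r := rfl

/-- The Laplace-like integral does not depend on the half line, as long as one does not cross the
directions in which the kernel fails to decay. -/
theorem laplaceRay_eq_laplaceRay {k₁ k₂ : ℕ} {k' ν K : ℝ} (h1 : 1 ≤ k₁) (h12 : k₁ < k₂)
    (hk' : 0 < k') (hk'2 : k' < k₂) {g : ℂ → ℂ} {ξ ξ' a : ℝ} {T₁ T₂ : ℂ} (hT₂ : T₂ ≠ 0)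
    (ha : T₂ = ‖T₂‖ * exp (a * I)) (hξ : |k₂ * (ξ - a)| < Real.pi / 2)
    (hξ' : |k₂ * (ξ' - a)| < Real.pi / 2)
    (hg : ∀ r : ℝ, 0 < r → ∀ φ ∈ uIcc ξ ξ', DifferentiableAt ℂ g (r * exp (φ * I)))
    (hK : ∀ r : ℝ, 0 < r → ∀ φ ∈ uIcc ξ ξ', ‖g (r * exp (φ * I))‖ ≤ K * r * Real.exp (ν * r ^ k')) :
    laplaceRay k₁ k₂ g ξ T₁ T₂ = laplaceRay k₁ k₂ g ξ' T₁ T₂ := by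
  -- The admissible directions for one determination `a` form an interval, so every direction
  -- between two admissible ones is admissible.
  have hconv : ∀ φ ∈ uIcc ξ ξ', |k₂ * (φ - a)| < Real.pi / 2 := by
    intro φ hφ
    have hk : (0 : ℝ) ≤ k₂ := Nat.cast_nonneg _
    rw [abs_lt] at hξ hξ' ⊢
    rcases mem_uIcc.1 hφ with ⟨h3, h4⟩ | ⟨h3, h4⟩ <;> constructor <;> nlinarith
  obtain ⟨c, hc, hcos⟩ := exists_cos_lower_bound hconv
  obtain ⟨B, hB, hBk⟩ := exists_norm_mul_kernel_le (ν := ν) (T₁ := T₁) h1 h12 hk' hk'2 hT₂ ha hc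
  have hK0 : 0 ≤ K := by
    have := (norm_nonneg _).trans (hK 1 one_pos ξ left_mem_uIcc)
    rw [mul_one] at this
    exact nonneg_of_mul_nonneg_left this (Real.exp_pos _)
  rw [laplaceRay_eq_integral, laplaceRay_eq_integral]
  refine integral_ray_eq_integral_ray (h := fun u => g u * kernel k₁ k₂ u T₁ T₂) (K := K * B) (fun r hr φ hφ =>
    (hg r hr φ hφ).mul (differentiable_kernel k₁ k₂ T₁ T₂).differentiableAt) fun r hr φ hφ => ?_
  rw [norm_mul]
  calc _ ≤ K * r * Real.exp (ν * r ^ k') * ‖kernel k₁ k₂ (r * exp (φ * I)) T₁ T₂‖ := by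
        gcongr; exact hK r hr φ hφ
    _ = K * r * (Real.exp (ν * r ^ k') * ‖kernel k₁ k₂ (r * exp (φ * I)) T₁ T₂‖) := by ring
    _ ≤ K * r * (B * Real.exp (-r)) := by
        have := hBk r φ (le_of_lt hr) (hcos φ hφ)
        have hr' : 0 < r := hr
        gcongr
    _ = _ := by ring

end InnerSol

end

noncomputable section

namespace InnerSol

/-! ### Functions of moderate growth -/

theorem exists_one_add_pow_le_exp {κ : ℝ} (hκ : 0 < κ) (n : ℕ) :
    ∃ C : ℝ, 0 < C ∧ ∀ x : ℝ, 0 ≤ x → (1 + x) ^ n ≤ C * Real.exp (κ * x) := by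
  refine ⟨n.factorial * Real.exp κ / κ ^ n, by positivity, fun x hx => ?_⟩
  have h := Real.pow_div_factorial_le_exp (κ * (1 + x)) (by positivity) n
  rw [div_le_iff₀ (by positivity), mul_pow, mul_add, mul_one, Real.exp_add] at h
  rw [div_mul_eq_mul_div, le_div_iff₀ (by positivity)]
  linarith

theorem integrable_exp_neg_mul_abs {κ : ℝ} (hκ : 0 < κ) :
    Integrable fun m : ℝ => Real.exp (-κ * |m|) := by
  obtain ⟨C, hC, h⟩ := exists_one_add_pow_le_exp hκ 2
  refine ((integrable_one_add_abs_rpow (s := 2) one_lt_two).const_mul C).mono'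
    (by fun_prop) (ae_of_all _ fun m => ?_)
  rw [Real.norm_of_nonneg (Real.exp_pos _).le, Real.rpow_neg (by positivity), Real.rpow_two,
    ← div_eq_mul_inv, le_div_iff₀ (by positivity), neg_mul, Real.exp_neg,
    inv_mul_le_iff₀ (Real.exp_pos _), mul_comm _ C]
  exact h |m| (abs_nonneg m)

theorem exists_pow_le_exp_rpow {k' : ℝ} (hk' : 0 < k') (n : ℕ) :
    ∃ C : ℝ, 0 < C ∧ ∀ x : ℝ, 0 ≤ x → x ^ n ≤ C * Real.exp (x ^ k') := by
  obtain ⟨N, hN⟩ := exists_nat_ge (n / k')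
  obtain ⟨C, hC, h⟩ := exists_one_add_pow_le_exp one_pos N
  refine ⟨C, hC, fun x hx => ?_⟩
  have hy : 0 ≤ x ^ k' := by positivity
  calc x ^ n = (x ^ k') ^ (n / k') := by
        rw [← Real.rpow_mul hx, mul_div_cancel₀ _ hk'.ne', Real.rpow_natCast]
    _ ≤ (1 + x ^ k') ^ (n / k') := Real.rpow_le_rpow hy (by linarith) (by positivity)
    _ ≤ (1 + x ^ k') ^ (N : ℝ) := Real.rpow_le_rpow_of_exponent_le (by linarith) hN
    _ ≤ _ := by simpa using h _ hy

/-- Functions on `S × ℝ`, holomorphic in the first variable, that grow at most like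
`‖τ‖ e^{ν‖τ‖^{k'}}` for some `ν`, and decay like `e^{-b|m|}` for every `b < β`. -/
structure Moderate (k' β : ℝ) (S : Set ℂ) (G : ℂ → ℝ → ℂ) : Prop where
  cont : ContinuousOn (fun p : ℂ × ℝ => G p.1 p.2) (S ×ˢ univ)
  holo : ∀ m, DifferentiableOn ℂ (fun τ => G τ m) S
  bound : ∀ b < β, ∃ K ν : ℝ, 0 ≤ K ∧ ∀ τ ∈ S, ∀ m : ℝ,
    ‖G τ m‖ ≤ K * ‖τ‖ * Real.exp (ν * ‖τ‖ ^ k') * Real.exp (-b * |m|)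

namespace Moderate

variable {k' β : ℝ} {S : Set ℂ} {G G' : ℂ → ℝ → ℂ}

theorem add (h : Moderate k' β S G) (h' : Moderate k' β S G') :
    Moderate k' β S fun τ m => G τ m + G' τ m := by
  refine ⟨h.cont.add h'.cont, fun m => (h.holo m).add (h'.holo m), fun b hb => ?_⟩
  obtain ⟨K, ν, hK, h1⟩ := h.bound b hb
  obtain ⟨K', ν', hK', h2⟩ := h'.bound b hb
  refine ⟨K + K', max ν ν', by positivity, fun τ hτ m => (norm_add_le _ _).trans ?_⟩
  have e1 : K * ‖τ‖ * Real.exp (ν * ‖τ‖ ^ k') * Real.exp (-b * |m|)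
      ≤ K * ‖τ‖ * Real.exp (max ν ν' * ‖τ‖ ^ k') * Real.exp (-b * |m|) := by
    gcongr; exact le_max_left _ _
  have e2 : K' * ‖τ‖ * Real.exp (ν' * ‖τ‖ ^ k') * Real.exp (-b * |m|)
      ≤ K' * ‖τ‖ * Real.exp (max ν ν' * ‖τ‖ ^ k') * Real.exp (-b * |m|) := by
    gcongr; exact le_max_right _ _
  have := h1 τ hτ m
  have := h2 τ hτ m
  linarith

theorem zero : Moderate k' β S fun _ _ => 0 :=
  ⟨continuousOn_const, fun _ => differentiableOn_const _, fun b _ =>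
    ⟨0, 0, le_rfl, fun τ _ m => by simp⟩⟩

theorem sum {ι : Type*} (s : Finset ι) {F : ι → ℂ → ℝ → ℂ} (h : ∀ i ∈ s, Moderate k' β S (F i)) :
    Moderate k' β S fun τ m => ∑ i ∈ s, F i τ m := by
  classical
  induction s using Finset.induction_on with
  | empty => simpa using zero
  | insert i s hi ih =>
    simp only [Finset.sum_insert hi]
    exact (h i (by simp)).add (ih fun j hj => h j (by simp [hj]))

/-- A power of `‖τ‖` is at most a multiple of `exp(‖τ‖^{k'})`, so `ν` grows by `1`. Leaving `ν` free
in `Moderate` is what makes the class stable under the operators of the equation. -/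
theorem const_mul_pow (hk' : 0 < k') (h : Moderate k' β S G) (c : ℂ) (n : ℕ) :
    Moderate k' β S fun τ m => c * τ ^ n * G τ m := by
  refine ⟨ContinuousOn.mul (by fun_prop) h.cont, fun m =>
    DifferentiableOn.mul (by fun_prop) (h.holo m), fun b hb => ?_⟩
  obtain ⟨K, ν, hK, h1⟩ := h.bound b hb
  obtain ⟨C, hC, h2⟩ := exists_pow_le_exp_rpow hk' n
  refine ⟨‖c‖ * C * K, 1 + ν, by positivity, fun τ hτ m => ?_⟩
  rw [norm_mul, norm_mul, norm_pow, add_mul, Real.exp_add, one_mul]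
  calc _ ≤ ‖c‖ * (C * Real.exp (‖τ‖ ^ k'))
        * (K * ‖τ‖ * Real.exp (ν * ‖τ‖ ^ k') * Real.exp (-b * |m|)) := by
        gcongr
        · exact h2 _ (norm_nonneg _)
        · exact h1 τ hτ m
    _ = _ := by ring

theorem const_mul (hk' : 0 < k') (h : Moderate k' β S G) (c : ℂ) :
    Moderate k' β S fun τ m => c * G τ m := by
  simpa using h.const_mul_pow hk' c 0

/-- Polynomial growth in `m` is paid by lowering the exponential rate from `b'` to `b < b'`. This is
why the rate in `Moderate` ranges over all `b < β` and does not include `β`. -/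
theorem eval_mul (h : Moderate k' β S G) (A : ℂ[X]) :
    Moderate k' β S fun τ m => A.eval (I * (m : ℂ)) * G τ m := by
  refine ⟨ContinuousOn.mul (A.continuous.comp (by fun_prop)).continuousOn h.cont,
    fun m => (h.holo m).const_mul _, fun b hb => ?_⟩
  obtain ⟨b', hb', hb'β⟩ := exists_between hb
  obtain ⟨K, ν, hK, h1⟩ := h.bound b' hb'β
  obtain ⟨c, hc, h2⟩ := exists_norm_eval_le_mul_pow A
  obtain ⟨C, hC, h3⟩ := exists_one_add_pow_le_exp (sub_pos.2 hb') A.natDegree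
  refine ⟨c * C * K, ν, by positivity, fun τ hτ m => ?_⟩
  rw [norm_mul]
  have e : Real.exp (-b * |m|) = Real.exp ((b' - b) * |m|) * Real.exp (-b' * |m|) := by
    rw [← Real.exp_add]; congr 1; ring
  rw [e]
  calc _ ≤ (c * (C * Real.exp ((b' - b) * |m|)))
        * (K * ‖τ‖ * Real.exp (ν * ‖τ‖ ^ k') * Real.exp (-b' * |m|)) := by
        refine mul_le_mul ((h2 m).trans ?_) (h1 τ hτ m) (norm_nonneg _) (by positivity)
        gcongr
        exact h3 _ (abs_nonneg m)
    _ = _ := by ring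

/-- Convolution in the second variable against an exponentially decaying function. -/
theorem convol (hS : IsOpen S) (hk' : 0 < k') (hβ : 0 < β) (h : Moderate k' β S G) {C : ℝ → ℂ}
    (hC : Continuous C) {B : ℝ} (hB : 0 ≤ B) (hCB : ∀ m, ‖C m‖ ≤ B * Real.exp (-β * |m|)) :
    Moderate k' β S (convol C G) := by
  have hCB' : ∀ m, ‖C m‖ ≤ B := fun m => (hCB m).trans (mul_le_of_le_one_right hB
    (Real.exp_le_one_iff.2 (by nlinarith [abs_nonneg m])))
  obtain ⟨K, ν, hK, h1⟩ := h.bound (β / 2) (by linarith)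
  have hM : Continuous fun τ : ℂ => K * ‖τ‖ * Real.exp (ν * ‖τ‖ ^ k') := by
    have : Continuous fun τ : ℂ => ‖τ‖ ^ k' :=
      continuous_norm.rpow_const fun τ => Or.inr hk'.le
    fun_prop
  have hq := integrable_exp_neg_mul_abs (half_pos hβ)
  refine ⟨continuousOn_convol hC hCB' h.cont hM hq h1,
    differentiableOn_convol hS hC hCB' h.cont h.holo hM hq h1, fun b hb => ?_⟩
  -- With `max b 0 < b₁ < b₂ < β`, the triangle inequality gives `b |m| + (b₂ - b₁) |m₁| ≤ β |m -
  -- m₁| + b₂ |m₁|`. Positivity of `b₁` is used here, as `b` may be negative; the gap `b₂ - b₁`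
  -- leaves integrability in `m₁`.
  obtain ⟨b₁, hb₁, hb₁β⟩ := exists_between (max_lt hb hβ)
  have hb₁0 : 0 < b₁ := (le_max_right _ _).trans_lt hb₁
  have hbb₁ : b < b₁ := (le_max_left _ _).trans_lt hb₁
  obtain ⟨b₂, hb₂, hb₂β⟩ := exists_between hb₁β
  obtain ⟨K, ν, hK, h1⟩ := h.bound b₂ hb₂β
  have hq := integrable_exp_neg_mul_abs (sub_pos.2 hb₂)
  have hI : 0 ≤ ∫ m : ℝ, Real.exp (-(b₂ - b₁) * |m|) := integral_nonneg fun m => by positivity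
  refine ⟨B * K * ∫ m : ℝ, Real.exp (-(b₂ - b₁) * |m|), ν, by positivity, fun τ hτ m => ?_⟩
  have hle : ‖∫ m₁ : ℝ, C (m - m₁) * G τ m₁‖ ≤ ∫ m₁ : ℝ, B * (K * ‖τ‖ * Real.exp (ν * ‖τ‖ ^ k'))
      * Real.exp (-b * |m|) * Real.exp (-(b₂ - b₁) * |m₁|) := by
    refine norm_integral_le_of_norm_le (hq.const_mul _) (ae_of_all _ fun m₁ => ?_)
    rw [norm_mul]
    calc ‖C (m - m₁)‖ * ‖G τ m₁‖ ≤ (B * Real.exp (-β * |m - m₁|))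
          * (K * ‖τ‖ * Real.exp (ν * ‖τ‖ ^ k') * Real.exp (-b₂ * |m₁|)) := by
          gcongr
          · exact hCB _
          · exact h1 τ hτ m₁
      _ = B * (K * ‖τ‖ * Real.exp (ν * ‖τ‖ ^ k'))
          * Real.exp (-β * |m - m₁| + -b₂ * |m₁|) := by rw [Real.exp_add]; ring
      _ ≤ B * (K * ‖τ‖ * Real.exp (ν * ‖τ‖ ^ k'))
          * Real.exp (-b * |m| + -(b₂ - b₁) * |m₁|) := by
          refine mul_le_mul_of_nonneg_left (Real.exp_le_exp.2 ?_) (by positivity)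
          have h3 : |m| ≤ |m - m₁| + |m₁| := by simpa using abs_add_le (m - m₁) m₁
          nlinarith [abs_nonneg m, abs_nonneg m₁, abs_nonneg (m - m₁)]
      _ = _ := by rw [Real.exp_add]; ring
  rw [integral_const_mul] at hle
  rw [InnerSol.convol, norm_mul]
  calc _ ≤ 1 * _ := mul_le_mul norm_inv_sqrt_two_pi_le_one hle (norm_nonneg _) zero_le_one
    _ = _ := by ring

end Moderate

/-! ### Exponential integrals -/

/-- The measure `dm dr` on `ℝ × (0,∞)`. -/
def rayMeasure : Measure (ℝ × ℝ) := volume.restrict (univ ×ˢ Ioi 0)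

theorem rayMeasure_eq_prod :
    rayMeasure = (volume : Measure ℝ).prod (volume.restrict (Ioi (0 : ℝ))) := by
  rw [rayMeasure, Measure.volume_eq_prod, ← Measure.prod_restrict, Measure.restrict_univ]

theorem ae_rayMeasure : ∀ᵐ x ∂rayMeasure, 0 < x.2 :=
  (ae_restrict_mem (MeasurableSet.univ.prod measurableSet_Ioi)).mono fun _ hx => hx.2

/-- The exponent `-A r^{k₁} - B r^{k₂} + i z m`, as a linear form in `(A, B, z)`. -/
def phase (k₁ k₂ : ℕ) (x : ℝ × ℝ) : ℂ × ℂ × ℂ →L[ℂ] ℂ :=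
  (-(x.2 : ℂ) ^ k₁) • ContinuousLinearMap.fst ℂ ℂ (ℂ × ℂ)
    + (-(x.2 : ℂ) ^ k₂) • (ContinuousLinearMap.fst ℂ ℂ ℂ).comp (ContinuousLinearMap.snd ℂ ℂ (ℂ × ℂ))
    + (I * x.1) • (ContinuousLinearMap.snd ℂ ℂ ℂ).comp (ContinuousLinearMap.snd ℂ ℂ (ℂ × ℂ))

theorem phase_apply (k₁ k₂ : ℕ) (x : ℝ × ℝ) (v : ℂ × ℂ × ℂ) :
    phase k₁ k₂ x v = -(x.2 : ℂ) ^ k₁ * v.1 + -(x.2 : ℂ) ^ k₂ * v.2.1 + I * x.1 * v.2.2 := rfl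

theorem continuous_phase (k₁ k₂ : ℕ) : Continuous (phase k₁ k₂) := by
  unfold phase
  fun_prop

theorem norm_phase_le (k₁ k₂ : ℕ) {x : ℝ × ℝ} (hx : 0 < x.2) :
    ‖phase k₁ k₂ x‖ ≤ x.2 ^ k₁ + x.2 ^ k₂ + |x.1| := by
  refine ContinuousLinearMap.opNorm_le_bound _ (by positivity) fun v => ?_
  have h1 : ‖v.1‖ ≤ ‖v‖ := norm_fst_le v
  have h2 : ‖v.2.1‖ ≤ ‖v‖ := (norm_fst_le v.2).trans (norm_snd_le v)
  have h3 : ‖v.2.2‖ ≤ ‖v‖ := (norm_snd_le v.2).trans (norm_snd_le v)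
  rw [phase_apply, add_mul, add_mul]
  have e : ∀ (k : ℕ), ‖-(x.2 : ℂ) ^ k‖ = x.2 ^ k := fun k => by
    rw [norm_neg, norm_pow, norm_real, Real.norm_of_nonneg hx.le]
  refine (norm_add₃_le).trans (add_le_add (add_le_add ?_ ?_) ?_)
  · rw [norm_mul, e]; gcongr
  · rw [norm_mul, e]; gcongr
  · rw [norm_mul, norm_mul, norm_I, one_mul, norm_real, Real.norm_eq_abs]; gcongr

theorem phase_re (k₁ k₂ : ℕ) (x : ℝ × ℝ) (v : ℂ × ℂ × ℂ) :
    (phase k₁ k₂ x v).re = -(x.2 ^ k₁ * v.1.re) - x.2 ^ k₂ * v.2.1.re - x.1 * v.2.2.im := by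
  rw [phase_apply]
  have e : ∀ (k : ℕ) (w : ℂ), (-(x.2 : ℂ) ^ k * w).re = -(x.2 ^ k * w.re) := fun k w => by
    rw [neg_mul, neg_re, ← ofReal_pow, re_ofReal_mul]
  rw [add_re, add_re, e, e, mul_assoc, mul_comm I, mul_assoc, re_ofReal_mul, mul_I_re]
  ring

/-- `∫ g(m, r) exp(-A r^{k₁} - B r^{k₂} + i z m) dm dr`. -/
def expIntegral (k₁ k₂ : ℕ) (g : ℝ × ℝ → ℂ) (v : ℂ × ℂ × ℂ) : ℂ :=
  ∫ x, g x * exp (phase k₁ k₂ x v) ∂rayMeasure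

/-- The densities for which the exponential integrals converge. -/
structure RayDensity (k' β : ℝ) (g : ℝ × ℝ → ℂ) : Prop where
  meas : AEStronglyMeasurable g rayMeasure
  bound : ∀ b < β, ∃ K ν : ℝ, 0 ≤ K ∧ ∀ m r : ℝ, 0 < r →
    ‖g (m, r)‖ ≤ K * Real.exp (ν * r ^ k') * Real.exp (-b * |m|)

section ExpIntegral

variable {k₁ k₂ : ℕ} {k' β : ℝ} {g : ℝ × ℝ → ℂ}

theorem aestronglyMeasurable_expIntegrand (hg : RayDensity k' β g) (v : ℂ × ℂ × ℂ) :
    AEStronglyMeasurable (fun x => g x * exp (phase k₁ k₂ x v)) rayMeasure := by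
  refine hg.meas.mul (Continuous.aestronglyMeasurable ?_)
  simp only [phase_apply]
  fun_prop

/-- Locally uniform domination of the integrand of an exponential integral and of its
derivative. -/
theorem exists_expIntegrand_majorant (h1 : 1 ≤ k₁) (h12 : k₁ < k₂) (hk' : 0 < k') (hk'2 : k' < k₂)
    (hg : RayDensity k' β g) {v₀ : ℂ × ℂ × ℂ} (hB : 0 < v₀.2.1.re) (hz : |v₀.2.2.im| < β) :
    ∃ η : ℝ, 0 < η ∧ ∃ q : ℝ × ℝ → ℝ, Integrable q rayMeasure ∧
      ∀ x : ℝ × ℝ, 0 < x.2 → ∀ v ∈ Metric.ball v₀ η,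
        ‖g x * exp (phase k₁ k₂ x v)‖ * (1 + ‖phase k₁ k₂ x‖) ≤ q x := by
  obtain ⟨b, hzb, hbβ⟩ := exists_between hz
  set η := min (v₀.2.1.re / 2) ((b - |v₀.2.2.im|) / 2) with hη
  have hη0 : 0 < η := lt_min (by linarith) (by linarith)
  have hη1 : η ≤ v₀.2.1.re / 2 := min_le_left _ _
  have hη2 : η ≤ (b - |v₀.2.2.im|) / 2 := min_le_right _ _
  obtain ⟨K, ν, hK, hgb⟩ := hg.bound b hbβ
  set c := v₀.2.1.re / 2 with hc
  have hc0 : 0 < c := by positivity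
  set κ := (b - |v₀.2.2.im|) / 2 with hκ
  have hκ0 : 0 < κ := by rw [hκ]; linarith
  -- The `+ 1` in `A` and the halved `c` make room for the terms of `Y` introduced below.
  obtain ⟨K₁, hK₁⟩ := exists_exponent_le (ν := ν) (A := ‖v₀.1‖ + η + 1) (c := c / 2) h1 h12 hk' hk'2
    (by positivity)
  set D := 1 + 1 + 2 / c + 2 / κ with hD
  have hD0 : 0 < D := by positivity
  refine ⟨η, hη0, fun x => K * D * Real.exp K₁ * (Real.exp (-(κ / 2) * |x.1|) * Real.exp (-x.2)),
    ?_, fun x hx v hv => ?_⟩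
  · rw [rayMeasure_eq_prod]
    refine Integrable.const_mul ?_ _
    have hexp : IntegrableOn (fun r : ℝ => Real.exp (-r)) (Ioi 0) := by
      simpa using exp_neg_integrableOn_Ioi 0 one_pos
    exact (integrable_exp_neg_mul_abs (half_pos hκ0)).mul_prod hexp
  · rw [mem_ball_iff_norm] at hv
    have v1 : ‖v.1 - v₀.1‖ < η := (norm_fst_le (v - v₀)).trans_lt hv
    have v2 : ‖v.2.1 - v₀.2.1‖ < η :=
      ((norm_fst_le (v - v₀).2).trans (norm_snd_le (v - v₀))).trans_lt hv
    have v3 : ‖v.2.2 - v₀.2.2‖ < η :=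
      ((norm_snd_le (v - v₀).2).trans (norm_snd_le (v - v₀))).trans_lt hv
    have w1 : -v.1.re ≤ ‖v₀.1‖ + η := by
      have := (neg_le_abs _).trans (abs_re_le_norm v.1)
      have := norm_le_norm_add_norm_sub v₀.1 v.1
      rw [norm_sub_rev] at v1
      linarith
    have w2 : c ≤ v.2.1.re := by
      have := (abs_le.1 ((abs_re_le_norm (v.2.1 - v₀.2.1)).trans v2.le)).1
      rw [sub_re] at this
      linarith
    have w3 : |v.2.2.im| ≤ b - κ := by
      have h4 := (abs_im_le_norm (v.2.2 - v₀.2.2)).trans v3.le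
      rw [sub_im] at h4
      have := abs_sub_abs_le_abs_sub v.2.2.im v₀.2.2.im
      linarith
    have hr1 : 0 ≤ x.2 ^ k₁ := by positivity
    have hr2 : 0 ≤ x.2 ^ k₂ := by positivity
    have hre : (phase k₁ k₂ x v).re
        ≤ (‖v₀.1‖ + η) * x.2 ^ k₁ - c * x.2 ^ k₂ + (b - κ) * |x.1| := by
      rw [phase_re]
      have i1 : -(x.2 ^ k₁ * v.1.re) ≤ (‖v₀.1‖ + η) * x.2 ^ k₁ := by nlinarith
      have i2 : c * x.2 ^ k₂ ≤ x.2 ^ k₂ * v.2.1.re := by nlinarith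
      have i3 : -(x.1 * v.2.2.im) ≤ (b - κ) * |x.1| := by
        refine (neg_le_abs _).trans ?_
        rw [abs_mul]
        nlinarith [abs_nonneg x.1]
      linarith
    -- `exp Y` dominates a multiple of `1 + ‖phase‖`, and `Y` is small enough to be added to the
    -- exponent without destroying the decay in `r` and in `m`.
    set Y := x.2 ^ k₁ + c / 2 * x.2 ^ k₂ + κ / 2 * |x.1| with hY
    have hY0 : 0 ≤ Y := by positivity
    have hphase : 1 + ‖phase k₁ k₂ x‖ ≤ D * Real.exp Y := by
      have j0 : 1 ≤ Real.exp Y := Real.one_le_exp hY0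
      have jY : Y ≤ Real.exp Y := by linarith [Real.add_one_le_exp Y]
      have j1 : x.2 ^ k₁ ≤ Real.exp Y := by
        have : 0 ≤ κ / 2 * |x.1| := by positivity
        have : 0 ≤ c / 2 * x.2 ^ k₂ := by positivity
        linarith
      have j2 : x.2 ^ k₂ ≤ 2 / c * Real.exp Y := by
        have : 0 ≤ κ / 2 * |x.1| := by positivity
        have : c / 2 * x.2 ^ k₂ ≤ Real.exp Y := by linarith
        rw [div_mul_eq_mul_div, le_div_iff₀ hc0]
        linarith
      have j3 : |x.1| ≤ 2 / κ * Real.exp Y := by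
        have : 0 ≤ c / 2 * x.2 ^ k₂ := by positivity
        have : κ / 2 * |x.1| ≤ Real.exp Y := by linarith
        rw [div_mul_eq_mul_div, le_div_iff₀ hκ0]
        linarith
      have := norm_phase_le k₁ k₂ hx
      rw [hD]
      linarith
    rw [norm_mul, norm_exp]
    calc _ ≤ (K * Real.exp (ν * x.2 ^ k') * Real.exp (-b * |x.1|))
          * Real.exp ((‖v₀.1‖ + η) * x.2 ^ k₁ - c * x.2 ^ k₂ + (b - κ) * |x.1|)
          * (D * Real.exp Y) := by
          gcongr
          exact hgb x.1 x.2 hx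
      _ = K * D * Real.exp ((ν * x.2 ^ k' + (‖v₀.1‖ + η + 1) * x.2 ^ k₁ - c / 2 * x.2 ^ k₂)
          + -(κ / 2) * |x.1|) := by
          have : ∀ a b c d : ℝ, K * Real.exp a * Real.exp b * Real.exp c * (D * Real.exp d)
              = K * D * Real.exp (a + b + c + d) := by
            intro a b c d
            simp only [Real.exp_add]; ring
          rw [this, hY]
          congr 2
          ring
      _ ≤ K * D * Real.exp ((K₁ - x.2) + -(κ / 2) * |x.1|) := by
          refine mul_le_mul_of_nonneg_left (Real.exp_le_exp.2 ?_) (by positivity)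
          exact add_le_add_left (hK₁ x.2 hx.le) _
      _ = _ := by
          rw [sub_eq_add_neg, Real.exp_add, Real.exp_add]; ring

theorem integrable_expIntegrand (h1 : 1 ≤ k₁) (h12 : k₁ < k₂) (hk' : 0 < k') (hk'2 : k' < k₂)
    (hg : RayDensity k' β g) {v₀ : ℂ × ℂ × ℂ} (hB : 0 < v₀.2.1.re) (hz : |v₀.2.2.im| < β) :
    Integrable (fun x => g x * exp (phase k₁ k₂ x v₀)) rayMeasure := by
  obtain ⟨η, hη, q, hq, hle⟩ := exists_expIntegrand_majorant h1 h12 hk' hk'2 hg hB hz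
  refine hq.mono' (aestronglyMeasurable_expIntegrand hg v₀) (ae_rayMeasure.mono fun x hx => ?_)
  refine le_trans ?_ (hle x hx v₀ (Metric.mem_ball_self hη))
  exact le_mul_of_one_le_right (norm_nonneg _) (by linarith [norm_nonneg (phase k₁ k₂ x)])

/-- Because the exponent is linear in `v`, a derivative is again an exponential integral, with the
density multiplied by the exponent evaluated at the direction `e`. Joint holomorphy in the three
variables and the formulas for `∂_{t₁}`, `∂_{t₂}`, `∂_z` all come from this one statement. -/
theorem hasFDerivAt_expIntegral (h1 : 1 ≤ k₁) (h12 : k₁ < k₂) (hk' : 0 < k') (hk'2 : k' < k₂)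
    (hg : RayDensity k' β g) {v₀ : ℂ × ℂ × ℂ} (hB : 0 < v₀.2.1.re) (hz : |v₀.2.2.im| < β) :
    ∃ L : ℂ × ℂ × ℂ →L[ℂ] ℂ, HasFDerivAt (expIntegral k₁ k₂ g) L v₀ ∧
      ∀ e, L e = expIntegral k₁ k₂ (fun x => phase k₁ k₂ x e * g x) v₀ := by
  obtain ⟨η, hη, q, hq, hle⟩ := exists_expIntegrand_majorant h1 h12 hk' hk'2 hg hB hz
  have hmeas : AEStronglyMeasurable
      (fun x => (g x * exp (phase k₁ k₂ x v₀)) • phase k₁ k₂ x) rayMeasure :=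
    (aestronglyMeasurable_expIntegrand hg v₀).smul (continuous_phase k₁ k₂).aestronglyMeasurable
  have hbd : ∀ x : ℝ × ℝ, 0 < x.2 → ∀ v ∈ Metric.ball v₀ η,
      ‖(g x * exp (phase k₁ k₂ x v)) • phase k₁ k₂ x‖ ≤ q x := by
    intro x hx v hv
    refine le_trans ?_ (hle x hx v hv)
    rw [norm_smul]
    gcongr
    linarith
  have hint : Integrable (fun x => (g x * exp (phase k₁ k₂ x v₀)) • phase k₁ k₂ x) rayMeasure :=
    hq.mono' hmeas (ae_rayMeasure.mono fun x hx => hbd x hx v₀ (Metric.mem_ball_self hη))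
  refine ⟨_, hasFDerivAt_integral_of_dominated_of_fderiv_le (𝕜 := ℂ)
    (F := fun v x => g x * exp (phase k₁ k₂ x v))
    (F' := fun v x => (g x * exp (phase k₁ k₂ x v)) • phase k₁ k₂ x)
    (Metric.ball_mem_nhds v₀ hη)
    (Eventually.of_forall fun v => aestronglyMeasurable_expIntegrand hg v)
    (integrable_expIntegrand h1 h12 hk' hk'2 hg hB hz) hmeas
    (ae_rayMeasure.mono fun x hx => hbd x hx) hq (ae_of_all _ fun x v _ => ?_), fun e => ?_⟩
  · have := ((phase k₁ k₂ x).hasFDerivAt (x := v)).cexp.const_mul (g x)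
    rwa [smul_smul] at this
  · rw [ContinuousLinearMap.integral_apply hint]
    refine integral_congr_ae (ae_of_all _ fun x => ?_)
    simp only [smul_apply, smul_eq_mul]
    ring

end ExpIntegral

end InnerSol

end

noncomputable section

namespace InnerSol

/-! ### Admissible half lines -/

theorem ray_mem_infSector {d θ ξ r : ℝ} (h : exp (ξ * I) ∈ infSector d θ) (hr : 0 < r) :
    (r : ℂ) * exp (ξ * I) ∈ infSector d θ := by
  obtain ⟨s, φ, hs, hφ, he⟩ := h
  refine ⟨r * s, φ, by positivity, hφ, ?_⟩
  rw [he]; push_cast; ring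

theorem exp_ofReal_mul_I_eq {x y : ℝ} (h : exp (x * I) = exp (y * I)) :
    ∃ n : ℤ, x = y + n * (2 * Real.pi) := by
  obtain ⟨n, hn⟩ := exp_eq_exp_iff_exists_int.1 h
  refine ⟨n, ?_⟩
  have := congrArg im hn
  simpa using this

theorem exp_add_int_mul_two_pi (x : ℝ) (n : ℤ) :
    exp ((x + n * (2 * Real.pi) : ℝ) * I) = exp (x * I) :=
  exp_eq_exp_iff_exists_int.2 ⟨n, by push_cast; ring⟩

theorem exists_shift_of_mem_infSector {d θ ξ : ℝ} (h : exp (ξ * I) ∈ infSector d θ) :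
    ∃ n : ℤ, |ξ + n * (2 * Real.pi) - d| < θ / 2 := by
  obtain ⟨s, φ, hs, hφ, he⟩ := h
  have hs1 : s = 1 := by
    have := congrArg norm he
    rw [norm_ray hs.le, norm_exp_ofReal_mul_I] at this
    exact this.symm
  rw [hs1, ofReal_one, one_mul] at he
  obtain ⟨n, hn⟩ := exp_ofReal_mul_I_eq he
  refine ⟨-n, ?_⟩
  rw [hn]
  push_cast
  rwa [neg_mul, add_neg_cancel_right]

theorem exists_shift_of_eq_norm_mul_exp {T : ℂ} (hT : T ≠ 0) {a a' : ℝ}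
    (ha : T = ‖T‖ * exp (a * I)) (ha' : T = ‖T‖ * exp (a' * I)) :
    ∃ n : ℤ, a' = a + n * (2 * Real.pi) := by
  refine exp_ofReal_mul_I_eq ?_
  have h : (‖T‖ : ℂ) ≠ 0 := ofReal_ne_zero.2 (norm_ne_zero_iff.2 hT)
  exact mul_left_cancel₀ h (ha'.symm.trans ha)

theorem laplaceRay_add_int_mul_two_pi (k₁ k₂ : ℕ) (g : ℂ → ℂ) (γ : ℝ) (n : ℤ) (T₁ T₂ : ℂ) :
    laplaceRay k₁ k₂ g (γ + n * (2 * Real.pi)) T₁ T₂ = laplaceRay k₁ k₂ g γ T₁ T₂ := by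
  simp only [laplaceRay, rayIntegrand, exp_add_int_mul_two_pi]

/-- The half line of direction `ξ` lies in the cone `S` and the kernel `exp(-(u/T)^k)` decays
along it. -/
def IsRay (k : ℕ) (S : Set ℂ) (T : ℂ) (ξ : ℝ) : Prop :=
  exp (ξ * I) ∈ S ∧ T ≠ 0 ∧ ∃ a : ℝ, T = ‖T‖ * exp (a * I) ∧ |k * (ξ - a)| < Real.pi / 2

theorem IsRay.re_pos {k : ℕ} {S : Set ℂ} {T : ℂ} {ξ : ℝ} (h : IsRay k S T ξ) :
    0 < ((exp (ξ * I) / T) ^ k).re := by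
  obtain ⟨-, hT, a, ha, hξ⟩ := h
  have := ray_div_pow_re ha 1 ξ k
  rw [ofReal_one, one_mul] at this
  rw [this]
  have hT' : 0 < ‖T‖ := norm_pos_iff.2 hT
  have := Real.cos_pos_of_mem_Ioo (abs_lt.1 hξ)
  positivity

/-- The determination of the argument is continued from `T₀` through `arg (T / T₀)`, which is
continuous near the value `1`; the branch cut of `arg` is thus avoided. -/
theorem IsRay.eventually {k : ℕ} {S : Set ℂ} {T₀ : ℂ} {ξ : ℝ} (h : IsRay k S T₀ ξ) :
    ∀ᶠ T in 𝓝 T₀, IsRay k S T ξ := by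
  obtain ⟨hS, hT₀, a, ha, hξ⟩ := h
  have hc : ContinuousAt (fun T : ℂ => |k * (ξ - (a + arg (T / T₀)))|) T₀ := by
    have h1 : ContinuousAt (fun T : ℂ => arg (T / T₀)) T₀ := by
      refine ContinuousAt.comp (g := arg) (f := fun T : ℂ => T / T₀) ?_ (by fun_prop)
      rw [div_self hT₀]
      exact continuousAt_arg (by simp [slitPlane])
    exact (continuousAt_const.mul (continuousAt_const.sub (continuousAt_const.add h1))).abs
  have hlt : ∀ᶠ T in 𝓝 T₀, |k * (ξ - (a + arg (T / T₀)))| < Real.pi / 2 := by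
    refine hc.eventually_lt_const ?_
    simpa [div_self hT₀] using hξ
  filter_upwards [hlt, isOpen_ne.mem_nhds hT₀] with T hT hT0
  refine ⟨hS, hT0, a + arg (T / T₀), ?_, hT⟩
  have e1 := norm_mul_exp_arg_mul_I (T / T₀)
  have hn : (‖T₀‖ : ℂ) ≠ 0 := ofReal_ne_zero.2 (norm_ne_zero_iff.2 hT₀)
  rw [norm_div, ofReal_div] at e1
  push_cast
  rw [add_mul, exp_add]
  calc T = T / T₀ * T₀ := by field_simp
    _ = ((‖T‖ : ℂ) / ‖T₀‖ * exp (arg (T / T₀) * I)) * (‖T₀‖ * exp (a * I)) := by rw [e1, ← ha]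
    _ = _ := by field_simp

/-- Two half lines in a sector of opening at most `2π - π/k`, both admissible for `T`, bound a
subsector, after a shift by a multiple of `2π`. -/
theorem IsRay.exists_shift {k : ℕ} (hk : 0 < k) {d θ : ℝ} (hθ : θ ≤ 2 * Real.pi - Real.pi / k) {T : ℂ}
    {ξ ξ' : ℝ} (h : IsRay k (infSector d θ) T ξ) (h' : IsRay k (infSector d θ) T ξ') :
    ∃ (n : ℤ) (a : ℝ), T = ‖T‖ * exp (a * I) ∧ |k * (ξ - a)| < Real.pi / 2 ∧
      |k * (ξ' + n * (2 * Real.pi) - a)| < Real.pi / 2 ∧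
      ∀ φ ∈ uIcc ξ (ξ' + n * (2 * Real.pi)), exp (φ * I) ∈ infSector d θ := by
  obtain ⟨hS, hT, a, ha, hξ⟩ := h
  obtain ⟨hS', -, a', ha', hξ'⟩ := h'
  obtain ⟨n, hn⟩ := exists_shift_of_eq_norm_mul_exp hT ha' ha
  have hπ := Real.pi_pos
  have hk0 : (0 : ℝ) < k := Nat.cast_pos.2 hk
  have e1 : k * (ξ' + n * (2 * Real.pi) - a) = k * (ξ' - a') := by rw [hn]; ring
  refine ⟨n, a, ha, hξ, by rw [e1]; exact hξ', ?_⟩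
  set ζ := ξ' + n * (2 * Real.pi) with hζ
  have hζS : exp (ζ * I) ∈ infSector d θ := by rw [hζ, exp_add_int_mul_two_pi]; exact hS'
  have hdist : |ξ - ζ| < Real.pi / k := by
    rw [← e1] at hξ'
    rw [lt_div_iff₀ hk0]
    rw [abs_lt] at hξ hξ'
    have h3 : |k * (ξ - ζ)| < Real.pi := by
      rw [abs_lt]; constructor <;> nlinarith
    rw [abs_mul, abs_of_pos hk0] at h3
    linarith
  obtain ⟨p, hp⟩ := exists_shift_of_mem_infSector hS
  obtain ⟨p', hp'⟩ := exists_shift_of_mem_infSector hζS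
  -- The representatives of `ξ` and `ζ` near `d` lie within `θ/2` of it, and `|ξ - ζ| < π/k`. If the
  -- shifts differed, `2π` would be less than `θ + π/k`, contrary to the bound on the opening.
  have hpp : p = p' := by
    have h4 : |((p - p' : ℤ) : ℝ) * (2 * Real.pi)| < 2 * Real.pi := by
      have : ((p - p' : ℤ) : ℝ) * (2 * Real.pi) = (ξ + p * (2 * Real.pi) - d)
          - (ζ + p' * (2 * Real.pi) - d) - (ξ - ζ) := by push_cast; ring
      rw [this]
      rw [abs_lt] at hp hp' hdist ⊢
      constructor <;> linarith
    rw [abs_mul, abs_of_pos (by positivity : 0 < 2 * Real.pi)] at h4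
    have h5 : |((p - p' : ℤ) : ℝ)| < 1 := by
      by_contra hcon
      push Not at hcon
      nlinarith
    have h6 : |p - p'| < 1 := by exact_mod_cast h5
    have := Int.abs_lt_one_iff.1 h6
    omega
  intro φ hφ
  refine ⟨1, φ + p * (2 * Real.pi), one_pos, ?_, ?_⟩
  · rw [← hpp] at hp'
    rw [abs_lt] at hp hp' ⊢
    rcases mem_uIcc.1 hφ with ⟨h7, h8⟩ | ⟨h7, h8⟩ <;> constructor <;> linarith
  · rw [exp_add_int_mul_two_pi, ofReal_one, one_mul]

/-- This allows an arbitrary, possibly discontinuous, choice of directions: the value of the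
integral does not depend on the choice inside one sector. -/
theorem laplaceRay_eq_of_isRay {k₁ k₂ : ℕ} {k' β : ℝ} (h1 : 1 ≤ k₁) (h12 : k₁ < k₂)
    (hk' : 0 < k') (hk'2 : k' < k₂) (hβ : 0 < β) {d θ : ℝ} (hθ : θ ≤ 2 * Real.pi - Real.pi / k₂)
    {G : ℂ → ℝ → ℂ} (hG : Moderate k' β (infSector d θ) G) {T₁ T₂ : ℂ} {ξ ξ' : ℝ}
    (h : IsRay k₂ (infSector d θ) T₂ ξ) (h' : IsRay k₂ (infSector d θ) T₂ ξ') (m : ℝ) :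
    laplaceRay k₁ k₂ (fun τ => G τ m) ξ T₁ T₂ = laplaceRay k₁ k₂ (fun τ => G τ m) ξ' T₁ T₂ := by
  obtain ⟨n, a, ha, hξ, hξ', hmem⟩ := h.exists_shift (by omega) hθ h'
  obtain ⟨K, ν, hK, hb⟩ := hG.bound 0 hβ
  rw [← laplaceRay_add_int_mul_two_pi k₁ k₂ _ ξ' n]
  refine laplaceRay_eq_laplaceRay (K := K) (ν := ν) h1 h12 hk' hk'2 h.2.1 ha hξ hξ'
    (fun r hr φ hφ => ?_) fun r hr φ hφ => ?_
  · have := ray_mem_infSector (hmem φ hφ) hr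
    exact (hG.holo m _ this).differentiableAt ((isOpen_infSector d θ).mem_nhds this)
  · have := hb _ (ray_mem_infSector (hmem φ hφ) hr) m
    rw [norm_ray hr.le] at this
    simpa using this

/-! ### The Laplace–Fourier transform -/

/-- The inverse Fourier transform of the Laplace-like transform along the direction `ξ`. -/
def transform (k₁ k₂ : ℕ) (G : ℂ → ℝ → ℂ) (ξ : ℝ) (T₁ T₂ z : ℂ) : ℂ :=
  invFourier (fun m => laplaceRay k₁ k₂ (fun τ => G τ m) ξ T₁ T₂) z

/-- The restriction of `G(τ, m) dτ/τ` to a half line. -/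
def rayDensity (G : ℂ → ℝ → ℂ) (ξ : ℝ) (x : ℝ × ℝ) : ℂ := G (x.2 * exp (ξ * I)) x.1 / x.2

/-- The arguments of the exponential integral that represents the transform. -/
def rayCoords (k₁ k₂ : ℕ) (ξ : ℝ) (T₁ T₂ z : ℂ) : ℂ × ℂ × ℂ :=
  ((exp (ξ * I) / T₁) ^ k₁, (exp (ξ * I) / T₂) ^ k₂, z)

section Transform

variable {k₁ k₂ : ℕ} {k' β d θ ξ : ℝ} {G G' : ℂ → ℝ → ℂ} {T₁ T₂ z : ℂ}

theorem rayDensity_of_moderate (hG : Moderate k' β (infSector d θ) G)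
    (hξ : exp (ξ * I) ∈ infSector d θ) : RayDensity k' β (rayDensity G ξ) := by
  refine ⟨?_, fun b hb => ?_⟩
  · refine ContinuousOn.aestronglyMeasurable ?_ (MeasurableSet.univ.prod measurableSet_Ioi)
    refine ContinuousOn.div ?_ (by fun_prop) fun x hx => ofReal_ne_zero.2 (ne_of_gt hx.2)
    exact hG.cont.comp (f := fun x : ℝ × ℝ => ((x.2 : ℂ) * exp (ξ * I), x.1))
      (by fun_prop) fun x hx => ⟨ray_mem_infSector hξ hx.2, mem_univ _⟩
  · obtain ⟨K, ν, hK, h⟩ := hG.bound b hb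
    refine ⟨K, ν, hK, fun m r hr => ?_⟩
    have := h _ (ray_mem_infSector hξ hr) m
    rw [norm_ray hr.le] at this
    rw [rayDensity, norm_div, norm_real, Real.norm_of_nonneg hr.le, div_le_iff₀ hr]
    linarith

theorem rayDensity_mul_exp_phase (m r : ℝ) :
    rayDensity G ξ (m, r) * exp (phase k₁ k₂ (m, r) (rayCoords k₁ k₂ ξ T₁ T₂ z))
      = rayIntegrand k₁ k₂ (fun τ => G τ m) ξ T₁ T₂ r * exp (I * z * m) := by
  simp only [rayDensity, rayIntegrand, kernel, rayCoords, phase_apply]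
  have e : -(r : ℂ) ^ k₁ * (exp (ξ * I) / T₁) ^ k₁ + -(r : ℂ) ^ k₂ * (exp (ξ * I) / T₂) ^ k₂
      + I * m * z = (-(r * exp (ξ * I) / T₁) ^ k₁ - (r * exp (ξ * I) / T₂) ^ k₂) + I * z * m := by
    rw [mul_div_assoc, mul_div_assoc, mul_pow, mul_pow]; ring
  rw [e, exp_add]
  ring

theorem integrable_rayDensity_mul_exp (h1 : 1 ≤ k₁) (h12 : k₁ < k₂) (hk' : 0 < k') (hk'2 : k' < k₂)
    (hG : Moderate k' β (infSector d θ) G) (hr : IsRay k₂ (infSector d θ) T₂ ξ)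
    (hz : |z.im| < β) :
    Integrable (fun x : ℝ × ℝ => rayIntegrand k₁ k₂ (fun τ => G τ x.1) ξ T₁ T₂ x.2
      * exp (I * z * x.1)) ((volume : Measure ℝ).prod (volume.restrict (Ioi (0 : ℝ)))) := by
  have := integrable_expIntegrand (v₀ := rayCoords k₁ k₂ ξ T₁ T₂ z) h1 h12 hk' hk'2
    (rayDensity_of_moderate hG hr.1) hr.re_pos hz
  rw [rayMeasure_eq_prod] at this
  exact this.congr (ae_of_all _ fun x => rayDensity_mul_exp_phase x.1 x.2)

theorem integrable_laplaceRay_mul_exp (h1 : 1 ≤ k₁) (h12 : k₁ < k₂) (hk' : 0 < k') (hk'2 : k' < k₂)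
    (hG : Moderate k' β (infSector d θ) G) (hr : IsRay k₂ (infSector d θ) T₂ ξ)
    (hz : |z.im| < β) :
    Integrable fun m : ℝ => laplaceRay k₁ k₂ (fun τ => G τ m) ξ T₁ T₂ * exp (I * z * m) := by
  have := (integrable_rayDensity_mul_exp (T₁ := T₁) h1 h12 hk' hk'2 hG hr hz).integral_prod_left
  refine this.congr (ae_of_all _ fun m => ?_)
  simp only [laplaceRay, integral_mul_const]

/-- Fubini, once the integrand is written in homogeneous form: `(r e^{iξ}/T)^k = r^k (e^{iξ}/T)^k`.
-/
theorem transform_eq_expIntegral (h1 : 1 ≤ k₁) (h12 : k₁ < k₂) (hk' : 0 < k') (hk'2 : k' < k₂)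
    (hG : Moderate k' β (infSector d θ) G) (hr : IsRay k₂ (infSector d θ) T₂ ξ)
    (hz : |z.im| < β) :
    transform k₁ k₂ G ξ T₁ T₂ z = ((Real.sqrt (2 * Real.pi) : ℝ) : ℂ)⁻¹
      * expIntegral k₁ k₂ (rayDensity G ξ) (rayCoords k₁ k₂ ξ T₁ T₂ z) := by
  rw [transform, invFourier, expIntegral, rayMeasure_eq_prod]
  congr 1
  have := integral_prod _ (integrable_rayDensity_mul_exp (T₁ := T₁) h1 h12 hk' hk'2 hG hr hz)
  simp only [integral_mul_const] at this
  rw [show (∫ m : ℝ, laplaceRay k₁ k₂ (fun τ => G τ m) ξ T₁ T₂ * exp (I * z * m))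
    = _ from this.symm]
  exact integral_congr_ae (ae_of_all _ fun x => (rayDensity_mul_exp_phase x.1 x.2).symm)

theorem transform_add (h1 : 1 ≤ k₁) (h12 : k₁ < k₂) (hk' : 0 < k') (hk'2 : k' < k₂)
    (hG : Moderate k' β (infSector d θ) G) (hr : IsRay k₂ (infSector d θ) T₂ ξ)
    (hz : |z.im| < β)
    (hG' : Moderate k' β (infSector d θ) G') :
    transform k₁ k₂ (fun τ m => G τ m + G' τ m) ξ T₁ T₂ z
      = transform k₁ k₂ G ξ T₁ T₂ z + transform k₁ k₂ G' ξ T₁ T₂ z := by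
  rw [transform_eq_expIntegral h1 h12 hk' hk'2 hG hr hz,
    transform_eq_expIntegral h1 h12 hk' hk'2 hG' hr hz,
    transform_eq_expIntegral h1 h12 hk' hk'2 (hG.add hG') hr hz, ← mul_add]
  congr 1
  rw [expIntegral, expIntegral, expIntegral, ← integral_add
    (integrable_expIntegrand h1 h12 hk' hk'2 (rayDensity_of_moderate hG hr.1) hr.re_pos hz)
    (integrable_expIntegrand h1 h12 hk' hk'2 (rayDensity_of_moderate hG' hr.1) hr.re_pos hz)]
  refine integral_congr_ae (ae_of_all _ fun x => ?_)
  simp only [rayDensity]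
  ring

theorem laplaceRay_congr {g g' : ℂ → ℂ} (hξ : exp (ξ * I) ∈ infSector d θ)
    (h : ∀ τ ∈ infSector d θ, g τ = g' τ) :
    laplaceRay k₁ k₂ g ξ T₁ T₂ = laplaceRay k₁ k₂ g' ξ T₁ T₂ := by
  refine setIntegral_congr_fun measurableSet_Ioi fun r hr => ?_
  simp only [rayIntegrand, h _ (ray_mem_infSector hξ hr)]

theorem transform_congr (hξ : exp (ξ * I) ∈ infSector d θ)
    (h : ∀ τ ∈ infSector d θ, ∀ m, G τ m = G' τ m) :
    transform k₁ k₂ G ξ T₁ T₂ z = transform k₁ k₂ G' ξ T₁ T₂ z := by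
  unfold transform
  congr 1
  funext m
  exact laplaceRay_congr hξ fun τ hτ => h τ hτ m

theorem transform_const_mul (c : ℂ) :
    transform k₁ k₂ (fun τ m => c * G τ m) ξ T₁ T₂ z = c * transform k₁ k₂ G ξ T₁ T₂ z := by
  have e : ∀ m, laplaceRay k₁ k₂ (fun τ => c * G τ m) ξ T₁ T₂
      = c * laplaceRay k₁ k₂ (fun τ => G τ m) ξ T₁ T₂ := by
    intro m
    rw [laplaceRay, laplaceRay, ← integral_const_mul]
    congr 1
    funext r
    simp only [rayIntegrand]
    ring
  simp only [transform, invFourier, e]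
  rw [mul_left_comm]
  congr 1
  rw [← integral_const_mul]
  congr 1
  funext m
  ring

theorem transform_zero : transform k₁ k₂ (fun _ _ => 0) ξ T₁ T₂ z = 0 := by
  simp [transform, invFourier, laplaceRay, rayIntegrand]

theorem transform_sum (h1 : 1 ≤ k₁) (h12 : k₁ < k₂) (hk' : 0 < k') (hk'2 : k' < k₂)
    (hr : IsRay k₂ (infSector d θ) T₂ ξ)
    (hz : |z.im| < β)
    {ι : Type*} (s : Finset ι) {F : ι → ℂ → ℝ → ℂ}
    (hF : ∀ i ∈ s, Moderate k' β (infSector d θ) (F i)) :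
    transform k₁ k₂ (fun τ m => ∑ i ∈ s, F i τ m) ξ T₁ T₂ z
      = ∑ i ∈ s, transform k₁ k₂ (F i) ξ T₁ T₂ z := by
  classical
  induction s using Finset.induction_on with
  | empty => simpa using transform_zero
  | insert i s hi ih =>
    simp only [Finset.sum_insert hi]
    have hs : ∀ j ∈ s, Moderate k' β (infSector d θ) (F j) := fun j hj => hF j (by simp [hj])
    rw [transform_add h1 h12 hk' hk'2 (hF i (by simp)) hr hz (Moderate.sum s hs), ih hs]

end Transform

end InnerSol

end

/-! ### The differential operators and coefficients under the transform -/

noncomputable section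

namespace InnerSol

theorem isOpen_strip (β : ℝ) : IsOpen (strip β) :=
  isOpen_lt (continuous_im.abs) continuous_const

theorem hasDerivAt_div_mul_pow (c : ℂ) (k : ℕ) {e t : ℂ} (he : e ≠ 0) (ht : t ≠ 0) :
    HasDerivAt (fun x => (c / (e * x)) ^ k) (-(k * (c / (e * t)) ^ k / t)) t := by
  have h1 : HasDerivAt (fun x => c / (e * x)) (-(c / (e * t) / t)) t := by
    refine ((hasDerivAt_const t c).fun_div ((hasDerivAt_id' t).const_mul e)
      (mul_ne_zero he ht)).congr_deriv ?_
    field_simp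
    ring
  refine (h1.fun_pow k).congr_deriv ?_
  rcases k with _ | j
  · simp
  · rw [Nat.add_sub_cancel, pow_succ (c / (e * t)) j]
    ring

/-- The hypotheses under which a field `ξ` of directions of integration, on `A₁ × A₂`, defines a
holomorphic function by Laplace and Fourier transform. -/
structure IsRayField (k₁ k₂ : ℕ) (k' β d θ : ℝ) (l₂ : ℕ) (ε : ℂ) (A₁ A₂ : Set ℂ)
    (ξ : ℂ → ℂ → ℝ) : Prop where
  one_le_k₁ : 1 ≤ k₁
  k₁_lt_k₂ : k₁ < k₂
  k'_pos : 0 < k'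
  k'_lt_k₂ : k' < k₂
  β_pos : 0 < β
  opening_le : θ ≤ 2 * Real.pi - Real.pi / k₂
  isOpen_fst : IsOpen A₁
  isOpen_snd : IsOpen A₂
  fst_ne_zero : ∀ t ∈ A₁, t ≠ 0
  ε_ne_zero : ε ≠ 0
  isRay : ∀ t₁ ∈ A₁, ∀ t₂ ∈ A₂, IsRay k₂ (infSector d θ) (ε ^ l₂ * t₂) (ξ t₁ t₂)

/-- The transform along a field of directions, in the rescaled times `ε^{l₁} t₁`, `ε^{l₂} t₂`. -/
def fieldTransform (k₁ k₂ l₁ l₂ : ℕ) (ε : ℂ) (ξ : ℂ → ℂ → ℝ) (G : ℂ → ℝ → ℂ) (t₁ t₂ z : ℂ) : ℂ :=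
  transform k₁ k₂ G (ξ t₁ t₂) (ε ^ l₁ * t₁) (ε ^ l₂ * t₂) z

namespace IsRayField

variable {k₁ k₂ l₁ l₂ : ℕ} {k' β d θ : ℝ} {ε : ℂ} {A₁ A₂ : Set ℂ} {ξ : ℂ → ℂ → ℝ}
  {G G' : ℂ → ℝ → ℂ} {t₁ t₂ z : ℂ}

theorem snd_ne_zero (h : IsRayField k₁ k₂ k' β d θ l₂ ε A₁ A₂ ξ) (ht₁ : t₁ ∈ A₁) (ht₂ : t₂ ∈ A₂) :
    t₂ ≠ 0 := right_ne_zero_of_mul (h.isRay t₁ ht₁ t₂ ht₂).2.1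

theorem eq_expIntegral (h : IsRayField k₁ k₂ k' β d θ l₂ ε A₁ A₂ ξ)
    (hG : Moderate k' β (infSector d θ) G) (ht₁ : t₁ ∈ A₁) (ht₂ : t₂ ∈ A₂) (hz : z ∈ strip β) :
    fieldTransform k₁ k₂ l₁ l₂ ε ξ G t₁ t₂ z = ((Real.sqrt (2 * Real.pi) : ℝ) : ℂ)⁻¹
      * expIntegral k₁ k₂ (rayDensity G (ξ t₁ t₂))
        (rayCoords k₁ k₂ (ξ t₁ t₂) (ε ^ l₁ * t₁) (ε ^ l₂ * t₂) z) :=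
  transform_eq_expIntegral h.one_le_k₁ h.k₁_lt_k₂ h.k'_pos h.k'_lt_k₂ hG (h.isRay t₁ ht₁ t₂ ht₂) hz

/-- Locally, the direction of integration may be frozen. -/
theorem eventually_eq_expIntegral (h : IsRayField k₁ k₂ k' β d θ l₂ ε A₁ A₂ ξ)
    (hG : Moderate k' β (infSector d θ) G) (ht₁ : t₁ ∈ A₁) (ht₂ : t₂ ∈ A₂) (hz : z ∈ strip β) :
    ∀ᶠ p : ℂ × ℂ × ℂ in 𝓝 (t₁, t₂, z), fieldTransform k₁ k₂ l₁ l₂ ε ξ G p.1 p.2.1 p.2.2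
      = ((Real.sqrt (2 * Real.pi) : ℝ) : ℂ)⁻¹ * expIntegral k₁ k₂ (rayDensity G (ξ t₁ t₂))
        (rayCoords k₁ k₂ (ξ t₁ t₂) (ε ^ l₁ * p.1) (ε ^ l₂ * p.2.1) p.2.2) := by
  -- Admissibility of the direction chosen at `(t₁, t₂)` is an open condition on `T₂`, so it may
  -- replace the direction chosen at each neighbouring point.
  have hray : ∀ᶠ p : ℂ × ℂ × ℂ in 𝓝 (t₁, t₂, z),
      IsRay k₂ (infSector d θ) (ε ^ l₂ * p.2.1) (ξ t₁ t₂) := by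
    have hc : Tendsto (fun p : ℂ × ℂ × ℂ => ε ^ l₂ * p.2.1) (𝓝 (t₁, t₂, z)) (𝓝 (ε ^ l₂ * t₂)) :=
      Continuous.tendsto (by fun_prop) (t₁, t₂, z)
    exact hc.eventually (h.isRay t₁ ht₁ t₂ ht₂).eventually
  have hmem : A₁ ×ˢ A₂ ×ˢ strip β ∈ 𝓝 (t₁, t₂, z) :=
    (h.isOpen_fst.prod (h.isOpen_snd.prod (isOpen_strip β))).mem_nhds ⟨ht₁, ht₂, hz⟩
  filter_upwards [hray, hmem] with p hp hpm
  rw [← transform_eq_expIntegral h.one_le_k₁ h.k₁_lt_k₂ h.k'_pos h.k'_lt_k₂ hG hp hpm.2.2,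
    fieldTransform, transform, transform]
  congr 1
  funext m
  exact laplaceRay_eq_of_isRay h.one_le_k₁ h.k₁_lt_k₂ h.k'_pos h.k'_lt_k₂ h.β_pos h.opening_le hG
    (h.isRay p.1 hpm.1 p.2.1 hpm.2.1) hp m

theorem differentiableAt (h : IsRayField k₁ k₂ k' β d θ l₂ ε A₁ A₂ ξ)
    (hG : Moderate k' β (infSector d θ) G) (ht₁ : t₁ ∈ A₁) (ht₂ : t₂ ∈ A₂) (hz : z ∈ strip β) :
    DifferentiableAt ℂ
      (fun p : ℂ × ℂ × ℂ => fieldTransform k₁ k₂ l₁ l₂ ε ξ G p.1 p.2.1 p.2.2) (t₁, t₂, z) := by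
  refine DifferentiableAt.congr_of_eventuallyEq ?_ (h.eventually_eq_expIntegral hG ht₁ ht₂ hz)
  have hr := h.isRay t₁ ht₁ t₂ ht₂
  obtain ⟨L, hL, -⟩ := hasFDerivAt_expIntegral (k₁ := k₁) (k₂ := k₂)
    (v₀ := rayCoords k₁ k₂ (ξ t₁ t₂) (ε ^ l₁ * t₁) (ε ^ l₂ * t₂) z) h.one_le_k₁ h.k₁_lt_k₂ h.k'_pos
    h.k'_lt_k₂ (rayDensity_of_moderate hG hr.1) hr.re_pos hz
  refine DifferentiableAt.const_mul ?_ _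
  refine DifferentiableAt.comp (g := expIntegral k₁ k₂ (rayDensity G (ξ t₁ t₂)))
    (f := fun p : ℂ × ℂ × ℂ => rayCoords k₁ k₂ (ξ t₁ t₂) (ε ^ l₁ * p.1) (ε ^ l₂ * p.2.1) p.2.2)
    (t₁, t₂, z) hL.differentiableAt ?_
  have e1 : ε ^ l₁ * t₁ ≠ 0 := mul_ne_zero (pow_ne_zero _ h.ε_ne_zero) (h.fst_ne_zero t₁ ht₁)
  have e2 : ε ^ l₂ * t₂ ≠ 0 := hr.2.1
  unfold rayCoords
  fun_prop (disch := assumption)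

/-- The derivative along a curve on which the frozen coordinates are differentiable. -/
theorem hasDerivAt_comp (h : IsRayField k₁ k₂ k' β d θ l₂ ε A₁ A₂ ξ)
    (hG : Moderate k' β (infSector d θ) G) (ht₁ : t₁ ∈ A₁) (ht₂ : t₂ ∈ A₂) (hz : z ∈ strip β)
    {γ : ℂ → ℂ × ℂ × ℂ} {s : ℂ} (hγ : ContinuousAt γ s) (hγs : γ s = (t₁, t₂, z))
    {v' : ℂ × ℂ × ℂ} (hv : HasDerivAt (fun x => rayCoords k₁ k₂ (ξ t₁ t₂) (ε ^ l₁ * (γ x).1)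
      (ε ^ l₂ * (γ x).2.1) (γ x).2.2) v' s) :
    HasDerivAt (fun x => fieldTransform k₁ k₂ l₁ l₂ ε ξ G (γ x).1 (γ x).2.1 (γ x).2.2)
      (((Real.sqrt (2 * Real.pi) : ℝ) : ℂ)⁻¹ * expIntegral k₁ k₂
        (fun x => phase k₁ k₂ x v' * rayDensity G (ξ t₁ t₂) x)
        (rayCoords k₁ k₂ (ξ t₁ t₂) (ε ^ l₁ * t₁) (ε ^ l₂ * t₂) z)) s := by
  have hr := h.isRay t₁ ht₁ t₂ ht₂
  obtain ⟨L, hL, hLe⟩ := hasFDerivAt_expIntegral (k₁ := k₁) (k₂ := k₂)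
    (v₀ := rayCoords k₁ k₂ (ξ t₁ t₂) (ε ^ l₁ * t₁) (ε ^ l₂ * t₂) z) h.one_le_k₁ h.k₁_lt_k₂ h.k'_pos
    h.k'_lt_k₂ (rayDensity_of_moderate hG hr.1) hr.re_pos hz
  rw [← hLe]
  have hev : ∀ᶠ x in 𝓝 s, fieldTransform k₁ k₂ l₁ l₂ ε ξ G (γ x).1 (γ x).2.1 (γ x).2.2
      = ((Real.sqrt (2 * Real.pi) : ℝ) : ℂ)⁻¹ * expIntegral k₁ k₂ (rayDensity G (ξ t₁ t₂))
        (rayCoords k₁ k₂ (ξ t₁ t₂) (ε ^ l₁ * (γ x).1) (ε ^ l₂ * (γ x).2.1) (γ x).2.2) := by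
    have h2 := h.eventually_eq_expIntegral (l₁ := l₁) hG ht₁ ht₂ hz
    rw [← hγs] at h2
    exact hγ.eventually h2
  refine HasDerivAt.congr_of_eventuallyEq ?_ hev
  refine HasDerivAt.const_mul _ ?_
  refine HasFDerivAt.comp_hasDerivAt (l := expIntegral k₁ k₂ (rayDensity G (ξ t₁ t₂))) s ?_ hv
  rw [hγs]
  exact hL

/-- The coordinate `A = (e^{iξ}/(ε^{l₁} t₁))^{k₁}` satisfies `t₁^{k₁+1} ∂_{t₁} A = -k₁ t₁^{k₁} A =
-k₁ e^{iξk₁}/ε^{l₁k₁}`. Differentiating `exp(-A r^{k₁})` therefore brings down `k₁ τ^{k₁}/ε^{l₁k₁}`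
with `τ = r e^{iξ}`. -/
theorem opT1_eq (h : IsRayField k₁ k₂ k' β d θ l₂ ε A₁ A₂ ξ)
    (hG : Moderate k' β (infSector d θ) G) (ht₁ : t₁ ∈ A₁) (ht₂ : t₂ ∈ A₂) (hz : z ∈ strip β) :
    opT1 k₁ (fieldTransform k₁ k₂ l₁ l₂ ε ξ G) t₁ t₂ z = fieldTransform k₁ k₂ l₁ l₂ ε ξ
      (fun τ m => (k₁ / ε ^ (l₁ * k₁)) * τ ^ k₁ * G τ m) t₁ t₂ z := by
  have hε := h.ε_ne_zero
  have ht0 := h.fst_ne_zero t₁ ht₁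
  have hd : HasDerivAt (fun x : ℂ => rayCoords k₁ k₂ (ξ t₁ t₂) (ε ^ l₁ * x) (ε ^ l₂ * t₂) z)
      (-(k₁ * (exp (ξ t₁ t₂ * I) / (ε ^ l₁ * t₁)) ^ k₁ / t₁), 0, 0) t₁ := by
    refine HasDerivAt.prodMk ?_ (hasDerivAt_const _ _)
    exact hasDerivAt_div_mul_pow _ k₁ (pow_ne_zero _ hε) ht0
  have hder := h.hasDerivAt_comp (l₁ := l₁) hG ht₁ ht₂ hz (γ := fun x => (x, t₂, z)) (s := t₁)
    (by fun_prop) rfl hd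
  rw [opT1, hder.deriv, h.eq_expIntegral (hG.const_mul_pow h.k'_pos _ _) ht₁ ht₂ hz, mul_left_comm]
  congr 1
  rw [expIntegral, expIntegral, ← integral_const_mul]
  congr 1
  funext x
  simp only [phase_apply, rayDensity, mul_zero, add_zero, mul_pow, div_pow]
  field_simp
  ring

theorem opT2_eq (h : IsRayField k₁ k₂ k' β d θ l₂ ε A₁ A₂ ξ)
    (hG : Moderate k' β (infSector d θ) G) (ht₁ : t₁ ∈ A₁) (ht₂ : t₂ ∈ A₂) (hz : z ∈ strip β) :
    opT2 k₂ (fieldTransform k₁ k₂ l₁ l₂ ε ξ G) t₁ t₂ z = fieldTransform k₁ k₂ l₁ l₂ ε ξ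
      (fun τ m => (k₂ / ε ^ (l₂ * k₂)) * τ ^ k₂ * G τ m) t₁ t₂ z := by
  have hε := h.ε_ne_zero
  have ht0 := h.snd_ne_zero ht₁ ht₂
  have hd : HasDerivAt (fun x : ℂ => rayCoords k₁ k₂ (ξ t₁ t₂) (ε ^ l₁ * t₁) (ε ^ l₂ * x) z)
      (0, -(k₂ * (exp (ξ t₁ t₂ * I) / (ε ^ l₂ * t₂)) ^ k₂ / t₂), 0) t₂ := by
    refine HasDerivAt.prodMk (hasDerivAt_const _ _) (HasDerivAt.prodMk ?_ (hasDerivAt_const _ _))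
    exact hasDerivAt_div_mul_pow _ k₂ (pow_ne_zero _ hε) ht0
  have hder := h.hasDerivAt_comp (l₁ := l₁) hG ht₁ ht₂ hz (γ := fun x => (t₁, x, z)) (s := t₂)
    (by fun_prop) rfl hd
  rw [opT2, hder.deriv, h.eq_expIntegral (hG.const_mul_pow h.k'_pos _ _) ht₁ ht₂ hz, mul_left_comm]
  congr 1
  rw [expIntegral, expIntegral, ← integral_const_mul]
  congr 1
  funext x
  simp only [phase_apply, rayDensity, mul_zero, zero_add, add_zero, mul_pow, div_pow]
  field_simp
  ring

theorem hasDerivAt_snd_snd (h : IsRayField k₁ k₂ k' β d θ l₂ ε A₁ A₂ ξ)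
    (hG : Moderate k' β (infSector d θ) G) (ht₁ : t₁ ∈ A₁) (ht₂ : t₂ ∈ A₂) (hz : z ∈ strip β) :
    HasDerivAt (fun w => fieldTransform k₁ k₂ l₁ l₂ ε ξ G t₁ t₂ w)
      (fieldTransform k₁ k₂ l₁ l₂ ε ξ (fun τ m => (I * m) * G τ m) t₁ t₂ z) z := by
  have hd : HasDerivAt (fun x : ℂ => rayCoords k₁ k₂ (ξ t₁ t₂) (ε ^ l₁ * t₁) (ε ^ l₂ * t₂) x)
      (0, 0, 1) z :=
    (hasDerivAt_const _ _).prodMk ((hasDerivAt_const _ _).prodMk (hasDerivAt_id z))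
  have hder := h.hasDerivAt_comp (l₁ := l₁) hG ht₁ ht₂ hz (γ := fun x => (t₁, t₂, x)) (s := z)
    (by fun_prop) rfl hd
  have hmod : Moderate k' β (infSector d θ) fun τ m => (I * m) * G τ m := by
    simpa using hG.eval_mul X
  rw [h.eq_expIntegral hmod ht₁ ht₂ hz]
  convert hder using 2
  rw [expIntegral, expIntegral]
  congr 1
  funext x
  simp only [phase_apply, rayDensity, mul_zero, zero_add, mul_one]
  ring

theorem iteratedDeriv_eq (h : IsRayField k₁ k₂ k' β d θ l₂ ε A₁ A₂ ξ)
    (hG : Moderate k' β (infSector d θ) G) (ht₁ : t₁ ∈ A₁) (ht₂ : t₂ ∈ A₂) (n : ℕ) :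
    ∀ z ∈ strip β, iteratedDeriv n (fun w => fieldTransform k₁ k₂ l₁ l₂ ε ξ G t₁ t₂ w) z
      = fieldTransform k₁ k₂ l₁ l₂ ε ξ (fun τ m => (I * m) ^ n * G τ m) t₁ t₂ z := by
  induction n with
  | zero => intro z _; simp
  | succ n ih =>
    intro z hz
    have hmod : Moderate k' β (infSector d θ) fun τ m => (I * m) ^ n * G τ m := by
      simpa using hG.eval_mul (X ^ n)
    rw [iteratedDeriv_succ]
    have hev : iteratedDeriv n (fun w => fieldTransform k₁ k₂ l₁ l₂ ε ξ G t₁ t₂ w) =ᶠ[𝓝 z]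
        fun w => fieldTransform k₁ k₂ l₁ l₂ ε ξ (fun τ m => (I * m) ^ n * G τ m) t₁ t₂ w := by
      filter_upwards [(isOpen_strip β).mem_nhds hz] with w hw using ih w hw
    rw [hev.deriv_eq, (h.hasDerivAt_snd_snd hmod ht₁ ht₂ hz).deriv]
    congr 1
    funext τ m
    ring

theorem opZ_eq (h : IsRayField k₁ k₂ k' β d θ l₂ ε A₁ A₂ ξ)
    (hG : Moderate k' β (infSector d θ) G) (A : ℂ[X]) (ht₁ : t₁ ∈ A₁) (ht₂ : t₂ ∈ A₂)
    (hz : z ∈ strip β) :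
    opZ A (fieldTransform k₁ k₂ l₁ l₂ ε ξ G) t₁ t₂ z
      = fieldTransform k₁ k₂ l₁ l₂ ε ξ (fun τ m => A.eval (I * (m : ℂ)) * G τ m) t₁ t₂ z := by
  have hterm : ∀ n ∈ A.support,
      Moderate k' β (infSector d θ) fun τ m => A.coeff n * ((I * m) ^ n * G τ m) := by
    intro n _
    have := (hG.eval_mul (X ^ n)).const_mul h.k'_pos (A.coeff n)
    simpa using this
  rw [opZ, Polynomial.sum_def]
  have e : (fun (τ : ℂ) (m : ℝ) => A.eval (I * (m : ℂ)) * G τ m)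
      = fun τ m => ∑ n ∈ A.support, A.coeff n * ((I * m) ^ n * G τ m) := by
    funext τ m
    rw [eval_eq_sum, Polynomial.sum_def, Finset.sum_mul]
    simp only [mul_assoc]
  rw [e, fieldTransform, transform_sum h.one_le_k₁ h.k₁_lt_k₂ h.k'_pos h.k'_lt_k₂
    (h.isRay t₁ ht₁ t₂ ht₂) hz A.support hterm]
  refine Finset.sum_congr rfl fun n _ => ?_
  rw [transform_const_mul, h.iteratedDeriv_eq hG ht₁ ht₂ n z hz, fieldTransform]

/-- The function `f` agrees with a transform on an open set only. That suffices, since each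
derivative depends only on the germ, and the statement carries `Moderate` along so that the next
step applies. -/
theorem iterate_opT1_eq (h : IsRayField k₁ k₂ k' β d θ l₂ ε A₁ A₂ ξ)
    (hG : Moderate k' β (infSector d θ) G) {f : ℂ → ℂ → ℂ → ℂ}
    (hf : ∀ t₁ ∈ A₁, ∀ t₂ ∈ A₂, ∀ z ∈ strip β,
      f t₁ t₂ z = fieldTransform k₁ k₂ l₁ l₂ ε ξ G t₁ t₂ z) (n : ℕ) :
    Moderate k' β (infSector d θ) (fun τ m => ((k₁ / ε ^ (l₁ * k₁)) * τ ^ k₁) ^ n * G τ m) ∧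
    ∀ t₁ ∈ A₁, ∀ t₂ ∈ A₂, ∀ z ∈ strip β, (opT1 k₁)^[n] f t₁ t₂ z
      = fieldTransform k₁ k₂ l₁ l₂ ε ξ
        (fun τ m => ((k₁ / ε ^ (l₁ * k₁)) * τ ^ k₁) ^ n * G τ m) t₁ t₂ z := by
  induction n with
  | zero => simpa using ⟨hG, hf⟩
  | succ n ih =>
    obtain ⟨hmod, ih⟩ := ih
    have e : (fun (τ : ℂ) (m : ℝ) => ((k₁ / ε ^ (l₁ * k₁)) * τ ^ k₁) ^ (n + 1) * G τ m)
        = fun τ m => (k₁ / ε ^ (l₁ * k₁)) * τ ^ k₁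
          * (((k₁ / ε ^ (l₁ * k₁)) * τ ^ k₁) ^ n * G τ m) := by
      funext τ m; ring
    rw [e]
    refine ⟨hmod.const_mul_pow h.k'_pos _ _, fun t₁ ht₁ t₂ ht₂ z hz => ?_⟩
    rw [← h.opT1_eq hmod ht₁ ht₂ hz, Function.iterate_succ_apply', opT1, opT1]
    congr 1
    refine Filter.EventuallyEq.deriv_eq ?_
    filter_upwards [h.isOpen_fst.mem_nhds ht₁] with s hs using ih s hs t₂ ht₂ z hz

theorem iterate_opT2_eq (h : IsRayField k₁ k₂ k' β d θ l₂ ε A₁ A₂ ξ)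
    (hG : Moderate k' β (infSector d θ) G) {f : ℂ → ℂ → ℂ → ℂ}
    (hf : ∀ t₁ ∈ A₁, ∀ t₂ ∈ A₂, ∀ z ∈ strip β,
      f t₁ t₂ z = fieldTransform k₁ k₂ l₁ l₂ ε ξ G t₁ t₂ z) (n : ℕ) :
    Moderate k' β (infSector d θ) (fun τ m => ((k₂ / ε ^ (l₂ * k₂)) * τ ^ k₂) ^ n * G τ m) ∧
    ∀ t₁ ∈ A₁, ∀ t₂ ∈ A₂, ∀ z ∈ strip β, (opT2 k₂)^[n] f t₁ t₂ z
      = fieldTransform k₁ k₂ l₁ l₂ ε ξ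
        (fun τ m => ((k₂ / ε ^ (l₂ * k₂)) * τ ^ k₂) ^ n * G τ m) t₁ t₂ z := by
  induction n with
  | zero => simpa using ⟨hG, hf⟩
  | succ n ih =>
    obtain ⟨hmod, ih⟩ := ih
    have e : (fun (τ : ℂ) (m : ℝ) => ((k₂ / ε ^ (l₂ * k₂)) * τ ^ k₂) ^ (n + 1) * G τ m)
        = fun τ m => (k₂ / ε ^ (l₂ * k₂)) * τ ^ k₂
          * (((k₂ / ε ^ (l₂ * k₂)) * τ ^ k₂) ^ n * G τ m) := by
      funext τ m; ring
    rw [e]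
    refine ⟨hmod.const_mul_pow h.k'_pos _ _, fun t₁ ht₁ t₂ ht₂ z hz => ?_⟩
    rw [← h.opT2_eq hmod ht₁ ht₂ hz, Function.iterate_succ_apply', opT2, opT2]
    congr 1
    refine Filter.EventuallyEq.deriv_eq ?_
    filter_upwards [h.isOpen_snd.mem_nhds ht₂] with s hs using ih t₁ ht₁ s hs z hz

/-- Multiplication by a coefficient of the form `F⁻¹(C)` corresponds to convolution with `C`. -/
theorem invFourier_mul_eq (h : IsRayField k₁ k₂ k' β d θ l₂ ε A₁ A₂ ξ)
    (hG : Moderate k' β (infSector d θ) G) {C : ℝ → ℂ} (hC : Continuous C) {B : ℝ}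
    (hCB : ∀ m, ‖C m‖ ≤ B) (hCz : Integrable fun m : ℝ => C m * exp (I * z * m))
    (ht₁ : t₁ ∈ A₁) (ht₂ : t₂ ∈ A₂) (hz : z ∈ strip β) :
    invFourier C z * fieldTransform k₁ k₂ l₁ l₂ ε ξ G t₁ t₂ z
      = fieldTransform k₁ k₂ l₁ l₂ ε ξ (convol C G) t₁ t₂ z := by
  have hr := h.isRay t₁ ht₁ t₂ ht₂
  simp only [fieldTransform, transform, invFourier]
  generalize ξ t₁ t₂ = ζ at hr ⊢
  generalize ε ^ l₁ * t₁ = T₁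
  generalize ε ^ l₂ * t₂ = T₂ at hr ⊢
  set U : ℝ → ℂ := fun m => laplaceRay k₁ k₂ (fun τ => G τ m) ζ T₁ T₂ with hU
  -- Fubini exchanges the Laplace integral with the convolution in the Fourier variable; boundedness
  -- of `C` is enough.
  have hswap : ∀ m : ℝ, laplaceRay k₁ k₂ (fun τ => convol C G τ m) ζ T₁ T₂
      = ((Real.sqrt (2 * Real.pi) : ℝ) : ℂ)⁻¹ * ∫ m₁, U m₁ * C (m - m₁) := by
    intro m
    have hint := integrable_rayDensity_mul_exp (T₁ := T₁) (z := 0) h.one_le_k₁ h.k₁_lt_k₂ h.k'_pos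
      h.k'_lt_k₂ hG hr (by simpa using h.β_pos)
    simp only [mul_zero, zero_mul, exp_zero, mul_one] at hint
    have hint2 : Integrable (fun x : ℝ × ℝ => C (m - x.1)
        * rayIntegrand k₁ k₂ (fun τ => G τ x.1) ζ T₁ T₂ x.2)
        ((volume : Measure ℝ).prod (volume.restrict (Ioi (0 : ℝ)))) :=
      hint.bdd_mul (c := B) (Continuous.aestronglyMeasurable (by fun_prop))
        (ae_of_all _ fun x => hCB _)
    have hsw := integral_integral_swap (f := fun m₁ r => C (m - m₁)
      * rayIntegrand k₁ k₂ (fun τ => G τ m₁) ζ T₁ T₂ r) hint2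
    have e1 : ∫ m₁, U m₁ * C (m - m₁) = ∫ m₁, ∫ r in Ioi (0 : ℝ), C (m - m₁)
        * rayIntegrand k₁ k₂ (fun τ => G τ m₁) ζ T₁ T₂ r := by
      congr 1
      funext m₁
      rw [integral_const_mul, mul_comm]
      rfl
    rw [e1, hsw, laplaceRay, ← integral_const_mul]
    congr 1
    funext r
    simp only [rayIntegrand, convol]
    rw [mul_assoc, mul_div_assoc]
    congr 1
    rw [mul_div_assoc, ← integral_mul_const]
    congr 1
    funext m₁
    ring
  -- The character `exp(izm)` splits as `exp(izm₁) exp(iz(m - m₁))`, so the integral of the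
  -- convolution of the two twisted functions factorises into the two inverse Fourier transforms.
  have hconv := integral_convolution (μ := (volume : Measure ℝ)) (ν := (volume : Measure ℝ))
    (ContinuousLinearMap.mul ℂ ℂ)
    (integrable_laplaceRay_mul_exp (T₁ := T₁) h.one_le_k₁ h.k₁_lt_k₂ h.k'_pos h.k'_lt_k₂ hG hr hz)
    hCz
  simp only [convolution, ContinuousLinearMap.mul_apply'] at hconv
  simp only [hswap]
  have e2 : ∀ m : ℝ, (∫ m₁ : ℝ, laplaceRay k₁ k₂ (fun τ => G τ m₁) ζ T₁ T₂ * exp (I * z * m₁)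
      * (C (m - m₁) * exp (I * z * ((m - m₁ : ℝ) : ℂ)))) = (∫ m₁, U m₁ * C (m - m₁))
        * exp (I * z * m) := by
    intro m
    rw [← integral_mul_const]
    congr 1
    funext m₁
    have : exp (I * z * m) = exp (I * z * m₁) * exp (I * z * ((m - m₁ : ℝ) : ℂ)) := by
      rw [← exp_add]; congr 1; push_cast; ring
    rw [this]
    ring
  simp only [e2] at hconv
  have e3 : ∫ m : ℝ, (((Real.sqrt (2 * Real.pi) : ℝ) : ℂ)⁻¹ * ∫ m₁, U m₁ * C (m - m₁))
      * exp (I * z * m) = ((Real.sqrt (2 * Real.pi) : ℝ) : ℂ)⁻¹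
        * ∫ m : ℝ, (∫ m₁, U m₁ * C (m - m₁)) * exp (I * z * m) := by
    rw [← integral_const_mul]
    congr 1
    funext m
    ring
  rw [e3, hconv]
  ring

end IsRayField

end InnerSol

end

noncomputable section

namespace InnerSol

namespace MainData

variable {P : MainData}

/-! ### The main equation -/

theorem moderate_of_norm_le (hP : P.Valid) {S : Set ℂ} {w : ℂ → ℝ → ℂ} {B : ℝ} (hB : 0 ≤ B)
    (hc : ContinuousOn (fun p : ℂ × ℝ => w p.1 p.2) (S ×ˢ univ))
    (hh : ∀ m, DifferentiableOn ℂ (fun τ => w τ m) S)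
    (hb : ∀ τ ∈ S, ∀ m, ‖w τ m‖ ≤ B * P.growth τ * weight P.μ P.β m) :
    Moderate P.k' P.β S w := by
  refine ⟨hc, hh, fun b hbβ => ⟨B, P.ν, hB, fun τ hτ m => (hb τ hτ m).trans ?_⟩⟩
  have h1 : weight P.μ P.β m ≤ Real.exp (-b * |m|) :=
    (weight_le_exp (by linarith [one_lt_μ hP]) m).trans
      (Real.exp_le_exp.2 (by nlinarith [abs_nonneg m]))
  have := growth_nonneg (P := P) τ
  calc _ ≤ B * P.growth τ * Real.exp (-b * |m|) := by gcongr
    _ = _ := by rw [growth]; ring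

theorem moderate_of_inExpBall (hP : P.Valid) {ρ d θ B : ℝ} (hB : 0 ≤ B) {w : ℂ → ℝ → ℂ}
    (hw : P.InExpBall ρ d θ B w) : Moderate P.k' P.β (infSector d θ) w :=
  moderate_of_norm_le hP hB (hw.cont.mono (prod_mono subset_union_left Subset.rfl))
    (fun m => (hw.holo m).mono subset_union_left)
    fun _ hτ m => norm_le_of_inExpBall hw (Or.inl hτ) m

theorem moderate_profile (hP : P.Valid) {Cψ : ℝ} {ψ : ℂ → ℝ → ℂ → ℂ}
    (hψ : P.IsForcingProfile Cψ ψ) (hC : 0 ≤ Cψ) {ε : ℂ} (hε : ε ∈ Metric.ball (0 : ℂ) P.ε₀)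
    (S : Set ℂ) : Moderate P.k' P.β S fun τ m => ψ τ m ε :=
  moderate_of_norm_le hP hC (continuous_profile hP hψ hC hε).continuousOn
    (fun m => (hψ.entire m ε hε).differentiableOn) fun τ _ m => norm_profile_le hψ hε τ m

theorem norm_C_le_exp (hP : P.Valid) {l₁ l₂ : ℕ} (h₁ : l₁ ∈ Finset.Ico 1 P.D₁)
    (h₂ : l₂ ∈ Finset.Ico 1 P.D₂) {ε : ℂ} (hε : ε ∈ Metric.ball (0 : ℂ) P.ε₀) :
    ∃ B : ℝ, 0 < B ∧ ∀ m, ‖P.C l₁ l₂ m ε‖ ≤ B * Real.exp (-P.β * |m|) := by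
  obtain ⟨B, hB, h⟩ := hP.C_bound l₁ h₁ l₂ h₂
  refine ⟨B, hB, fun m => (norm_C_le (h ε hε m)).trans ?_⟩
  gcongr
  exact weight_le_exp (by linarith [one_lt_μ hP]) m

theorem norm_exp_I_mul_mul (z : ℂ) (m : ℝ) : ‖exp (I * z * m)‖ = Real.exp (-(z.im * m)) := by
  rw [norm_exp]
  congr 1
  simp

theorem norm_exp_I_mul_mul_le (z : ℂ) (m : ℝ) :
    ‖exp (I * z * m)‖ ≤ Real.exp (|z.im| * |m|) := by
  rw [norm_exp_I_mul_mul, Real.exp_le_exp, ← abs_mul]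
  exact neg_le_abs _

theorem integrable_C_mul_exp (hP : P.Valid) {l₁ l₂ : ℕ} (h₁ : l₁ ∈ Finset.Ico 1 P.D₁)
    (h₂ : l₂ ∈ Finset.Ico 1 P.D₂) {ε z : ℂ} (hε : ε ∈ Metric.ball (0 : ℂ) P.ε₀)
    (hz : z ∈ strip P.β) : Integrable fun m : ℝ => P.C l₁ l₂ m ε * exp (I * z * m) := by
  obtain ⟨B, hB, h⟩ := norm_C_le_exp hP h₁ h₂ hε
  have hz' : 0 < P.β - |z.im| := sub_pos.2 hz
  refine ((integrable_exp_neg_mul_abs hz').const_mul B).mono' (Continuous.aestronglyMeasurable ?_)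
    (ae_of_all _ fun m => ?_)
  · exact (hP.C_cont l₁ h₁ l₂ h₂ ε hε).mul (by fun_prop)
  · rw [norm_mul]
    calc _ ≤ B * Real.exp (-P.β * |m|) * Real.exp (|z.im| * |m|) := by
          gcongr
          · exact h m
          · exact norm_exp_I_mul_mul_le z m
      _ = _ := by rw [mul_assoc, ← Real.exp_add]; congr 2; ring

/-- The forcing term is the transform of the profile along any admissible direction. -/
theorem f_eq_transform (hP : P.Valid) {Cψ : ℝ} {ψ : ℂ → ℝ → ℂ → ℂ}
    (hψ : P.IsForcingProfile Cψ ψ) (hC : 0 ≤ Cψ) {ε : ℂ} (hε : ε ∈ Metric.ball (0 : ℂ) P.ε₀)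
    {S : Set ℂ} {t₁ t₂ z : ℂ} {ξ : ℝ} (hr : IsRay P.k₂ S (ε ^ P.lam₂ * t₂) ξ) :
    P.f ψ t₁ t₂ z ε = transform P.k₁ P.k₂ (fun τ m => ψ τ m ε) ξ (ε ^ P.lam₁ * t₁)
      (ε ^ P.lam₂ * t₂) z := by
  obtain ⟨-, hT, a, ha, hξ⟩ := hr
  rw [MainData.f, transform]
  congr 1
  funext m
  rw [MainData.F]
  have harg : ε ^ P.lam₂ * t₂ = ‖ε ^ P.lam₂ * t₂‖ * exp (arg (ε ^ P.lam₂ * t₂) * I) :=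
    (norm_mul_exp_arg_mul_I _).symm
  -- Up to a multiple of `2π`, `arg` is the determination `a`, the centre of the admissible interval
  -- containing `ξ`. The profile is entire, so the rotation from `a` to `ξ` meets no sector
  -- constraint.
  obtain ⟨n, hn⟩ := exists_shift_of_eq_norm_mul_exp hT ha harg
  rw [hn, laplaceRay_add_int_mul_two_pi]
  obtain ⟨K, ν, hK, hb⟩ := (moderate_profile hP hψ hC hε univ).bound 0 hP.β_pos
  refine laplaceRay_eq_laplaceRay (K := K) (ν := ν) hP.one_le_k₁ hP.k₁_lt_k₂ (k'_pos hP)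
    hP.k'_lt_k₂ hT ha (by simpa using Real.pi_pos) hξ
    (fun r _ φ _ => (hψ.entire m ε hε).differentiableAt) fun r hr φ _ => ?_
  have := hb (r * exp (φ * I)) (mem_univ _) m
  rw [norm_ray hr.le] at this
  simpa using this

theorem scaled_pow_mul_scaled_pow (k₁ k₂ : ℕ) {ε : ℂ} (hε : ε ≠ 0) (a₁ a₂ n₁ n₂ : ℕ) (x y g : ℂ) :
    (k₁ / ε ^ a₁ * x) ^ n₁ * ((k₂ / ε ^ a₂ * y) ^ n₂ * g)
      = (ε ^ (a₁ * n₁ + a₂ * n₂))⁻¹ * ((k₁ * x) ^ n₁ * (k₂ * y) ^ n₂ * g) := by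
  simp only [div_mul_eq_mul_div, div_pow, ← pow_mul, pow_add]
  field_simp

/-- The transform of a solution of the auxiliary equation solves the main equation. -/
theorem solvesAt_fieldTransform (hP : P.Valid) {Cψ : ℝ} {ψ : ℂ → ℝ → ℂ → ℂ}
    (hψ : P.IsForcingProfile Cψ ψ) (hC : 0 ≤ Cψ) {ε : ℂ} (hε : ε ∈ Metric.ball (0 : ℂ) P.ε₀)
    {d θ : ℝ} {A₁ A₂ : Set ℂ} {ξ : ℂ → ℂ → ℝ}
    (h : IsRayField P.k₁ P.k₂ P.k' P.β d θ P.lam₂ ε A₁ A₂ ξ) {w : ℂ → ℝ → ℂ}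
    (hw : Moderate P.k' P.β (infSector d θ) w) (hsol : P.SolvesBorel ψ ε (infSector d θ) w)
    {t₁ t₂ z : ℂ} (ht₁ : t₁ ∈ A₁) (ht₂ : t₂ ∈ A₂) (hz : z ∈ strip P.β) :
    P.SolvesAt ψ ε (fieldTransform P.k₁ P.k₂ P.lam₁ P.lam₂ ε ξ w) t₁ t₂ z := by
  have hk' := k'_pos hP
  have hε0 := h.ε_ne_zero
  have hr := h.isRay t₁ ht₁ t₂ ht₂
  -- the leading term
  obtain ⟨m2, e2⟩ := h.iterate_opT2_eq (l₁ := P.lam₁) (hw.eval_mul (P.R P.D₁ P.D₂))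
    (fun s₁ hs₁ s₂ hs₂ y hy => h.opZ_eq hw (P.R P.D₁ P.D₂) hs₁ hs₂ hy) (P.δ₂ P.D₂)
  obtain ⟨m1, e1⟩ := h.iterate_opT1_eq m2 e2 (P.δ₁ P.D₁)
  -- the other terms
  have hterm : ∀ l₁ ∈ Finset.Ico 1 P.D₁, ∀ l₂ ∈ Finset.Ico 1 P.D₂,
      Moderate P.k' P.β (infSector d θ) (fun τ m => (P.k₁ / ε ^ (P.lam₁ * P.k₁) * τ ^ P.k₁) ^ P.δ₁ l₁
        * ((P.k₂ / ε ^ (P.lam₂ * P.k₂) * τ ^ P.k₂) ^ P.δ₂ l₂ * P.borelConv l₁ l₂ ε w τ m)) ∧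
      ((opT1 P.k₁)^[P.δ₁ l₁] ((opT2 P.k₂)^[P.δ₂ l₂] (fun s₁ s₂ y => P.c l₁ l₂ y ε *
        opZ (P.R l₁ l₂) (fieldTransform P.k₁ P.k₂ P.lam₁ P.lam₂ ε ξ w) s₁ s₂ y))) t₁ t₂ z
      = fieldTransform P.k₁ P.k₂ P.lam₁ P.lam₂ ε ξ
        (fun τ m => (P.k₁ / ε ^ (P.lam₁ * P.k₁) * τ ^ P.k₁) ^ P.δ₁ l₁
        * ((P.k₂ / ε ^ (P.lam₂ * P.k₂) * τ ^ P.k₂) ^ P.δ₂ l₂ * P.borelConv l₁ l₂ ε w τ m))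
          t₁ t₂ z := by
    intro l₁ h₁ l₂ h₂
    obtain ⟨B, hB, hCB⟩ := norm_C_le_exp hP h₁ h₂ hε
    obtain ⟨B', -, hCB'⟩ := norm_C_le_const hP h₁ h₂ hε
    have hcont := hP.C_cont l₁ h₁ l₂ h₂ ε hε
    have hRw := hw.eval_mul (P.R l₁ l₂)
    have m0 : Moderate P.k' P.β (infSector d θ) (P.borelConv l₁ l₂ ε w) :=
      hRw.convol (isOpen_infSector d θ) hk' hP.β_pos hcont hB.le hCB
    obtain ⟨m2, e2⟩ := h.iterate_opT2_eq (l₁ := P.lam₁) m0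
      (f := fun s₁ s₂ y => P.c l₁ l₂ y ε *
        opZ (P.R l₁ l₂) (fieldTransform P.k₁ P.k₂ P.lam₁ P.lam₂ ε ξ w) s₁ s₂ y)
      (fun s₁ hs₁ s₂ hs₂ y hy => by
        rw [h.opZ_eq hw (P.R l₁ l₂) hs₁ hs₂ hy]
        exact h.invFourier_mul_eq hRw hcont hCB' (integrable_C_mul_exp hP h₁ h₂ hε hy) hs₁ hs₂ hy)
      (P.δ₂ l₂)
    obtain ⟨m1, e1⟩ := h.iterate_opT1_eq m2 e2 (P.δ₁ l₁)
    exact ⟨m1, e1 t₁ ht₁ t₂ ht₂ z hz⟩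
  have hψm := moderate_profile hP hψ hC hε (infSector d θ)
  rw [SolvesAt, h.opZ_eq hw P.Q ht₁ ht₂ hz, e1 t₁ ht₁ t₂ ht₂ z hz,
    f_eq_transform hP hψ hC hε hr]
  have hsum : ∑ l₁ ∈ Finset.Ico 1 P.D₁, ∑ l₂ ∈ Finset.Ico 1 P.D₂, ε ^ P.Dlt l₁ l₂ *
      ((opT1 P.k₁)^[P.δ₁ l₁] ((opT2 P.k₂)^[P.δ₂ l₂] (fun s₁ s₂ y => P.c l₁ l₂ y ε *
        opZ (P.R l₁ l₂) (fieldTransform P.k₁ P.k₂ P.lam₁ P.lam₂ ε ξ w) s₁ s₂ y))) t₁ t₂ z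
      = transform P.k₁ P.k₂ (fun τ m => ∑ l₁ ∈ Finset.Ico 1 P.D₁, ∑ l₂ ∈ Finset.Ico 1 P.D₂,
          ε ^ P.Dlt l₁ l₂ * ((P.k₁ / ε ^ (P.lam₁ * P.k₁) * τ ^ P.k₁) ^ P.δ₁ l₁
          * ((P.k₂ / ε ^ (P.lam₂ * P.k₂) * τ ^ P.k₂) ^ P.δ₂ l₂ * P.borelConv l₁ l₂ ε w τ m)))
          (ξ t₁ t₂) (ε ^ P.lam₁ * t₁) (ε ^ P.lam₂ * t₂) z := by
    rw [transform_sum h.one_le_k₁ h.k₁_lt_k₂ hk' h.k'_lt_k₂ hr hz _ fun l₁ h₁ =>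
      Moderate.sum _ fun l₂ h₂ => (hterm l₁ h₁ l₂ h₂).1.const_mul hk' _]
    refine Finset.sum_congr rfl fun l₁ h₁ => ?_
    rw [transform_sum h.one_le_k₁ h.k₁_lt_k₂ hk' h.k'_lt_k₂ hr hz _ fun l₂ h₂ =>
      (hterm l₁ h₁ l₂ h₂).1.const_mul hk' _]
    refine Finset.sum_congr rfl fun l₂ h₂ => ?_
    rw [(hterm l₁ h₁ l₂ h₂).2, transform_const_mul, fieldTransform]
  have hsm : Moderate P.k' P.β (infSector d θ) (fun τ m => ∑ l₁ ∈ Finset.Ico 1 P.D₁,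
      ∑ l₂ ∈ Finset.Ico 1 P.D₂, ε ^ P.Dlt l₁ l₂ *
        ((P.k₁ / ε ^ (P.lam₁ * P.k₁) * τ ^ P.k₁) ^ P.δ₁ l₁
        * ((P.k₂ / ε ^ (P.lam₂ * P.k₂) * τ ^ P.k₂) ^ P.δ₂ l₂ * P.borelConv l₁ l₂ ε w τ m))) :=
    Moderate.sum _ fun l₁ h₁ => Moderate.sum _ fun l₂ h₂ =>
      (hterm l₁ h₁ l₂ h₂).1.const_mul hk' _
  rw [hsum, fieldTransform, fieldTransform, ← transform_const_mul (ε ^ P.Dlt P.D₁ P.D₂),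
    ← transform_add h.one_le_k₁ h.k₁_lt_k₂ hk' h.k'_lt_k₂ (m1.const_mul hk' _) hr hz hsm,
    ← transform_add h.one_le_k₁ h.k₁_lt_k₂ hk' h.k'_lt_k₂ ((m1.const_mul hk' _).add hsm) hr hz hψm]
  -- Both sides are now transforms along the same half line, so it suffices to compare the functions
  -- of `(τ, m)` on the sector, and this is the auxiliary equation.
  refine transform_congr hr.1 fun τ hτ m => ?_
  have hB := solvesBorel_iff.1 hsol τ hτ m
  rw [Pm] at hB
  have g0 : ε ^ P.Dlt P.D₁ P.D₂ * ((P.k₁ / ε ^ (P.lam₁ * P.k₁) * τ ^ P.k₁) ^ P.δ₁ P.D₁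
      * ((P.k₂ / ε ^ (P.lam₂ * P.k₂) * τ ^ P.k₂) ^ P.δ₂ P.D₂
        * ((P.R P.D₁ P.D₂).eval (I * m) * w τ m)))
      = (P.k₁ * τ ^ P.k₁) ^ P.δ₁ P.D₁ * (P.k₂ * τ ^ P.k₂) ^ P.δ₂ P.D₂
        * (P.R P.D₁ P.D₂).eval (I * m) * w τ m := by
    -- The choice of `Δ_{D₁D₂}` cancels exactly the powers of `ε` produced by the rescaled times, so
    -- the leading term has no `ε` left.
    rw [scaled_pow_mul_scaled_pow _ _ hε0, hP.Dlt_top, mul_inv_cancel_left₀ (pow_ne_zero _ hε0)]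
    ring
  have g1 : ∑ l₁ ∈ Finset.Ico 1 P.D₁, ∑ l₂ ∈ Finset.Ico 1 P.D₂, ε ^ P.Dlt l₁ l₂ *
        ((P.k₁ / ε ^ (P.lam₁ * P.k₁) * τ ^ P.k₁) ^ P.δ₁ l₁
        * ((P.k₂ / ε ^ (P.lam₂ * P.k₂) * τ ^ P.k₂) ^ P.δ₂ l₂ * P.borelConv l₁ l₂ ε w τ m))
      = P.borelSum ε w τ m := by
    refine Finset.sum_congr rfl fun l₁ h₁ => Finset.sum_congr rfl fun l₂ h₂ => ?_
    rw [scaled_pow_mul_scaled_pow _ _ hε0, ← mul_assoc, ← pow_sub₀ _ hε0 (hP.Dlt_gt l₁ h₁ l₂ h₂).le,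
      borelCoeff]
    ring
  simp only [g0, g1]
  linear_combination hB

end MainData

end InnerSol

end

noncomputable section

namespace InnerSol

/-! ### Estimates along admissible directions -/

/-- The elementary bound `x^k ≥ x - 1` reduces to an exponential integral of rate `c/T`, so the
result is linear in `T`; this linearity gives the limits at vanishing times. -/
theorem norm_integral_Ioi_le_of_exp_neg_pow {f : ℝ → ℂ} {A c T s : ℝ} {k : ℕ} (hk : 1 ≤ k)
    (hc : 0 < c) (hT : 0 < T) (hs : 0 ≤ s) (hA : 0 ≤ A)
    (hf : ∀ r, s < r → ‖f r‖ ≤ A * Real.exp (-(c * (r / T) ^ k))) :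
    ‖∫ r in Ioi s, f r‖ ≤ A * (Real.exp c * T / c) := by
  have hcT : 0 < c / T := by positivity
  have hle : ∀ r ∈ Ioi s, ‖f r‖ ≤ A * Real.exp c * Real.exp (-(c / T) * r) := by
    intro r hr
    have hr0 : 0 < r := hs.trans_lt hr
    refine (hf r hr).trans ?_
    rw [mul_assoc, ← Real.exp_add]
    refine mul_le_mul_of_nonneg_left (Real.exp_le_exp.2 ?_) hA
    have h1 : r / T - 1 ≤ (r / T) ^ k := by
      rcases le_total 1 (r / T) with h | h
      · have := le_self_pow₀ h (by omega : k ≠ 0)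
        linarith
      · have : 0 ≤ (r / T) ^ k := by positivity
        linarith
    have : c * (r / T - 1) ≤ c * (r / T) ^ k := mul_le_mul_of_nonneg_left h1 hc.le
    calc -(c * (r / T) ^ k) ≤ -(c * (r / T - 1)) := by linarith
      _ = c + -(c / T) * r := by ring
  have := norm_integral_le_of_norm_le ((exp_neg_integrableOn_Ioi s hcT).const_mul (A * Real.exp c))
    ((ae_restrict_mem measurableSet_Ioi).mono hle)
  refine this.trans ?_
  rw [integral_const_mul, integral_exp_mul_Ioi (by linarith), neg_div_neg_eq, mul_assoc]
  refine mul_le_mul_of_nonneg_left ?_ hA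
  have h2 : Real.exp (-(c / T) * s) ≤ 1 := Real.exp_le_one_iff.2 (by nlinarith)
  calc Real.exp c * (Real.exp (-(c / T) * s) / (c / T)) ≤ Real.exp c * (1 / (c / T)) := by gcongr
    _ = _ := by rw [one_div_div, mul_div_assoc]

theorem sin_le_cos_of_abs_le {δ x : ℝ} (hδ : 0 ≤ δ) (hx : |x| ≤ Real.pi / 2 - δ) :
    Real.sin δ ≤ Real.cos x := by
  rw [← Real.cos_pi_div_two_sub, ← Real.cos_abs x]
  exact Real.cos_le_cos_of_nonneg_of_le_pi (abs_nonneg x) (by linarith [Real.pi_pos]) hx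

/-- `c` is a lower bound for the decay of both factors of the kernel in the direction `φ`. -/
structure IsDecaying (k₁ k₂ : ℕ) (c : ℝ) (T₁ T₂ : ℂ) (φ : ℝ) : Prop where
  fst : ∀ r : ℝ, 0 ≤ r → c * (r / ‖T₁‖) ^ k₁ ≤ ((r * exp (φ * I) / T₁) ^ k₁).re
  snd : ∀ r : ℝ, 0 ≤ r → c * (r / ‖T₂‖) ^ k₂ ≤ ((r * exp (φ * I) / T₂) ^ k₂).re

theorem isDecaying_of_abs_le {k₁ k₂ : ℕ} {T₁ T₂ : ℂ} {a₁ a₂ δ φ : ℝ} (hδ : 0 ≤ δ)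
    (h₁ : T₁ = ‖T₁‖ * exp (a₁ * I)) (h₂ : T₂ = ‖T₂‖ * exp (a₂ * I))
    (hφ₁ : |k₁ * (φ - a₁)| ≤ Real.pi / 2 - δ) (hφ₂ : |k₂ * (φ - a₂)| ≤ Real.pi / 2 - δ) :
    IsDecaying k₁ k₂ (Real.sin δ) T₁ T₂ φ := by
  refine ⟨fun r hr => ?_, fun r hr => ?_⟩
  · rw [ray_div_pow_re h₁, mul_comm]
    exact mul_le_mul_of_nonneg_left (sin_le_cos_of_abs_le hδ hφ₁) (by positivity)
  · rw [ray_div_pow_re h₂, mul_comm]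
    exact mul_le_mul_of_nonneg_left (sin_le_cos_of_abs_le hδ hφ₂) (by positivity)

theorem IsDecaying.norm_kernel_le {k₁ k₂ : ℕ} {c : ℝ} {T₁ T₂ : ℂ} {φ r : ℝ}
    (h : IsDecaying k₁ k₂ c T₁ T₂ φ) (hr : 0 ≤ r) :
    ‖kernel k₁ k₂ (r * exp (φ * I)) T₁ T₂‖
      ≤ Real.exp (-(c * (r / ‖T₁‖) ^ k₁) - c * (r / ‖T₂‖) ^ k₂) := by
  rw [norm_kernel, Real.exp_le_exp]
  have := h.fst r hr
  have := h.snd r hr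
  linarith

/-- Pointwise bound of the integrand of the Laplace-like integral in a direction of decay. -/
theorem exists_norm_rayIntegrand_le {k₁ k₂ : ℕ} {k' ν c : ℝ} (hk' : 0 < k') (hk'2 : k' < k₂)
    (hν : 0 ≤ ν) (hc : 0 < c) :
    ∃ K : ℝ, 0 ≤ K ∧ ∀ (T₁ T₂ : ℂ) (φ A r : ℝ) (g : ℂ → ℂ), T₂ ≠ 0 → 0 < r →
      IsDecaying k₁ k₂ c T₁ T₂ φ →
      ‖g (r * exp (φ * I))‖ ≤ A * (r * Real.exp (ν * r ^ k')) →
      ‖rayIntegrand k₁ k₂ g φ T₁ T₂ r‖ ≤ A * Real.exp (K * ‖T₂‖ ^ (1 / k' - 1 / (k₂ : ℝ))⁻¹)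
        * (Real.exp (-(c * (r / ‖T₁‖) ^ k₁)) * Real.exp (-(c / 2 * (r / ‖T₂‖) ^ k₂))) := by
  -- Half of the decay in `r/‖T₂‖` is spent on absorbing `exp(ν r^{k'})`; the other half stays
  -- available for integration.
  obtain ⟨K, hK, hy⟩ := exists_mul_rpow_le_rpow_add (b := c / 2) hk' hk'2 hν (half_pos hc)
  refine ⟨K, hK, fun T₁ T₂ φ A r g hT hr hd hg => ?_⟩
  have h1 := hy ‖T₂‖ (norm_pos_iff.2 hT) r hr.le
  rw [Real.rpow_natCast] at h1
  have hA : 0 ≤ A :=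
    nonneg_of_mul_nonneg_left ((norm_nonneg _).trans hg) (by positivity)
  rw [rayIntegrand, norm_div, norm_mul, norm_real, Real.norm_of_nonneg hr.le, div_le_iff₀ hr]
  calc _ ≤ A * (r * Real.exp (ν * r ^ k'))
        * Real.exp (-(c * (r / ‖T₁‖) ^ k₁) - c * (r / ‖T₂‖) ^ k₂) := by
        gcongr
        exact hd.norm_kernel_le hr.le
    _ = A * r * Real.exp (ν * r ^ k' + (-(c * (r / ‖T₁‖) ^ k₁) - c * (r / ‖T₂‖) ^ k₂)) := by
        rw [Real.exp_add]; ring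
    _ ≤ A * r * Real.exp (K * ‖T₂‖ ^ (1 / k' - 1 / (k₂ : ℝ))⁻¹
          + (-(c * (r / ‖T₁‖) ^ k₁) + -(c / 2 * (r / ‖T₂‖) ^ k₂))) := by
        refine mul_le_mul_of_nonneg_left (Real.exp_le_exp.2 ?_) (by positivity)
        linarith
    _ = _ := by rw [Real.exp_add, Real.exp_add]; ring

/-- Bounds of the Laplace-like integral in a direction of decay, linear in `‖T₁‖`, respectively
in `‖T₂‖`. -/
theorem exists_norm_laplaceRay_le {k₁ k₂ : ℕ} {k' ν c : ℝ} (h1 : 1 ≤ k₁) (h12 : k₁ < k₂)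
    (hk' : 0 < k') (hk'2 : k' < k₂) (hν : 0 ≤ ν) (hc : 0 < c) :
    ∃ K C : ℝ, 0 ≤ K ∧ 0 ≤ C ∧ ∀ (T₁ T₂ : ℂ) (φ A : ℝ) (g : ℂ → ℂ), T₁ ≠ 0 → T₂ ≠ 0 → 0 ≤ A →
      IsDecaying k₁ k₂ c T₁ T₂ φ →
      (∀ r : ℝ, 0 < r → ‖g (r * exp (φ * I))‖ ≤ A * (r * Real.exp (ν * r ^ k'))) →
      ‖laplaceRay k₁ k₂ g φ T₁ T₂‖
          ≤ C * Real.exp (K * ‖T₂‖ ^ (1 / k' - 1 / (k₂ : ℝ))⁻¹) * ‖T₁‖ * A ∧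
      ‖laplaceRay k₁ k₂ g φ T₁ T₂‖
          ≤ C * Real.exp (K * ‖T₂‖ ^ (1 / k' - 1 / (k₂ : ℝ))⁻¹) * ‖T₂‖ * A := by
  obtain ⟨K, hK, hb⟩ := exists_norm_rayIntegrand_le (k₁ := k₁) hk' hk'2 hν hc
  refine ⟨K, max (Real.exp c / c) (Real.exp (c / 2) / (c / 2)), hK, by positivity,
    fun T₁ T₂ φ A g hT₁ hT₂ hA hd hg => ?_⟩
  set E := Real.exp (K * ‖T₂‖ ^ (1 / k' - 1 / (k₂ : ℝ))⁻¹) with hE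
  have hE0 : 0 < E := Real.exp_pos _
  have n1 : 0 < ‖T₁‖ := norm_pos_iff.2 hT₁
  have n2 : 0 < ‖T₂‖ := norm_pos_iff.2 hT₂
  -- Both decaying factors are at most `1`. Integrating the first and dropping the second gives the
  -- bound linear in `‖T₁‖`; exchanging their roles gives the one linear in `‖T₂‖`.
  have hb' := fun (r : ℝ) (hr : 0 < r) => hb T₁ T₂ φ A r g hT₂ hr hd (hg r hr)
  constructor
  · have := norm_integral_Ioi_le_of_exp_neg_pow (f := rayIntegrand k₁ k₂ g φ T₁ T₂) (A := A * E)
      (T := ‖T₁‖) h1 hc n1 le_rfl (by positivity) fun r hr => (hb' r hr).trans ?_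
    · refine this.trans ?_
      calc A * E * (Real.exp c * ‖T₁‖ / c) = (Real.exp c / c) * E * ‖T₁‖ * A := by ring
        _ ≤ _ := by gcongr; exact le_max_left _ _
    · refine mul_le_mul_of_nonneg_left (mul_le_of_le_one_right (Real.exp_pos _).le ?_)
        (by positivity)
      exact Real.exp_le_one_iff.2 (neg_nonpos.2 (by positivity))
  · have := norm_integral_Ioi_le_of_exp_neg_pow (f := rayIntegrand k₁ k₂ g φ T₁ T₂) (A := A * E)
      (T := ‖T₂‖) (by omega : 1 ≤ k₂) (half_pos hc) n2 le_rfl (by positivity)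
      fun r hr => (hb' r hr).trans ?_
    · refine this.trans ?_
      calc A * E * (Real.exp (c / 2) * ‖T₂‖ / (c / 2))
          = (Real.exp (c / 2) / (c / 2)) * E * ‖T₂‖ * A := by ring
        _ ≤ _ := by gcongr; exact le_max_right _ _
    · refine mul_le_mul_of_nonneg_left (mul_le_of_le_one_left (Real.exp_pos _).le ?_)
        (by positivity)
      exact Real.exp_le_one_iff.2 (neg_nonpos.2 (by positivity))

/-- The Laplace-like integrals of a function holomorphic near the vertex, along two half lines in
directions of decay, are close to each other. -/
theorem exists_norm_laplaceRay_sub_le {k₁ k₂ : ℕ} {k' ν c s : ℝ} (h1 : 1 ≤ k₁)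
    (hk' : 0 < k') (hk'2 : k' < k₂) (hν : 0 ≤ ν) (hc : 0 < c) (hs : 0 < s) :
    ∃ K C : ℝ, 0 ≤ K ∧ 0 ≤ C ∧ ∀ (T₁ T₂ : ℂ) (ξ ξ' A : ℝ) (g : ℂ → ℂ), T₁ ≠ 0 → T₂ ≠ 0 → 0 ≤ A →
      |ξ' - ξ| ≤ Real.pi → (∀ φ ∈ uIcc ξ ξ', IsDecaying k₁ k₂ c T₁ T₂ φ) →
      (∀ r : ℝ, 0 < r → r ≤ s → ∀ φ ∈ uIcc ξ ξ', DifferentiableAt ℂ g (r * exp (φ * I))) →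
      (∀ r : ℝ, 0 < r → r ≤ s → ∀ φ ∈ uIcc ξ ξ',
        ‖g (r * exp (φ * I))‖ ≤ A * (r * Real.exp (ν * r ^ k'))) →
      (∀ φ : ℝ, φ = ξ ∨ φ = ξ' → IntegrableOn (rayIntegrand k₁ k₂ g φ T₁ T₂) (Ioi 0)) →
      (∀ φ : ℝ, φ = ξ ∨ φ = ξ' → ∀ r : ℝ, 0 < r →
        ‖g (r * exp (φ * I))‖ ≤ A * (r * Real.exp (ν * r ^ k'))) →
      ‖laplaceRay k₁ k₂ g ξ' T₁ T₂ - laplaceRay k₁ k₂ g ξ T₁ T₂‖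
        ≤ C * (Real.exp (K * ‖T₂‖ ^ (1 / k' - 1 / (k₂ : ℝ))⁻¹) * ‖T₁‖ + 1)
          * Real.exp (-(c / 2 * (s / ‖T₁‖) ^ k₁)) * A := by
  obtain ⟨K, hK, hb⟩ := exists_norm_rayIntegrand_le (k₁ := k₁) hk' hk'2 hν hc
  set C₁ := 2 * (Real.exp (c / 2) / (c / 2)) with hC₁
  set C₂ := s * Real.exp (ν * s ^ k') * Real.pi with hC₂
  have hC₁0 : 0 ≤ C₁ := by positivity
  have hC₂0 : 0 ≤ C₂ := by have := Real.pi_pos; positivity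
  refine ⟨K, C₁ + C₂, hK, by positivity,
    fun T₁ T₂ ξ ξ' A g hT₁ hT₂ hA hπ hd hg hgb hint hgray => ?_⟩
  set E := Real.exp (K * ‖T₂‖ ^ (1 / k' - 1 / (k₂ : ℝ))⁻¹) with hE
  have hE0 : 0 < E := Real.exp_pos _
  have n1 : 0 < ‖T₁‖ := norm_pos_iff.2 hT₁
  set q := Real.exp (-(c / 2 * (s / ‖T₁‖) ^ k₁)) with hq
  have hq0 : 0 < q := Real.exp_pos _
  have hdend : ∀ φ : ℝ, φ = ξ ∨ φ = ξ' → IsDecaying k₁ k₂ c T₁ T₂ φ := by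
    rintro φ (rfl | rfl)
    · exact hd _ left_mem_uIcc
    · exact hd _ right_mem_uIcc
  have hsplit : ∀ φ : ℝ, φ = ξ ∨ φ = ξ' → laplaceRay k₁ k₂ g φ T₁ T₂
      = (∫ r in (0 : ℝ)..s, rayIntegrand k₁ k₂ g φ T₁ T₂ r)
        + ∫ r in Ioi s, rayIntegrand k₁ k₂ g φ T₁ T₂ r := fun φ hφ =>
    (intervalIntegral.integral_interval_add_Ioi (hint φ hφ)
      ((hint φ hφ).mono_set (Ioi_subset_Ioi hs.le))).symm
  -- Beyond radius `s`, half of the decay in `r/‖T₁‖` yields the small factor `q` and the other half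
  -- is integrated.
  have htail : ∀ φ : ℝ, φ = ξ ∨ φ = ξ' → ‖∫ r in Ioi s, rayIntegrand k₁ k₂ g φ T₁ T₂ r‖
      ≤ A * E * q * (Real.exp (c / 2) * ‖T₁‖ / (c / 2)) := by
    intro φ hφ
    refine norm_integral_Ioi_le_of_exp_neg_pow h1 (half_pos hc) n1 hs.le (by positivity)
      fun r hr => ?_
    have hr0 : 0 < r := hs.trans hr
    refine (hb T₁ T₂ φ A r g hT₂ hr0 (hdend φ hφ) (hgray φ hφ r hr0)).trans ?_
    rw [mul_assoc (A * E)]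
    refine mul_le_mul_of_nonneg_left ?_ (by positivity)
    rw [hq, ← Real.exp_add, ← Real.exp_add]
    refine Real.exp_le_exp.2 ?_
    have i1 : (s / ‖T₁‖) ^ k₁ ≤ (r / ‖T₁‖) ^ k₁ := by
      gcongr
    have i2 : 0 ≤ c / 2 * (r / ‖T₂‖) ^ k₂ := by positivity
    nlinarith
  have hrot := integral_ray_zero_sub_integral_ray_zero (h := fun u => g u * kernel k₁ k₂ u T₁ T₂)
    (ξ := ξ) (ξ' := ξ') (K := A * Real.exp (ν * s ^ k')) hs
    (fun r hr φ hφ => (hg r hr.1 hr.2 φ hφ).mul (differentiable_kernel _ _ _ _).differentiableAt)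
    (fun r hr φ hφ => by
      have hr0 : 0 < r := hr.1
      have hk1 : ‖kernel k₁ k₂ (r * exp (φ * I)) T₁ T₂‖ ≤ 1 := by
        refine ((hd φ hφ).norm_kernel_le hr.1.le).trans (Real.exp_le_one_iff.2 ?_)
        have : 0 ≤ c * (r / ‖T₁‖) ^ k₁ := by positivity
        have : 0 ≤ c * (r / ‖T₂‖) ^ k₂ := by positivity
        linarith
      rw [norm_mul]
      calc _ ≤ A * (r * Real.exp (ν * r ^ k')) * 1 := by
            gcongr
            exact hgb r hr.1 hr.2 φ hφ
        _ ≤ A * (r * Real.exp (ν * s ^ k')) * 1 := by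
            have := Real.rpow_le_rpow hr0.le hr.2 hk'.le
            gcongr
        _ = _ := by ring)
  -- On the arc of radius `s` the kernel is at most `q`; the length of the arc in angle is at most
  -- `π`.
  have harc : ‖I * ∫ φ in ξ..ξ', (fun u => g u * kernel k₁ k₂ u T₁ T₂) (s * exp (φ * I))‖
      ≤ C₂ * q * A := by
    rw [norm_mul, norm_I, one_mul]
    have := intervalIntegral.norm_integral_le_of_norm_le_const (a := ξ) (b := ξ')
      (f := fun φ : ℝ => (fun u => g u * kernel k₁ k₂ u T₁ T₂) (s * exp (φ * I)))
      (C := A * (s * Real.exp (ν * s ^ k')) * q) fun φ hφ => by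
        have hφ' := uIoc_subset_uIcc hφ
        have hk1 : ‖kernel k₁ k₂ (s * exp (φ * I)) T₁ T₂‖ ≤ q := by
          refine ((hd φ hφ').norm_kernel_le hs.le).trans (Real.exp_le_exp.2 ?_)
          have : 0 ≤ c / 2 * (s / ‖T₁‖) ^ k₁ := by positivity
          have : 0 ≤ c * (s / ‖T₂‖) ^ k₂ := by positivity
          linarith
        rw [norm_mul]
        gcongr
        exact hgb s hs le_rfl φ hφ'
    refine this.trans ?_
    calc A * (s * Real.exp (ν * s ^ k')) * q * |ξ' - ξ|
        ≤ A * (s * Real.exp (ν * s ^ k')) * q * Real.pi := by gcongr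
      _ = _ := by rw [hC₂]; ring
  have hrot' : (∫ r in (0 : ℝ)..s, rayIntegrand k₁ k₂ g ξ' T₁ T₂ r)
      - ∫ r in (0 : ℝ)..s, rayIntegrand k₁ k₂ g ξ T₁ T₂ r
      = I * ∫ φ in ξ..ξ', (fun u => g u * kernel k₁ k₂ u T₁ T₂) (s * exp (φ * I)) := hrot
  rw [hsplit ξ' (Or.inr rfl), hsplit ξ (Or.inl rfl), add_sub_add_comm, hrot']
  refine (norm_add_le _ _).trans ((add_le_add harc ((norm_sub_le _ _).trans
    (add_le_add (htail ξ' (Or.inr rfl)) (htail ξ (Or.inl rfl))))).trans ?_)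
  have e : A * E * q * (Real.exp (c / 2) * ‖T₁‖ / (c / 2))
      + A * E * q * (Real.exp (c / 2) * ‖T₁‖ / (c / 2)) = C₁ * (E * ‖T₁‖) * q * A := by
    rw [hC₁]; ring
  rw [e]
  have j1 : 0 ≤ C₁ * q * A := by positivity
  have j2 : 0 ≤ C₂ * (E * ‖T₁‖) * q * A := by positivity
  linarith

/-- The inverse Fourier transform of a function dominated by the weight. -/
theorem norm_invFourier_le {f : ℝ → ℂ} {A μ β β' : ℝ} (hμ : 0 ≤ μ) (hβ' : β' < β)
    (hf : ∀ m, ‖f m‖ ≤ A * weight μ β m) {z : ℂ} (hz : z ∈ strip β') :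
    ‖invFourier f z‖ ≤ A * ∫ m : ℝ, Real.exp (-(β - β') * |m|) := by
  have hA : 0 ≤ A := nonneg_of_mul_nonneg_left ((norm_nonneg _).trans (hf 0)) (weight_pos _ _ 0)
  have hle : ‖∫ m : ℝ, f m * exp (I * z * m)‖ ≤ ∫ m : ℝ, A * Real.exp (-(β - β') * |m|) := by
    refine norm_integral_le_of_norm_le
      ((integrable_exp_neg_mul_abs (sub_pos.2 hβ')).const_mul A) (ae_of_all _ fun m => ?_)
    rw [norm_mul]
    calc ‖f m‖ * ‖exp (I * z * m)‖ ≤ A * Real.exp (-β * |m|) * Real.exp (|z.im| * |m|) := by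
          gcongr
          · refine (hf m).trans ?_
            gcongr
            exact weight_le_exp hμ m
          · exact MainData.norm_exp_I_mul_mul_le z m
      _ ≤ A * Real.exp (-β * |m|) * Real.exp (β' * |m|) := by
          have : |z.im| < β' := hz
          gcongr
      _ = _ := by rw [mul_assoc, ← Real.exp_add]; congr 2; ring
  rw [integral_const_mul] at hle
  rw [invFourier, norm_mul]
  calc _ ≤ 1 * _ := mul_le_mul norm_inv_sqrt_two_pi_le_one hle (norm_nonneg _) zero_le_one
    _ = _ := one_mul _

theorem invFourier_sub {f g : ℝ → ℂ} {z : ℂ} (hf : Integrable fun m : ℝ => f m * exp (I * z * m))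
    (hg : Integrable fun m : ℝ => g m * exp (I * z * m)) :
    invFourier f z - invFourier g z = invFourier (fun m => f m - g m) z := by
  simp only [invFourier, ← mul_sub, sub_mul]
  rw [integral_sub hf hg]

/-- Two admissible directions at the same point, with respect to possibly different sectors, are
joined by admissible directions, after a shift by a multiple of `2π`. -/
theorem MainData.IsDirection.exists_shift {P : MainData} (hP : P.Valid) {S S' : Set ℂ} {δ : ℝ}
    (hδ : 0 < δ) {t₁ t₂ ε : ℂ} (ht₁ : ε ^ P.lam₁ * t₁ ≠ 0) (ht₂ : ε ^ P.lam₂ * t₂ ≠ 0) {ξ ξ' : ℝ}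
    (h : P.IsDirection S δ t₁ t₂ ε ξ) (h' : P.IsDirection S' δ t₁ t₂ ε ξ') :
    ∃ n : ℤ, |ξ' + n * (2 * Real.pi) - ξ| ≤ Real.pi ∧ ∀ φ ∈ uIcc ξ (ξ' + n * (2 * Real.pi)),
      IsDecaying P.k₁ P.k₂ (Real.sin δ) (ε ^ P.lam₁ * t₁) (ε ^ P.lam₂ * t₂) φ := by
  obtain ⟨-, ⟨a₁, ha₁, hξ₁⟩, a₂, ha₂, hξ₂⟩ := h
  obtain ⟨-, ⟨b₁, hb₁, hξ₁'⟩, b₂, hb₂, hξ₂'⟩ := h'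
  obtain ⟨n, hn⟩ := exists_shift_of_eq_norm_mul_exp ht₂ hb₂ ha₂
  obtain ⟨p, hp⟩ := exists_shift_of_eq_norm_mul_exp ht₁ hb₁ ha₁
  have hπ := Real.pi_pos
  have hk₁ : (1 : ℝ) ≤ P.k₁ := by exact_mod_cast hP.one_le_k₁
  have hk₂ : (1 : ℝ) ≤ P.k₂ := by
    have := hP.k₁_lt_k₂
    have := hP.one_le_k₁
    exact_mod_cast (by omega : 1 ≤ P.k₂)
  have habs : ∀ (k x y : ℝ), 1 ≤ k → k * x - k * y ∈ Ioo (-(Real.pi / 2) + δ) (Real.pi / 2 - δ) →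
      |k * (x - y)| < Real.pi / 2 - δ ∧ |x - y| < Real.pi / 2 := by
    intro k x y hk hxy
    have h1 : |k * (x - y)| < Real.pi / 2 - δ := by
      rw [abs_lt]
      constructor <;> nlinarith [hxy.1, hxy.2]
    refine ⟨h1, ?_⟩
    rw [abs_mul, abs_of_pos (by linarith)] at h1
    nlinarith [abs_nonneg (x - y)]
  obtain ⟨u1, v1⟩ := habs _ _ _ hk₁ hξ₁
  obtain ⟨u2, v2⟩ := habs _ _ _ hk₂ hξ₂
  obtain ⟨u1', v1'⟩ := habs _ _ _ hk₁ hξ₁'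
  obtain ⟨u2', v2'⟩ := habs _ _ _ hk₂ hξ₂'
  have hd2 : |ξ' + n * (2 * Real.pi) - ξ| < Real.pi := by
    have : ξ' + n * (2 * Real.pi) - ξ = (ξ' - b₂) - (ξ - a₂) := by rw [hn]; ring
    rw [this]
    rw [abs_lt] at v2 v2' ⊢
    constructor <;> linarith
  -- One shift must suit both times. As `k₁, k₂ ≥ 1`, the direction `ξ` is within `π/2` of `a₁`,
  -- `ξ'` is within `π/2` of `b₁`, and the shifted `ξ'` is within `π` of `ξ`; so the two shifts
  -- differ by less than `2π`.
  have hnp : n = p := by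
    have h4 : |((n - p : ℤ) : ℝ) * (2 * Real.pi)| < 2 * Real.pi := by
      have : ((n - p : ℤ) : ℝ) * (2 * Real.pi)
          = (ξ' + n * (2 * Real.pi) - ξ) - (ξ' - b₁) + (ξ - a₁) := by
        rw [hp]; push_cast; ring
      rw [this]
      rw [abs_lt] at v1 v1' hd2 ⊢
      constructor <;> linarith
    rw [abs_mul, abs_of_pos (by positivity : 0 < 2 * Real.pi)] at h4
    have h5 : |((n - p : ℤ) : ℝ)| < 1 := by
      by_contra hcon
      push Not at hcon
      nlinarith
    have h6 : |n - p| < 1 := by exact_mod_cast h5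
    have := Int.abs_lt_one_iff.1 h6
    omega
  refine ⟨n, hd2.le, fun φ hφ => isDecaying_of_abs_le hδ.le ha₁ ha₂ ?_ ?_⟩
  · have e : P.k₁ * (ξ' - b₁) = P.k₁ * (ξ' + n * (2 * Real.pi) - a₁) := by rw [hp, hnp]; ring
    rw [e] at u1'
    rw [abs_lt] at u1 u1'
    rw [abs_le]
    rcases mem_uIcc.1 hφ with ⟨h7, h8⟩ | ⟨h7, h8⟩ <;> constructor <;> nlinarith
  · have e : P.k₂ * (ξ' - b₂) = P.k₂ * (ξ' + n * (2 * Real.pi) - a₂) := by rw [hn]; ring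
    rw [e] at u2'
    rw [abs_lt] at u2 u2'
    rw [abs_le]
    rcases mem_uIcc.1 hφ with ⟨h7, h8⟩ | ⟨h7, h8⟩ <;> constructor <;> nlinarith

theorem MainData.IsDirection.isRay {P : MainData} {S : Set ℂ} {δ : ℝ}
    (hδ : 0 < δ) {t₁ t₂ ε : ℂ} (ht₂ : ε ^ P.lam₂ * t₂ ≠ 0) {ξ : ℝ}
    (h : P.IsDirection S δ t₁ t₂ ε ξ) : IsRay P.k₂ S (ε ^ P.lam₂ * t₂) ξ := by
  obtain ⟨hS, -, a, ha, hξ⟩ := h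
  refine ⟨hS, ht₂, a, ha, ?_⟩
  rw [abs_lt]
  constructor <;> linarith [hξ.1, hξ.2]

theorem MainData.IsDirection.isDecaying {P : MainData} {S : Set ℂ} {δ : ℝ}
    (hδ : 0 < δ) {t₁ t₂ ε : ℂ} {ξ : ℝ} (h : P.IsDirection S δ t₁ t₂ ε ξ) :
    IsDecaying P.k₁ P.k₂ (Real.sin δ) (ε ^ P.lam₁ * t₁) (ε ^ P.lam₂ * t₂) ξ := by
  obtain ⟨-, ⟨a₁, ha₁, hξ₁⟩, a₂, ha₂, hξ₂⟩ := h
  refine isDecaying_of_abs_le hδ.le ha₁ ha₂ ?_ ?_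
  · rw [abs_le]; constructor <;> linarith [hξ₁.1, hξ₁.2]
  · rw [abs_le]; constructor <;> linarith [hξ₂.1, hξ₂.2]

/-- Nothing bounds `δ` above beforehand; the existence of a single admissible direction forces the
interval to be nonempty, that is `δ < π/2`. -/
theorem MainData.IsDirection.sin_pos {P : MainData} {S : Set ℂ} {δ : ℝ}
    (hδ : 0 < δ) {t₁ t₂ ε : ℂ} {ξ : ℝ} (h : P.IsDirection S δ t₁ t₂ ε ξ) : 0 < Real.sin δ := by
  obtain ⟨-, ⟨a₁, -, hξ₁⟩, -⟩ := h
  exact Real.sin_pos_of_pos_of_lt_pi hδ (by linarith [hξ₁.1, hξ₁.2, Real.pi_pos])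

end InnerSol

end

noncomputable section

namespace InnerSol

/-! ### Sectors -/

theorem bddSector_eq_inter (d θ R : ℝ) : bddSector d θ R = infSector d θ ∩ Metric.ball 0 R := by
  ext u
  constructor
  · rintro ⟨r, φ, hr, hR, hφ, rfl⟩
    exact ⟨⟨r, φ, hr, hφ, rfl⟩, by rwa [mem_ball_zero_iff, norm_ray hr.le]⟩
  · rintro ⟨⟨r, φ, hr, hφ, rfl⟩, hR⟩
    rw [mem_ball_zero_iff, norm_ray hr.le] at hR
    exact ⟨r, φ, hr, hR, hφ, rfl⟩

theorem ne_zero_of_mem_infSector {d θ : ℝ} {u : ℂ} (h : u ∈ infSector d θ) : u ≠ 0 := by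
  obtain ⟨r, φ, hr, -, rfl⟩ := h
  exact mul_ne_zero (ofReal_ne_zero.2 hr.ne') (exp_ne_zero _)

theorem infSector_nonempty (d : ℝ) {θ : ℝ} (hθ : 0 < θ) : (infSector d θ).Nonempty :=
  ⟨_, 1, d, one_pos, by simpa using hθ, rfl⟩

theorem bddSector_nonempty (d : ℝ) {θ R : ℝ} (hθ : 0 < θ) (hR : 0 < R) :
    (bddSector d θ R).Nonempty :=
  ⟨_, R / 2, d, half_pos hR, half_lt_self hR, by simpa using hθ, rfl⟩

theorem norm_mem_Ioo_of_mem_annularSector {r R a b : ℝ} (hr : 0 ≤ r) {x : ℂ}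
    (h : x ∈ annularSector r R a b) : ‖x‖ ∈ Ioo r R := by
  obtain ⟨s, φ, h1, h2, -, -, rfl⟩ := h
  rw [norm_ray (hr.trans h1.le)]
  exact ⟨h1, h2⟩

theorem norm_pow_mul_innerTime {l μ₂ : ℕ} (hl : l ≤ μ₂) {ε : ℂ} (hε : ε ≠ 0) (θ : ℝ) (x : ℂ) :
    ‖ε ^ l * innerTime μ₂ θ ε x‖ = ‖x‖ * ‖ε‖⁻¹ ^ (μ₂ - l) := by
  have h0 : ‖ε‖ ≠ 0 := norm_ne_zero_iff.2 hε
  obtain ⟨j, rfl⟩ := Nat.exists_eq_add_of_le hl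
  rw [innerTime, norm_mul, norm_mul, norm_div, norm_pow, norm_pow, norm_exp_ofReal_mul_I, mul_one,
    inv_pow, Nat.add_sub_cancel_left, pow_add]
  field_simp

/-! ### Estimates of the transform -/

theorem integrableOn_rayIntegrand {k₁ k₂ : ℕ} {k' β d θ ξ : ℝ} {G : ℂ → ℝ → ℂ} {T₁ T₂ : ℂ}
    (h1 : 1 ≤ k₁) (h12 : k₁ < k₂) (hk' : 0 < k') (hk'2 : k' < k₂)
    (hG : Moderate k' β (infSector d θ) G) (hr : IsRay k₂ (infSector d θ) T₂ ξ) (m : ℝ) :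
    IntegrableOn (rayIntegrand k₁ k₂ (fun τ => G τ m) ξ T₁ T₂) (Ioi 0) := by
  obtain ⟨hξ, hT, a, ha, hlt⟩ := hr
  obtain ⟨K, ν, hK, hb⟩ := hG.bound (β - 1) (by linarith)
  obtain ⟨B, hB, hker⟩ := exists_norm_mul_kernel_le (ν := ν) (T₁ := T₁) h1 h12 hk' hk'2 hT ha
    (Real.cos_pos_of_mem_Ioo (abs_lt.1 hlt))
  refine integrableOn_ray_Ioi (h := fun u => G u m * kernel k₁ k₂ u T₁ T₂)
    (K := K * Real.exp (-(β - 1) * |m|) * B) (fun r hr => ?_) fun r hr => ?_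
  · refine ContinuousAt.mul ?_ (differentiable_kernel _ _ _ _).continuous.continuousAt
    exact (hG.holo m).continuousOn.continuousAt
      ((isOpen_infSector d θ).mem_nhds (ray_mem_infSector hξ hr))
  · have h3 := hb _ (ray_mem_infSector hξ hr) m
    have h4 := hker r ξ hr.le le_rfl
    rw [norm_ray hr.le] at h3
    rw [norm_mul]
    calc _ ≤ K * r * Real.exp (ν * r ^ k') * Real.exp (-(β - 1) * |m|)
          * ‖kernel k₁ k₂ (r * exp (ξ * I)) T₁ T₂‖ := by gcongr
      _ = K * r * Real.exp (-(β - 1) * |m|)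
          * (Real.exp (ν * r ^ k') * ‖kernel k₁ k₂ (r * exp (ξ * I)) T₁ T₂‖) := by ring
      _ ≤ K * r * Real.exp (-(β - 1) * |m|) * (B * Real.exp (-r)) := by gcongr
      _ = _ := by ring

namespace MainData

variable {P : MainData}

theorem norm_ray_le_of_inExpBall {ρ d θ B : ℝ} {w : ℂ → ℝ → ℂ} (h : P.InExpBall ρ d θ B w)
    {r φ : ℝ} (hr : 0 < r) (hτ : (r : ℂ) * exp (φ * I) ∈ infSector d θ ∪ Metric.closedBall 0 ρ)
    (m : ℝ) : ‖w (r * exp (φ * I)) m‖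
      ≤ B * weight P.μ P.β m * (r * Real.exp (P.ν * r ^ P.k')) := by
  have := norm_le_of_inExpBall h hτ m
  rw [growth, norm_ray hr.le] at this
  linarith

/-- Bounds of the transform of an element of the Borel space, linear in `‖T₁‖`, respectively in
`‖T₂‖`. -/
theorem exists_norm_transform_le (hP : P.Valid) {c β' B : ℝ} (hc : 0 < c) (hβ' : β' < P.β)
    (hB : 0 ≤ B) :
    ∃ K C : ℝ, 0 ≤ K ∧ 0 ≤ C ∧ ∀ (ρ d θ ξ : ℝ) (w : ℂ → ℝ → ℂ) (T₁ T₂ z : ℂ), T₁ ≠ 0 → T₂ ≠ 0 →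
      P.InExpBall ρ d θ B w → exp (ξ * I) ∈ infSector d θ → IsDecaying P.k₁ P.k₂ c T₁ T₂ ξ →
      z ∈ strip β' →
      ‖transform P.k₁ P.k₂ w ξ T₁ T₂ z‖
          ≤ C * Real.exp (K * ‖T₂‖ ^ (1 / P.k' - 1 / (P.k₂ : ℝ))⁻¹) * ‖T₁‖ ∧
      ‖transform P.k₁ P.k₂ w ξ T₁ T₂ z‖
          ≤ C * Real.exp (K * ‖T₂‖ ^ (1 / P.k' - 1 / (P.k₂ : ℝ))⁻¹) * ‖T₂‖ := by
  obtain ⟨K, C, hK, hC, h⟩ := exists_norm_laplaceRay_le hP.one_le_k₁ hP.k₁_lt_k₂ (k'_pos hP)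
    hP.k'_lt_k₂ hP.ν_pos.le hc
  have hμ : 0 ≤ P.μ := by linarith [one_lt_μ hP]
  have hJ : 0 ≤ ∫ m : ℝ, Real.exp (-(P.β - β') * |m|) :=
    integral_nonneg fun m => (Real.exp_pos _).le
  refine ⟨K, C * B * ∫ m : ℝ, Real.exp (-(P.β - β') * |m|), hK, by positivity,
    fun ρ d θ ξ w T₁ T₂ z hT₁ hT₂ hw hξ hd hz => ?_⟩
  have hm := fun m : ℝ => h T₁ T₂ ξ (B * weight P.μ P.β m) (fun τ => w τ m) hT₁ hT₂
    (mul_nonneg hB (weight_pos _ _ _).le) hd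
    fun r hr => norm_ray_le_of_inExpBall hw hr (Or.inl (ray_mem_infSector hξ hr)) m
  constructor
  · exact (norm_invFourier_le (A := C * Real.exp (K * ‖T₂‖ ^ (1 / P.k' - 1 / (P.k₂ : ℝ))⁻¹)
      * ‖T₁‖ * B) hμ hβ' (fun m => (hm m).1.trans (le_of_eq (by ring))) hz).trans
      (le_of_eq (by ring))
  · exact (norm_invFourier_le (A := C * Real.exp (K * ‖T₂‖ ^ (1 / P.k' - 1 / (P.k₂ : ℝ))⁻¹)
      * ‖T₂‖ * B) hμ hβ' (fun m => (hm m).2.trans (le_of_eq (by ring))) hz).trans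
      (le_of_eq (by ring))

/-- The transforms along admissible directions in two different sectors are close. -/
theorem exists_norm_transform_sub_le (hP : P.Valid) {δ β' B ρ : ℝ} (hδ : 0 < δ)
    (hc : 0 < Real.sin δ) (hβ' : β' < P.β) (hB : 0 ≤ B) (hρ : 0 < ρ) :
    ∃ K C : ℝ, 0 ≤ K ∧ 0 ≤ C ∧ ∀ (d θ d' θ' ξ ξ' : ℝ) (w : ℂ → ℝ → ℂ) (t₁ t₂ ε z : ℂ),
      ε ^ P.lam₁ * t₁ ≠ 0 → ε ^ P.lam₂ * t₂ ≠ 0 →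
      P.InExpBall ρ d θ B w → P.InExpBall ρ d' θ' B w →
      P.IsDirection (infSector d θ) δ t₁ t₂ ε ξ → P.IsDirection (infSector d' θ') δ t₁ t₂ ε ξ' →
      z ∈ strip β' →
      ‖transform P.k₁ P.k₂ w ξ' (ε ^ P.lam₁ * t₁) (ε ^ P.lam₂ * t₂) z
          - transform P.k₁ P.k₂ w ξ (ε ^ P.lam₁ * t₁) (ε ^ P.lam₂ * t₂) z‖
        ≤ C * (Real.exp (K * ‖ε ^ P.lam₂ * t₂‖ ^ (1 / P.k' - 1 / (P.k₂ : ℝ))⁻¹)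
              * ‖ε ^ P.lam₁ * t₁‖ + 1)
          * Real.exp (-(Real.sin δ / 2 * (ρ / 2 / ‖ε ^ P.lam₁ * t₁‖) ^ P.k₁)) := by
  -- Cutting at `ρ/2` keeps the arc inside the open disc, where `w` is holomorphic whatever the
  -- direction.
  obtain ⟨K, C, hK, hC, h⟩ := exists_norm_laplaceRay_sub_le hP.one_le_k₁ (k'_pos hP)
    hP.k'_lt_k₂ hP.ν_pos.le hc (half_pos hρ)
  have hμ : 0 ≤ P.μ := by linarith [one_lt_μ hP]
  have hJ : 0 ≤ ∫ m : ℝ, Real.exp (-(P.β - β') * |m|) :=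
    integral_nonneg fun m => (Real.exp_pos _).le
  refine ⟨K, C * B * ∫ m : ℝ, Real.exp (-(P.β - β') * |m|), hK, by positivity,
    fun d θ d' θ' ξ ξ' w t₁ t₂ ε z hT₁ hT₂ hw hw' hξ hξ' hz => ?_⟩
  have hzβ : |z.im| < P.β := lt_trans hz hβ'
  obtain ⟨n, hn, hdec⟩ := hξ.exists_shift hP hδ hT₁ hT₂ hξ'
  have hM := moderate_of_inExpBall hP hB hw
  have hM' := moderate_of_inExpBall hP hB hw'
  have hray := hξ.isRay hδ hT₂
  have hray' := hξ'.isRay hδ hT₂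
  set T₁ := ε ^ P.lam₁ * t₁ with hT₁def
  set T₂ := ε ^ P.lam₂ * t₂ with hT₂def
  have hball : ∀ r φ : ℝ, 0 < r → r ≤ ρ / 2 → (r : ℂ) * exp (φ * I) ∈ Metric.ball (0 : ℂ) ρ := by
    intro r φ hr hrs
    rw [mem_ball_zero_iff, norm_ray hr.le]
    linarith
  have hm : ∀ m : ℝ, ‖laplaceRay P.k₁ P.k₂ (fun τ => w τ m) ξ' T₁ T₂
      - laplaceRay P.k₁ P.k₂ (fun τ => w τ m) ξ T₁ T₂‖
      ≤ C * (Real.exp (K * ‖T₂‖ ^ (1 / P.k' - 1 / (P.k₂ : ℝ))⁻¹) * ‖T₁‖ + 1)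
          * Real.exp (-(Real.sin δ / 2 * (ρ / 2 / ‖T₁‖) ^ P.k₁)) * B * weight P.μ P.β m := by
    intro m
    have := h T₁ T₂ ξ (ξ' + n * (2 * Real.pi)) (B * weight P.μ P.β m) (fun τ => w τ m) hT₁ hT₂
      (mul_nonneg hB (weight_pos _ _ _).le) hn hdec
      (fun r hr hrs φ _ => (hw.holo m).differentiableAt
        (((isOpen_infSector d θ).union Metric.isOpen_ball).mem_nhds (Or.inr (hball r φ hr hrs))))
      (fun r hr hrs φ _ => norm_ray_le_of_inExpBall hw hr
        (Or.inr (Metric.ball_subset_closedBall (hball r φ hr hrs))) m)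
      (by
        rintro φ (rfl | rfl)
        · exact integrableOn_rayIntegrand hP.one_le_k₁ hP.k₁_lt_k₂ (k'_pos hP) hP.k'_lt_k₂ hM hray m
        · have := integrableOn_rayIntegrand (T₁ := T₁) hP.one_le_k₁ hP.k₁_lt_k₂ (k'_pos hP)
            hP.k'_lt_k₂ hM' hray' m
          unfold rayIntegrand at this ⊢
          simpa only [exp_add_int_mul_two_pi] using this)
      (by
        rintro φ (rfl | rfl) r hr
        · exact norm_ray_le_of_inExpBall hw hr (Or.inl (ray_mem_infSector hξ.1 hr)) m
        · rw [exp_add_int_mul_two_pi]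
          exact norm_ray_le_of_inExpBall hw' hr (Or.inl (ray_mem_infSector hξ'.1 hr)) m)
    rw [laplaceRay_add_int_mul_two_pi] at this
    exact this.trans (le_of_eq (by ring))
  rw [transform, transform, invFourier_sub
    (integrable_laplaceRay_mul_exp hP.one_le_k₁ hP.k₁_lt_k₂ (k'_pos hP) hP.k'_lt_k₂ hM' hray' hzβ)
    (integrable_laplaceRay_mul_exp hP.one_le_k₁ hP.k₁_lt_k₂ (k'_pos hP) hP.k'_lt_k₂ hM hray hzβ)]
  exact (norm_invFourier_le hμ hβ' hm hz).trans (le_of_eq (by ring))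

end MainData

/-- The scalar estimate behind the exponential closeness of consecutive inner solutions: the
growth `exp(K y^κ)`, for `y` of the order of `x^{-j}`, is absorbed by the decay
`exp(-c (s/t)^k)`, for `t` of the order of `x^l`, if `j κ < l k`. -/
theorem exists_mul_exp_le_exp_neg {K C c s κ R₁ R₂ X : ℝ} {k l j : ℕ} (hK : 0 ≤ K) (hC : 0 ≤ C)
    (hc : 0 < c) (hs : 0 < s) (hκ : 0 < κ) (hR₁ : 0 < R₁) (hR₂ : 0 < R₂) (hj : 0 < j)
    (h : j * κ < l * k) :
    ∃ Ct Dt : ℝ, 0 < Ct ∧ 0 < Dt ∧ ∀ x t y : ℝ, 0 < x → x ≤ X → 0 < t → t ≤ x ^ l * R₁ → 0 ≤ y →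
      y ≤ R₂ * x⁻¹ ^ j →
      C * (Real.exp (K * y ^ κ) * t + 1) * Real.exp (-(c * (s / t) ^ k))
        ≤ Ct * Real.exp (-Dt / x ^ (l * k)) := by
  set D := c * (s / R₁) ^ k with hD
  have hD0 : 0 < D := by positivity
  -- Young's inequality again, with `T = 1` and `r = 1/x`: the growth of order `x^{-jκ}` in the
  -- exponent costs half of the decay of order `x^{-lk}`, plus a constant.
  obtain ⟨K', hK', hy⟩ := exists_mul_rpow_le_rpow_add (p := j * κ) (q := l * k)
    (ν := K * R₂ ^ κ) (b := D / 2) (by positivity) h (by positivity) (half_pos hD0)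
  refine ⟨C * (Real.exp K' * (|X| ^ l * R₁) + 1) + 1, D / 2, by positivity, half_pos hD0,
    fun x t y hx hX ht htx hy0 hyx => ?_⟩
  have hxl : x ^ l ≤ |X| ^ l := pow_le_pow_left₀ hx.le (hX.trans (le_abs_self X)) l
  set Y := x⁻¹ ^ (l * k) with hY
  have hY0 : 0 < Y := by positivity
  have e1 : K * y ^ κ ≤ D / 2 * Y + K' := by
    have h1 := hy 1 one_pos x⁻¹ (by positivity)
    rw [div_one, Real.one_rpow, mul_one, Real.rpow_mul (by positivity), Real.rpow_natCast] at h1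
    have h2 : (x⁻¹ : ℝ) ^ ((l : ℝ) * k) = Y := by
      rw [hY, ← Real.rpow_natCast]; push_cast; rfl
    rw [h2] at h1
    refine le_trans ?_ h1
    rw [mul_assoc, ← Real.mul_rpow hR₂.le (by positivity)]
    exact mul_le_mul_of_nonneg_left (Real.rpow_le_rpow hy0 hyx hκ.le) hK
  have e2 : D * Y ≤ c * (s / t) ^ k := by
    rw [hD, mul_assoc]
    refine mul_le_mul_of_nonneg_left ?_ hc.le
    calc (s / R₁) ^ k * Y = (s / (x ^ l * R₁)) ^ k := by
          rw [hY, pow_mul, ← mul_pow, inv_pow]; congr 1; field_simp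
      _ ≤ _ := by gcongr
  have e3 : -(D / 2) / x ^ (l * k) = -(D / 2 * Y) := by
    rw [hY, inv_pow]; ring
  rw [e3]
  have hE : 1 ≤ Real.exp (D / 2 * Y) := Real.one_le_exp (by positivity)
  calc C * (Real.exp (K * y ^ κ) * t + 1) * Real.exp (-(c * (s / t) ^ k))
      ≤ C * (Real.exp (D / 2 * Y + K') * (|X| ^ l * R₁) + 1 * Real.exp (D / 2 * Y))
          * Real.exp (-(D * Y)) := by
        gcongr
        · exact htx.trans (by gcongr)
        · linarith
    _ = C * (Real.exp K' * (|X| ^ l * R₁) + 1) * (Real.exp (D / 2 * Y) * Real.exp (-(D * Y))) := by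
        rw [Real.exp_add]; ring
    _ = C * (Real.exp K' * (|X| ^ l * R₁) + 1) * Real.exp (-(D / 2 * Y)) := by
        rw [← Real.exp_add]; congr 2; ring
    _ ≤ _ := by gcongr; linarith

end InnerSol

end

/-! ### Assembly of the main theorem -/

theorem theorem1 (P : InnerSol.MainData) (hP : P.Valid)
    (ι : ℕ) [NeZero ι] (hι : 2 ≤ ι)
    -- the disc `D(0, ρ)` and the sectors `S_h` (bisecting direction `d h`, opening `op h`)
    (ρ : ℝ) (hρ : 0 < ρ) (d op : Fin ι → ℝ)
    (hop : ∀ h, 0 < op h ∧ op h ≤ 2 * Real.pi - Real.pi / P.k₂)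
    (hS : ∀ h, P.AvoidsRoots ρ (d h) (op h))
    (ϖ : ℝ) (hϖ : 0 < ϖ) :
    ∃ ε₁ ξψ : ℝ, 0 < ε₁ ∧ ε₁ ≤ P.ε₀ ∧ 0 < ξψ ∧
    ∀ (Cψ : ℝ) (ψ : ℂ → ℝ → ℂ → ℂ), 0 < Cψ → Cψ ≤ ξψ → P.IsForcingProfile Cψ ψ →
    ∃ w : Fin ι → ℂ → ℝ → ℂ → ℂ,
      (∀ h, ∀ ε ∈ Metric.ball (0 : ℂ) ε₁,
        P.IsBorelSolution ψ ε ρ (d h) (op h) ϖ (fun τ m => w h τ m ε)) ∧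
      ∀ (T₁ T₂ : Set ℂ) (E : Fin ι → Set ℂ),
        InnerSol.IsBddSector T₁ → InnerSol.IsInfSector T₂ → InnerSol.IsGoodCovering ι ε₁ E →
      -- admissibility, with a choice `ξ h t₁ t₂ ε` of the directions of integration
      ∀ (δ : ℝ) (ξ : Fin ι → ℂ → ℂ → ℂ → ℝ), 0 < δ →
        (∀ h, ∀ ε ∈ E h, ∀ t₁ ∈ T₁, ∀ t₂ ∈ T₂,
          P.IsDirection (InnerSol.infSector (d h) (op h)) δ t₁ t₂ ε (ξ h t₁ t₂ ε)) →
      -- the inner domain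
      ∀ (μ₂ : ℕ) (r R a b : ℝ) (θ : Fin ι → ℝ),
        P.lam₂ < μ₂ →
        ((μ₂ : ℝ) - P.lam₂) * (1 / P.k' - 1 / P.k₂)⁻¹ < P.lam₁ * P.k₁ →
        0 < r → r < R → a < b →
        (∀ h, ∀ x₂ ∈ InnerSol.annularSector r R a b, ∀ ε ∈ E h,
          InnerSol.innerTime μ₂ (θ h) ε x₂ ∈ T₂) →
      ∀ β' : ℝ, 0 < β' → β' < P.β → ∀ h,
        (∀ ε ∈ E h,
          -- the integrals defining `u` converge
          (∀ t₁ ∈ T₁, ∀ t₂ ∈ T₂, ∀ z ∈ InnerSol.strip β',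
            (∀ m : ℝ, IntegrableOn (InnerSol.rayIntegrand P.k₁ P.k₂ (fun τ => w h τ m ε)
              (ξ h t₁ t₂ ε) (ε ^ P.lam₁ * t₁) (ε ^ P.lam₂ * t₂)) (Ioi 0)) ∧
            Integrable (fun m : ℝ =>
              P.U (w h) (ξ h t₁ t₂ ε) (ε ^ P.lam₁ * t₁) (ε ^ P.lam₂ * t₂) m ε
                * exp (I * z * m))) ∧
          -- bounded and holomorphic
          DifferentiableOn ℂ (fun p : ℂ × ℂ × ℂ => P.u (w h) (ξ h) p.1 p.2.1 p.2.2 ε)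
            (T₁ ×ˢ InnerSol.innerDomain μ₂ (θ h) (InnerSol.annularSector r R a b) ε
              ×ˢ InnerSol.strip β') ∧
          (∃ M : ℝ, ∀ t₁ ∈ T₁,
            ∀ t₂ ∈ InnerSol.innerDomain μ₂ (θ h) (InnerSol.annularSector r R a b) ε,
            ∀ z ∈ InnerSol.strip β', ‖P.u (w h) (ξ h) t₁ t₂ z ε‖ ≤ M) ∧
          -- solution of the main equation
          (∀ t₁ ∈ T₁,
            ∀ t₂ ∈ InnerSol.innerDomain μ₂ (θ h) (InnerSol.annularSector r R a b) ε,
            ∀ z ∈ InnerSol.strip β',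
              P.SolvesAt ψ ε (fun s₁ s₂ y => P.u (w h) (ξ h) s₁ s₂ y ε) t₁ t₂ z) ∧
          -- zero initial data
          (∀ t₂ ∈ T₂, ∀ z ∈ InnerSol.strip β',
            Tendsto (fun t₁ => P.u (w h) (ξ h) t₁ t₂ z ε) (𝓝[T₁] 0) (𝓝 0)) ∧
          (∀ t₁ ∈ T₁, ∀ z ∈ InnerSol.strip β',
            Tendsto (fun t₂ => P.u (w h) (ξ h) t₁ t₂ z ε) (𝓝[T₂] 0) (𝓝 0))) ∧
        -- consecutive inner solutions are exponentially close
        ∃ Ct Dt : ℝ, 0 < Ct ∧ 0 < Dt ∧ ∀ ε ∈ E h ∩ E (h + 1), ∀ t₁ ∈ T₁,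
          ∀ x₂ ∈ InnerSol.annularSector r R a b, ∀ z ∈ InnerSol.strip β',
            ‖P.u (w (h + 1)) (ξ (h + 1)) t₁ (InnerSol.innerTime μ₂ (θ h) ε x₂) z ε
              - P.u (w h) (ξ h) t₁ (InnerSol.innerTime μ₂ (θ h) ε x₂) z ε‖
              ≤ Ct * Real.exp (-Dt / ‖ε‖ ^ (P.lam₁ * P.k₁)) := by
  have hk' := InnerSol.MainData.k'_pos hP
  have hk₂ : (0 : ℝ) < P.k₂ := hk'.trans hP.k'_lt_k₂
  choose e x he he' hx hsol using
    fun h => InnerSol.MainData.exists_isBorelSolution hP hρ (hS h) hϖ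
  -- There are finitely many sectors, so the smallest radius and the smallest profile size serve all
  -- of them.
  obtain ⟨i₀, hi₀⟩ := Finite.exists_min e
  obtain ⟨j₀, hj₀⟩ := Finite.exists_min x
  refine ⟨e i₀, x j₀, he i₀, he' i₀, hx j₀, fun Cψ ψ hC hCx hψ => ?_⟩
  have hB : ∀ h, ∀ ε ∈ Metric.ball (0 : ℂ) (e i₀),
      P.IsBorelSolution ψ ε ρ (d h) (op h) ϖ (P.borelSol ψ ε) := fun h ε hε =>
    hsol h Cψ ψ hC (hCx.trans (hj₀ h)) hψ ε (Metric.ball_subset_ball (hi₀ h) hε)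
  -- The Neumann series is the same for every `h`. The solutions for two sectors thus agree on the
  -- disc by construction, and the comparison of consecutive solutions is a comparison of half lines
  -- for a single function.
  refine ⟨fun _ τ m ε => P.borelSol ψ ε τ m, hB, ?_⟩
  intro T₁ T₂ E hT₁ hT₂ hE δ ξ hδ hξ μ₂ r R a b θ hμ₂ hgap hr hrR hab hinner β' hβ'0 hβ' h
  obtain ⟨d₁, θ₁, R₁, hθ₁, -, hR₁, rfl⟩ := hT₁
  obtain ⟨d₂, θ₂, hθ₂, -, rfl⟩ := hT₂
  have hT₁0 : ∀ t ∈ InnerSol.bddSector d₁ θ₁ R₁, t ≠ 0 := fun t ht =>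
    InnerSol.ne_zero_of_mem_infSector (InnerSol.bddSector_eq_inter d₁ θ₁ R₁ ▸ ht).1
  have hT₁R : ∀ t ∈ InnerSol.bddSector d₁ θ₁ R₁, ‖t‖ ≤ R₁ := fun t ht =>
    (mem_ball_zero_iff.1 (InnerSol.bddSector_eq_inter d₁ θ₁ R₁ ▸ ht).2).le
  have hT₂0 : ∀ t ∈ InnerSol.infSector d₂ θ₂, t ≠ 0 := fun t ht =>
    InnerSol.ne_zero_of_mem_infSector ht
  have hE0 : ∀ i, ∀ ε ∈ E i, ε ≠ 0 := by
    intro i ε hε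
    obtain ⟨d₃, θ₃, R₃, -, -, -, h3⟩ := hE.sector i
    rw [h3, InnerSol.bddSector_eq_inter] at hε
    exact InnerSol.ne_zero_of_mem_infSector hε.1
  have hsin : 0 < Real.sin δ := by
    obtain ⟨ε, hε, -⟩ := hE.inter h
    obtain ⟨t₁, ht₁⟩ := InnerSol.bddSector_nonempty d₁ hθ₁ hR₁
    obtain ⟨t₂, ht₂⟩ := InnerSol.infSector_nonempty d₂ hθ₂
    exact (hξ h ε hε t₁ ht₁ t₂ ht₂).sin_pos hδ
  have hκ : 0 < (1 / P.k' - 1 / (P.k₂ : ℝ))⁻¹ :=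
    inv_pos.2 (sub_pos.2 (one_div_lt_one_div_of_lt hk' hP.k'_lt_k₂))
  have hstrip : InnerSol.strip β' ⊆ InnerSol.strip P.β := fun z hz => lt_trans hz hβ'
  have hn₁ : ∀ ε : ℂ, ε ≠ 0 → ∀ t₁ ∈ InnerSol.bddSector d₁ θ₁ R₁, ε ^ P.lam₁ * t₁ ≠ 0 :=
    fun ε hε t ht => mul_ne_zero (pow_ne_zero _ hε) (hT₁0 t ht)
  have hn₂ : ∀ ε : ℂ, ε ≠ 0 → ∀ t₂ ∈ InnerSol.infSector d₂ θ₂, ε ^ P.lam₂ * t₂ ≠ 0 :=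
    fun ε hε t ht => mul_ne_zero (pow_ne_zero _ hε) (hT₂0 t ht)
  have hnorm₁ : ∀ ε : ℂ, ∀ t₁ ∈ InnerSol.bddSector d₁ θ₁ R₁,
      ‖ε ^ P.lam₁ * t₁‖ ≤ ‖ε‖ ^ P.lam₁ * R₁ := fun ε t ht => by
    rw [norm_mul, norm_pow]
    exact mul_le_mul_of_nonneg_left (hT₁R t ht) (by positivity)
  have hnorm₂ : ∀ i, ∀ ε ∈ E i, ∀ x₂ ∈ InnerSol.annularSector r R a b,
      ‖ε ^ P.lam₂ * InnerSol.innerTime μ₂ (θ i) ε x₂‖ ≤ R * ‖ε‖⁻¹ ^ (μ₂ - P.lam₂) := by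
    intro i ε hε x₂ hx₂
    rw [InnerSol.norm_pow_mul_innerTime hμ₂.le (hE0 i ε hε)]
    exact mul_le_mul_of_nonneg_right
      (InnerSol.norm_mem_Ioo_of_mem_annularSector hr.le hx₂).2.le (by positivity)
  refine ⟨fun ε hε => ?_, ?_⟩
  · have hε0 := hE0 h ε hε
    have hεb := hE.subset h hε
    have hsolε := hB h ε hεb
    have hM := InnerSol.MainData.moderate_of_inExpBall hP hϖ.le hsolε.mem
    have hray : ∀ t₁ ∈ InnerSol.bddSector d₁ θ₁ R₁, ∀ t₂ ∈ InnerSol.infSector d₂ θ₂,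
        InnerSol.IsRay P.k₂ (InnerSol.infSector (d h) (op h)) (ε ^ P.lam₂ * t₂) (ξ h t₁ t₂ ε) :=
      fun t₁ ht₁ t₂ ht₂ => (hξ h ε hε t₁ ht₁ t₂ ht₂).isRay hδ (hn₂ ε hε0 t₂ ht₂)
    have hfield : InnerSol.IsRayField P.k₁ P.k₂ P.k' P.β (d h) (op h) P.lam₂ ε
        (InnerSol.bddSector d₁ θ₁ R₁) (InnerSol.infSector d₂ θ₂) (fun t₁ t₂ => ξ h t₁ t₂ ε) :=
      { one_le_k₁ := hP.one_le_k₁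
        k₁_lt_k₂ := hP.k₁_lt_k₂
        k'_pos := hk'
        k'_lt_k₂ := hP.k'_lt_k₂
        β_pos := hP.β_pos
        opening_le := (hop h).2
        isOpen_fst := by
          rw [InnerSol.bddSector_eq_inter]
          exact (InnerSol.isOpen_infSector _ _).inter Metric.isOpen_ball
        isOpen_snd := InnerSol.isOpen_infSector _ _
        fst_ne_zero := hT₁0
        ε_ne_zero := hε0
        isRay := hray }
    obtain ⟨K, C, hK, hC0, hbound⟩ :=
      InnerSol.MainData.exists_norm_transform_le hP hsin hβ' hϖ.le
    have hb := fun t₁ ht₁ t₂ ht₂ z hz => hbound ρ (d h) (op h) (ξ h t₁ t₂ ε) (P.borelSol ψ ε)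
      (ε ^ P.lam₁ * t₁) (ε ^ P.lam₂ * t₂) z (hn₁ ε hε0 t₁ ht₁) (hn₂ ε hε0 t₂ ht₂) hsolε.mem
      (hξ h ε hε t₁ ht₁ t₂ ht₂).1 ((hξ h ε hε t₁ ht₁ t₂ ht₂).isDecaying hδ) hz
    have hdom : InnerSol.innerDomain μ₂ (θ h) (InnerSol.annularSector r R a b) ε
        ⊆ InnerSol.infSector d₂ θ₂ := by
      rintro _ ⟨x₂, hx₂, rfl⟩
      exact hinner h x₂ hx₂ ε hε
    refine ⟨fun t₁ ht₁ t₂ ht₂ z hz => ⟨fun m => ?_, ?_⟩, ?_, ?_, ?_, ?_, ?_⟩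
    · exact InnerSol.integrableOn_rayIntegrand hP.one_le_k₁ hP.k₁_lt_k₂ hk' hP.k'_lt_k₂ hM
        (hray t₁ ht₁ t₂ ht₂) m
    · exact InnerSol.integrable_laplaceRay_mul_exp hP.one_le_k₁ hP.k₁_lt_k₂ hk' hP.k'_lt_k₂ hM
        (hray t₁ ht₁ t₂ ht₂) (hstrip hz)
    · rintro ⟨t₁, t₂, z⟩ ⟨ht₁, ht₂, hz⟩
      exact (hfield.differentiableAt (l₁ := P.lam₁) hM ht₁ (hdom ht₂)
        (hstrip hz)).differentiableWithinAt
    -- On the inner domain `|ε^{λ₂} t₂|` is at most `R |ε|^{-(μ₂-λ₂)}`, which bounds the exponential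
    -- factor for fixed `ε`; on the unbounded sector `T₂` this bound would not be uniform.
    · refine ⟨C * Real.exp (K * (R * ‖ε‖⁻¹ ^ (μ₂ - P.lam₂)) ^ (1 / P.k' - 1 / (P.k₂ : ℝ))⁻¹)
        * (‖ε‖ ^ P.lam₁ * R₁), fun t₁ ht₁ t₂ ht₂ z hz => ?_⟩
      refine (hb t₁ ht₁ t₂ (hdom ht₂) z hz).1.trans ?_
      obtain ⟨x₂, hx₂, rfl⟩ := ht₂
      have h1 := hnorm₁ ε t₁ ht₁
      have h2 := Real.rpow_le_rpow (norm_nonneg _) (hnorm₂ h ε hε x₂ hx₂) hκ.le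
      gcongr
    · intro t₁ ht₁ t₂ ht₂ z hz
      exact InnerSol.MainData.solvesAt_fieldTransform hP hψ hC.le
        (Metric.ball_subset_ball (he' i₀) hεb) hfield hM
        (fun τ hτ => hsolε.solves τ (Or.inl hτ)) ht₁ (hdom ht₂) (hstrip hz)
    · intro t₂ ht₂ z hz
      refine squeeze_zero_norm' (eventually_mem_nhdsWithin.mono fun t₁ ht₁ =>
        (hb t₁ ht₁ t₂ ht₂ z hz).1) ?_
      refine Tendsto.mono_left (Continuous.tendsto' ?_ _ _ (by simp)) nhdsWithin_le_nhds
      fun_prop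
    · intro t₁ ht₁ z hz
      refine squeeze_zero_norm' (eventually_mem_nhdsWithin.mono fun t₂ ht₂ =>
        (hb t₁ ht₁ t₂ ht₂ z hz).2) ?_
      refine Tendsto.mono_left (Continuous.tendsto' ?_ _ _ (by simp)) nhdsWithin_le_nhds
      have : Continuous fun t : ℂ => ‖ε ^ P.lam₂ * t‖ ^ (1 / P.k' - 1 / (P.k₂ : ℝ))⁻¹ :=
        Continuous.rpow_const (by fun_prop) fun _ => Or.inr hκ.le
      fun_prop
  · obtain ⟨K, C, hK, hC0, hbound⟩ :=
      InnerSol.MainData.exists_norm_transform_sub_le hP hδ hsin hβ' hϖ.le hρ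
    -- Here `x = |ε|`, bounded by the radius `e i₀`, and `j = μ₂ - λ₂`. The required inequality `j κ
    -- < λ₁ k₁` is the gap condition on `μ₂`, which also rules out `λ₁ = 0`.
    obtain ⟨Ct, Dt, hCt, hDt, hest⟩ := InnerSol.exists_mul_exp_le_exp_neg (X := e i₀)
      (k := P.k₁) (l := P.lam₁) (j := μ₂ - P.lam₂) hK hC0 (half_pos hsin) (half_pos hρ) hκ hR₁
      (hr.trans hrR) (Nat.sub_pos_of_lt hμ₂) (by rwa [Nat.cast_sub hμ₂.le])
    refine ⟨Ct, Dt, hCt, hDt, fun ε hε t₁ ht₁ x₂ hx₂ z hz => ?_⟩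
    have hε0 := hE0 h ε hε.1
    -- The angle `θ h` is used for both solutions. It places the point in `T₂`, and admissibility
    -- for `h + 1` holds at every point of `T₂`, so `θ (h + 1)` plays no role.
    have ht₂ := hinner h x₂ hx₂ ε hε.1
    refine (hbound (d h) (op h) (d (h + 1)) (op (h + 1)) _ _ (P.borelSol ψ ε) t₁ _ ε z
      (hn₁ ε hε0 t₁ ht₁) (hn₂ ε hε0 _ ht₂) (hB h ε (hE.subset h hε.1)).mem
      (hB (h + 1) ε (hE.subset h hε.1)).mem (hξ h ε hε.1 t₁ ht₁ _ ht₂)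
      (hξ (h + 1) ε hε.2 t₁ ht₁ _ ht₂) hz).trans ?_
    exact hest ‖ε‖ _ _ (norm_pos_iff.2 hε0) (mem_ball_zero_iff.1 (hE.subset h hε.1)).le
      (norm_pos_iff.2 (hn₁ ε hε0 t₁ ht₁)) (hnorm₁ ε t₁ ht₁) (norm_nonneg _)
      (hnorm₂ h ε hε.1 x₂ hx₂)
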